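/- Let $V=[n]=\{1,\dots,n\}$. A $k$-graph on $V$ is a set of $k$-element subsets of $V$ (its edges), and the degree of a vertex is the number of edges containing it. For integers $k,n,m$ and a real $\varphi$ write $$d=\frac{km}{n},\qquad \mu=m\binom nk^{-1},$$ and let $\mathfrak D=\mathfrak D(n,k,m,\varphi)$ be the set of integer sequences $\mathbf d=(d_v)_{v\in V}$ with $\sum_{v\in V}d_v=dn=km$ and $|d_v-d|\le d^{1-\varphi}$ for all $v\in V$. For a $k$-element set $K\subseteq V$ let $P_K(\mathbf d)$ be the probability that $K$ is an edge of a $k$-graph chosen uniformly at random among all $k$-graphs on $V$ with degree sequence $\mathbf d$. There exist constants $c>0$, $C>0$ and $N$ such that the following holds for all integers $n\ge N$, $k\ge 3$, $m\ge 0$ and all $\varphi\in(4/9,1/2)$ satisfying $$k\,d^{-\varphi}<c,\qquad k\mu+\frac{k^2}{n}<c,\qquad \log^3 n<d .$$ For every $\mathbf d\in\mathfrak D$ there is at least one $k$-graph on $V$ with degree sequence $\mathbf d$ (so $P_K(\mathbf d)$ is defined), and for every $k$-element set $K\subseteq V$ there is a real $\delta$ with $|\delta|\le C\,k^2d^{-2\varphi}$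 and $$P_K(\mathbf d)=\binom{n-1}{k-1}^{-1}\left(d+\frac{n-1}{n-k}\sum_{v\in K}(d_v-d)\right)(1+\delta).$$ -/

import Mathlib

namespace KGraph

variable {V : Type*} [Fintype V] [DecidableEq V]

/-- A `k`-graph on the vertex set `V`: a collection of `k`-element subsets of `V`. -/
def IsKGraph (k : ℕ) (H : Finset (Finset V)) : Prop :=
  ∀ e ∈ H, e.card = k

/-- The degree of `v` in `H`: the number of edges that contain `v`. -/
def degree (H : Finset (Finset V)) (v : V) : ℕ :=
  (H.filter (fun e => v ∈ e)).card

open Classical in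
/-- The set of all `k`-graphs on `V` with degree sequence `d`. -/
noncomputable def withDegrees (k : ℕ) (d : V → ℤ) : Finset (Finset (Finset V)) :=
  Finset.univ.filter (fun H => IsKGraph k H ∧ ∀ v, (degree H v : ℤ) = d v)

/-- The probability that a uniformly random `k`-graph with degree sequence `d` has `K` as an
edge (meaningful when there is at least one such `k`-graph). -/
noncomputable def edgeProb (k : ℕ) (d : V → ℤ) (K : Finset V) : ℝ :=
  (((withDegrees k d).filter (fun H => K ∈ H)).card : ℝ) / ((withDegrees k d).card : ℝ)

/-- The average degree `km/n` of a `k`-graph with `n` vertices and `m` edges. -/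
noncomputable def avgDegree (n k m : ℕ) : ℝ := (k : ℝ) * (m : ℝ) / (n : ℝ)

/-- The edge density `m / (n choose k)`. -/
noncomputable def density (n k m : ℕ) : ℝ := (m : ℝ) / (n.choose k : ℝ)

/-- Integer sequences of length `n` with sum `km` whose entries all differ from the average
`D = km/n` by at most `D ^ (1 - φ)`. -/
def nearlyRegular (n k m : ℕ) (φ : ℝ) : Set (Fin n → ℤ) :=
  {d | ∑ v, d v = (k : ℤ) * (m : ℤ) ∧
    ∀ v, |(d v : ℝ) - avgDegree n k m| ≤ avgDegree n k m ^ (1 - φ)}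

end KGraph

/-!
The probability `P_K(d)` that `K` is an edge is determined, up to the claimed error, by exact
relations between edge probabilities at neighbouring degree sequences. The proof has two stages:
bounds up to a constant factor, and a bootstrap that sharpens them.

**Bounds up to a constant factor.** For vertices `x ≠ y` let `side F H x y` be the family of sets
`g` such that `g ∪ {x}` is an edge of `H` and `g ∪ {y}` is not (`F` is a set of at most two frozen
potential edges). Exchanging a member of `side F H x y` with one of `side F H y x` preserves all
degrees and is reversible (`Family.sum_exch`), so all ratios of probabilities follow from ratios of
the numbers of such switchings. The sizes of the two sides differ by about `d x - d y`, which is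
small compared with their sum `disc F H x y`, provided that this sum is of order `D`, the mean
degree. That it almost always is (`Family.card_disc_lt`) is the main point. It fails for a pair only
if `x` and `y` have many common link sets, or a large codegree. On average over all pairs the former
are bounded by the second moment of the codegrees of `(k-1)`-sets. The Poincaré inequality
(`poincare`) reduces that moment to the differences between two sides above `(k-2)`-sets, and the
switchings show that these behave like sums of independent signs (`Family.sum_sideOver_sub_sq_le`,
`Family.sum_com_le`). A birth-and-death argument transfers a large discrepancy from the pair `a, c`
to the pair `a, b` (`Family.card_disc_lt_le`); applied twice, it turns the average over all pairs
into a bound for every pair. Consequences are the existence of a graph (`nonempty_withDegrees`: from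
an almost regular sequence, single units of degree are moved until `d` is reached) and bounds for
all edge probabilities up to a constant factor (`edgeProb_apriori`).

**The bootstrap.** Removing an edge `K` relates degree sequence `d` to `sub1 d K`. This expresses
the probability that both `K` and `L` are edges in terms of probabilities at `sub1 d K`
(`pairProb_recursion`). For `K = f ∪ {a}` and `L = f ∪ {b}`, counting moves of an edge from `a` to
`b` relates `P_K(d) / P_L(d)` to the same kind of quantities at `sub1 d K` and `sub1 d L`
(`edgeProb_switch`). Suppose that in the region of degree sequences within `τ + 1` of `D` the
edge probabilities agree with the claimed formula up to a relative error `η`, and that the events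
for two different sets are independent up to a relative error of the same order. Inserted into the
two relations, whose error terms carry an additional small factor, this gives the same in the region
of radius `τ`, with `η` replaced by `40 k² ε² + η / 2` (`Estimate.improve`). Here the first-order
contributions of `d a - d b` cancel (`switch_ratio`), and the absolute size of the probabilities
follows from the ratios because both they and their approximations sum to the number of edges
(`abs_edgeProb_sub_le_of_adjacent`). The bootstrap starts from `η = 1` and a region whose radius is
three times the admitted deviation `T = D ^ (1 - φ)`. There is room for `⌊T⌋` steps, after which
only an error of order `k² ε²` with `ε = 3 D ^ (-φ)` remains.
-/

namespace KGraph

open Finset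

set_option linter.unusedSectionVars false

variable {V : Type*} [Fintype V] [DecidableEq V]

/-! ### Links and exchanges of two edges -/

theorem mem_withDegrees {k : ℕ} {d : V → ℤ} {H : Finset (Finset V)} :
    H ∈ withDegrees k d ↔ IsKGraph k H ∧ ∀ v, (degree H v : ℤ) = d v := by
  simp [withDegrees]

/-- The sets `g` avoiding `x` and `y` such that `g ∪ {x}` is an edge and `g ∪ {y}` is not, where
neither of the two sets belongs to the family `F` of frozen sets. -/
def side (F H : Finset (Finset V)) (x y : V) : Finset (Finset V) :=
  univ.filter fun g => x ∉ g ∧ y ∉ g ∧ insert x g ∈ H ∧ insert y g ∉ H ∧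
    insert x g ∉ F ∧ insert y g ∉ F

/-- The switching that replaces the edges `g ∪ {x}`, `l ∪ {y}` by `g ∪ {y}`, `l ∪ {x}`. -/
def exch (H : Finset (Finset V)) (x y : V) (g l : Finset V) : Finset (Finset V) :=
  (H \ {insert x g, insert y l}) ∪ {insert y g, insert x l}

theorem mem_side {F H : Finset (Finset V)} {x y : V} {g : Finset V} :
    g ∈ side F H x y ↔ x ∉ g ∧ y ∉ g ∧ insert x g ∈ H ∧ insert y g ∉ H ∧
      insert x g ∉ F ∧ insert y g ∉ F := by
  simp [side]

theorem insert_inj_left {x : V} {g h : Finset V} (hg : x ∉ g) (hh : x ∉ h) :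
    insert x g = insert x h ↔ g = h := by
  constructor
  · intro h1
    rw [← erase_insert hg, h1, erase_insert hh]
  · rintro rfl; rfl

theorem insert_ne_insert {x y : V} {g h : Finset V} (hxy : x ≠ y) (hh : x ∉ h) :
    insert x g ≠ insert y h := by
  intro h1
  have : x ∈ insert y h := h1 ▸ mem_insert_self x g
  simp_all

theorem mem_exch {H : Finset (Finset V)} {x y : V} {g l e : Finset V} :
    e ∈ exch H x y g l ↔ (e ∈ H ∧ e ≠ insert x g ∧ e ≠ insert y l) ∨ e = insert y g ∨
      e = insert x l := by
  simp only [exch, mem_union, mem_sdiff, mem_insert, mem_singleton, not_or]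

section Exch

variable {F H : Finset (Finset V)} {x y : V} {g l : Finset V}

theorem insert_left_mem_exch (hxy : x ≠ y) (hg : g ∈ side F H x y) (hl : l ∈ side F H y x)
    {h : Finset V} (hx : x ∉ h) :
    insert x h ∈ exch H x y g l ↔ (insert x h ∈ H ∧ h ≠ g) ∨ h = l := by
  rw [mem_side] at hg hl
  rw [mem_exch, Ne, Ne, insert_inj_left hx hg.1, insert_inj_left hx hl.2.1]
  have h1 : insert x h ≠ insert y l := insert_ne_insert hxy hl.2.1
  have h2 : insert x h ≠ insert y g := insert_ne_insert hxy hg.1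
  tauto

theorem insert_right_mem_exch (hxy : x ≠ y) (hg : g ∈ side F H x y) (hl : l ∈ side F H y x)
    {h : Finset V} (hy : y ∉ h) :
    insert y h ∈ exch H x y g l ↔ (insert y h ∈ H ∧ h ≠ l) ∨ h = g := by
  rw [mem_side] at hg hl
  rw [mem_exch, Ne, Ne, insert_inj_left hy hg.2.1, insert_inj_left hy hl.1]
  have h1 : insert y h ≠ insert x l := insert_ne_insert hxy.symm hl.1
  have h2 : insert y h ≠ insert x g := insert_ne_insert hxy.symm hg.2.1
  tauto

/-- The switching only affects sets that contain exactly one of `x` and `y`. -/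
theorem mem_exch_of_iff (hxy : x ≠ y) (hg : g ∈ side F H x y) (hl : l ∈ side F H y x)
    {e : Finset V} (he : x ∈ e ↔ y ∈ e) : e ∈ exch H x y g l ↔ e ∈ H := by
  rw [mem_side] at hg hl
  rw [mem_exch]
  have h1 : e ≠ insert x g := by
    rintro rfl; simp [hg.2.1, hxy.symm] at he
  have h2 : e ≠ insert y l := by
    rintro rfl; simp [hl.2.1, hxy] at he
  have h3 : e ≠ insert y g := by
    rintro rfl; simp [hg.1, hxy] at he
  have h4 : e ≠ insert x l := by
    rintro rfl; simp [hl.1, hxy.symm] at he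
  tauto

theorem mem_exch_of_mem_frozen (hg : g ∈ side F H x y) (hl : l ∈ side F H y x)
    {e : Finset V} (he : e ∈ F) : e ∈ exch H x y g l ↔ e ∈ H := by
  rw [mem_side] at hg hl
  rw [mem_exch]
  have h1 : e ≠ insert x g := by rintro rfl; tauto
  have h2 : e ≠ insert y l := by rintro rfl; tauto
  have h3 : e ≠ insert y g := by rintro rfl; tauto
  have h4 : e ≠ insert x l := by rintro rfl; tauto
  tauto

theorem side_exch (hxy : x ≠ y) (hg : g ∈ side F H x y) (hl : l ∈ side F H y x) :
    side F (exch H x y g l) x y = insert l ((side F H x y).erase g) := by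
  ext h
  by_cases hx : x ∈ h
  · rw [mem_side] at hl
    have : h ≠ l := by rintro rfl; tauto
    simp [mem_side, hx, this]
  by_cases hy : y ∈ h
  · rw [mem_side] at hl
    have : h ≠ l := by rintro rfl; tauto
    simp [mem_side, hy, this]
  rw [mem_side, insert_left_mem_exch hxy hg hl hx, insert_right_mem_exch hxy hg hl hy]
  simp only [mem_insert, mem_erase, mem_side]
  rw [mem_side] at hg hl
  by_cases h1 : h = l
  · subst h1
    have : h ≠ g := by rintro rfl; tauto
    tauto
  · by_cases h2 : h = g
    · subst h2; tauto
    · tauto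

theorem exch_symm (H : Finset (Finset V)) (x y : V) (g l : Finset V) :
    exch H x y g l = exch H y x l g := by
  unfold exch; rw [pair_comm (insert x g), pair_comm (insert y g)]

theorem side_exch' (hxy : x ≠ y) (hg : g ∈ side F H x y) (hl : l ∈ side F H y x) :
    side F (exch H x y g l) y x = insert g ((side F H y x).erase l) := by
  rw [exch_symm, side_exch hxy.symm hl hg]

theorem card_side_exch (hxy : x ≠ y) (hg : g ∈ side F H x y) (hl : l ∈ side F H y x) :
    (side F (exch H x y g l) x y).card = (side F H x y).card := by
  rw [side_exch hxy hg hl, card_insert_of_notMem, card_erase_of_mem hg]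
  · have := card_pos.mpr ⟨g, hg⟩; omega
  · rw [mem_erase, not_and]; intro _ h
    rw [mem_side] at hl h; tauto

theorem card_side_exch' (hxy : x ≠ y) (hg : g ∈ side F H x y) (hl : l ∈ side F H y x) :
    (side F (exch H x y g l) y x).card = (side F H y x).card := by
  rw [side_exch' hxy hg hl, card_insert_of_notMem, card_erase_of_mem hl]
  · have := card_pos.mpr ⟨l, hl⟩; omega
  · rw [mem_erase, not_and]; intro _ h
    rw [mem_side] at hg h; tauto

theorem exch_exch (hxy : x ≠ y) (hg : g ∈ side F H x y) (hl : l ∈ side F H y x) :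
    exch (exch H x y g l) x y l g = H := by
  rw [mem_side] at hg hl
  have h1 : insert x g ≠ insert y l := insert_ne_insert hxy hl.2.1
  have h2 : insert x g ≠ insert y g := insert_ne_insert hxy hg.1
  have h3 : insert x l ≠ insert y l := insert_ne_insert hxy hl.2.1
  have h4 : insert x l ≠ insert y g := insert_ne_insert hxy hg.1
  have h5 : insert x g ≠ insert x l := by
    intro h; rw [insert_inj_left hg.1 hl.2.1] at h; subst h; tauto
  have h6 : insert y g ≠ insert y l := by
    intro h; rw [insert_inj_left hg.2.1 hl.1] at h; subst h; tauto
  ext e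
  rw [mem_exch, mem_exch]
  by_cases e1 : e = insert x g
  · subst e1; tauto
  by_cases e2 : e = insert y l
  · subst e2; tauto
  by_cases e3 : e = insert x l
  · subst e3; tauto
  by_cases e4 : e = insert y g
  · subst e4; tauto
  tauto

theorem degree_eq_sum (H : Finset (Finset V)) (v : V) :
    degree H v = ∑ e ∈ H, if v ∈ e then 1 else 0 := by
  rw [degree, card_filter]

theorem degree_exch (hxy : x ≠ y) (hg : g ∈ side F H x y) (hl : l ∈ side F H y x) (v : V) :
    degree (exch H x y g l) v = degree H v := by
  rw [mem_side] at hg hl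
  have h1 : insert x g ≠ insert y l := insert_ne_insert hxy hl.2.1
  have h4 : insert y g ≠ insert x l := insert_ne_insert hxy.symm hl.1
  have hsub : ({insert x g, insert y l} : Finset (Finset V)) ⊆ H := by
    intro e; simp only [mem_insert, mem_singleton]; rintro (rfl | rfl) <;> tauto
  have hdis : Disjoint (H \ {insert x g, insert y l})
      ({insert y g, insert x l} : Finset (Finset V)) := by
    rw [disjoint_left]; intro e he; simp only [mem_insert, mem_singleton, mem_sdiff] at he ⊢
    rintro (rfl | rfl) <;> tauto
  rw [degree_eq_sum, degree_eq_sum, exch, sum_union hdis, ← sum_sdiff hsub, sum_pair h1,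
    sum_pair h4]
  simp only [mem_insert]
  by_cases hvx : v = x
  · subst hvx; simp [hxy, hg.1, hl.2.1]
  · by_cases hvy : v = y
    · subst hvy; simp [hxy.symm, hg.2.1, hl.1]
    · simp [hvx, hvy]

theorem exch_mem_withDegrees {k : ℕ} {d : V → ℤ} (hxy : x ≠ y) (hg : g ∈ side F H x y)
    (hl : l ∈ side F H y x) (hH : H ∈ withDegrees k d) : exch H x y g l ∈ withDegrees k d := by
  rw [mem_withDegrees] at hH ⊢
  refine ⟨?_, fun v => by rw [degree_exch hxy hg hl, hH.2]⟩
  rw [mem_side] at hg hl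
  intro e he
  rw [mem_exch] at he
  have h1 := hH.1 _ hg.2.2.1
  have h2 := hH.1 _ hl.2.2.1
  rw [card_insert_of_notMem hg.1] at h1
  rw [card_insert_of_notMem hl.1] at h2
  rcases he with he | rfl | rfl
  · exact hH.1 _ he.1
  · rw [card_insert_of_notMem hg.2.1, h1]
  · rw [card_insert_of_notMem hl.2.1, h2]

end Exch

/-- `𝒢` consists of `k`-graphs with degree sequence `d`, and whether such a `k`-graph belongs to
`𝒢` depends only on which of the frozen sets, the members of `F`, are among its edges. Switchings
that do not touch frozen sets therefore stay in `𝒢`. -/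
structure Family (k : ℕ) (d : V → ℤ) (F : Finset (Finset V))
    (𝒢 : Finset (Finset (Finset V))) : Prop where
  sub : ∀ H ∈ 𝒢, H ∈ withDegrees k d
  closed : ∀ H ∈ 𝒢, ∀ H' ∈ withDegrees k d, (∀ e ∈ F, e ∈ H' ↔ e ∈ H) → H' ∈ 𝒢

theorem family_withDegrees (k : ℕ) (d : V → ℤ) (F : Finset (Finset V)) :
    Family k d F (withDegrees k d) := ⟨fun _ h => h, fun _ _ _ h _ => h⟩

section Engine

variable {k : ℕ} {d : V → ℤ} {F : Finset (Finset V)} {𝒢 : Finset (Finset (Finset V))}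

theorem Family.exch_mem (h𝒢 : Family k d F 𝒢) {x y : V} (hxy : x ≠ y)
    {H : Finset (Finset V)} (hH : H ∈ 𝒢) {g l : Finset V}
    (hg : g ∈ side F H x y) (hl : l ∈ side F H y x) : exch H x y g l ∈ 𝒢 :=
  h𝒢.closed H hH _ (exch_mem_withDegrees hxy hg hl (h𝒢.sub H hH))
    fun _ he => mem_exch_of_mem_frozen hg hl he

/-- Double counting along the switchings at `x` and `y`: reversing a switching is a bijection. -/
theorem Family.sum_exch (h𝒢 : Family k d F 𝒢) {x y : V} (hxy : x ≠ y)
    (Φ : Finset (Finset V) → Finset V → Finset V → ℝ) :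
    ∑ H ∈ 𝒢, ∑ g ∈ side F H x y, ∑ l ∈ side F H y x, Φ H g l =
      ∑ H ∈ 𝒢, ∑ g ∈ side F H x y, ∑ l ∈ side F H y x, Φ (exch H x y g l) l g := by
  simp only [← sum_product', sum_sigma']
  refine sum_nbij' (fun p => ⟨exch p.1 x y p.2.1 p.2.2, (p.2.2, p.2.1)⟩)
    (fun p => ⟨exch p.1 x y p.2.1 p.2.2, (p.2.2, p.2.1)⟩) ?_ ?_ ?_ ?_ ?_
  · rintro ⟨H, g, l⟩ hp
    simp only [mem_sigma, mem_product] at hp ⊢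
    refine ⟨h𝒢.exch_mem hxy hp.1 hp.2.1 hp.2.2, ?_, ?_⟩
    · rw [side_exch hxy hp.2.1 hp.2.2]; exact mem_insert_self _ _
    · rw [side_exch' hxy hp.2.1 hp.2.2]; exact mem_insert_self _ _
  · rintro ⟨H, g, l⟩ hp
    simp only [mem_sigma, mem_product] at hp ⊢
    refine ⟨h𝒢.exch_mem hxy hp.1 hp.2.1 hp.2.2, ?_, ?_⟩
    · rw [side_exch hxy hp.2.1 hp.2.2]; exact mem_insert_self _ _
    · rw [side_exch' hxy hp.2.1 hp.2.2]; exact mem_insert_self _ _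
  · rintro ⟨H, g, l⟩ hp
    simp only [mem_sigma, mem_product] at hp ⊢
    simp [exch_exch hxy hp.2.1 hp.2.2]
  · rintro ⟨H, g, l⟩ hp
    simp only [mem_sigma, mem_product] at hp ⊢
    simp [exch_exch hxy hp.2.1 hp.2.2]
  · rintro ⟨H, g, l⟩ hp
    simp only [mem_sigma, mem_product] at hp ⊢
    simp [exch_exch hxy hp.2.1 hp.2.2]

end Engine

/-! ### Codegrees, common link sets, and moves of one edge -/

/-- The number of edges that contain both `x` and `y`. -/
def codeg (H : Finset (Finset V)) (x y : V) : ℕ := (H.filter fun e => x ∈ e ∧ y ∈ e).card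

/-- The number of sets avoiding `x` and `y` that form an edge both with `x` and with `y`. -/
def com (H : Finset (Finset V)) (x y : V) : ℕ :=
  (univ.filter fun g : Finset V => x ∉ g ∧ y ∉ g ∧ insert x g ∈ H ∧ insert y g ∈ H).card

theorem codeg_comm (H : Finset (Finset V)) (x y : V) : codeg H x y = codeg H y x := by
  unfold codeg; simp only [and_comm]

theorem com_comm (H : Finset (Finset V)) (x y : V) : com H x y = com H y x := by
  unfold com
  congr 1; ext g; simp only [mem_filter]; tauto

theorem card_link (H : Finset (Finset V)) (P : Finset V → Prop) [DecidablePred P] (x : V) :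
    (univ.filter fun g : Finset V => x ∉ g ∧ insert x g ∈ H ∧ P g).card =
      (H.filter fun e => x ∈ e ∧ P (e.erase x)).card := by
  refine card_nbij' (fun g => insert x g) (fun e => e.erase x) ?_ ?_ ?_ ?_
  · intro g hg
    simp only [coe_filter, Set.mem_ofPred_eq, mem_univ, true_and] at hg ⊢
    refine ⟨hg.2.1, mem_insert_self _ _, ?_⟩
    rw [erase_insert hg.1]; exact hg.2.2
  · intro e he
    simp only [coe_filter, Set.mem_ofPred_eq, mem_univ, true_and] at he ⊢
    refine ⟨notMem_erase _ _, ?_, he.2.2⟩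
    rw [insert_erase he.2.1]; exact he.1
  · intro g hg
    simp only [coe_filter, Set.mem_ofPred_eq, mem_univ, true_and] at hg
    exact erase_insert hg.1
  · intro e he
    simp only [coe_filter, Set.mem_ofPred_eq] at he
    exact insert_erase he.2.1

theorem degree_eq_side_add (H : Finset (Finset V)) {x y : V} (hxy : x ≠ y) :
    degree H x = (side ∅ H x y).card + codeg H x y + com H x y := by
  have h1 : degree H x = codeg H x y + (H.filter fun e => x ∈ e ∧ y ∉ e.erase x).card := by
    rw [degree, codeg, ← card_filter_add_card_filter_not (s := H.filter fun e => x ∈ e)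
      (fun e => y ∈ e), filter_filter, filter_filter]
    congr 2
    ext e
    simp [hxy.symm]
  have h2 : (H.filter fun e => x ∈ e ∧ y ∉ e.erase x).card =
      (side ∅ H x y).card + com H x y := by
    rw [← card_link H (fun e => y ∉ e) x,
      ← card_filter_add_card_filter_not (fun g => insert y g ∉ H), filter_filter, filter_filter]
    congr 1
    · congr 1; ext g; simp only [mem_filter, mem_univ, true_and, mem_side, notMem_empty]; tauto
    · unfold com
      congr 1; ext g; simp only [mem_filter, mem_univ, true_and]; tauto
  omega

theorem side_subset_side_empty (F H : Finset (Finset V)) (x y : V) :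
    side F H x y ⊆ side ∅ H x y := by
  intro g; simp only [mem_side, notMem_empty]; tauto

/-- Each frozen set accounts for at most one member of `side ∅ H x y`. -/
theorem card_sdiff_side_le (F H : Finset (Finset V)) {x y : V} (hxy : x ≠ y) :
    (side ∅ H x y \ side F H x y).card ≤ F.card := by
  refine card_le_card_of_injOn (fun g => if insert x g ∈ F then insert x g else insert y g) ?_ ?_
  · intro g hg
    simp only [coe_sdiff, Set.mem_sdiff, mem_coe, mem_side, notMem_empty] at hg ⊢
    split_ifs with h
    · exact h
    · tauto
  · intro g hg h hh hgh
    simp only [coe_sdiff, Set.mem_sdiff, mem_coe, mem_side] at hg hh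
    dsimp only at hgh
    split_ifs at hgh with h1 h2 h2
    · exact (insert_inj_left hg.1.1 hh.1.1).mp hgh
    · exact absurd hgh (insert_ne_insert hxy hh.1.1)
    · exact absurd hgh (insert_ne_insert hxy.symm hh.1.2.1)
    · exact (insert_inj_left hg.1.2.1 hh.1.2.1).mp hgh

theorem card_side_empty_le (F H : Finset (Finset V)) {x y : V} (hxy : x ≠ y) :
    (side ∅ H x y).card ≤ (side F H x y).card + F.card := by
  have h1 := card_sdiff_side_le F H hxy
  have h2 := card_sdiff_add_card_eq_card (side_subset_side_empty F H x y)
  omega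

/-- `D_xy`: the number of sets at which the links of `x` and `y` differ (off `F`). -/
def disc (F H : Finset (Finset V)) (x y : V) : ℕ := (side F H x y).card + (side F H y x).card

theorem disc_comm (F H : Finset (Finset V)) (x y : V) : disc F H x y = disc F H y x := by
  unfold disc; omega

theorem abs_side_sub_side_le {k : ℕ} {d : V → ℤ} (F : Finset (Finset V))
    {H : Finset (Finset V)} (hH : H ∈ withDegrees k d) {x y : V} (hxy : x ≠ y) :
    |((side F H x y).card : ℝ) - (side F H y x).card| ≤ |(d x : ℝ) - d y| + F.card := by
  have h1 := degree_eq_side_add H hxy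
  have h2 := degree_eq_side_add H hxy.symm
  rw [codeg_comm H y x, com_comm H y x] at h2
  have h3 := card_side_empty_le F H hxy
  have h4 := card_side_empty_le F H hxy.symm
  have h5 := card_le_card (side_subset_side_empty F H x y)
  have h6 := card_le_card (side_subset_side_empty F H y x)
  rw [mem_withDegrees] at hH
  have h7 := hH.2 x
  have h8 := hH.2 y
  rw [← h7, ← h8, h1, h2]
  push_cast
  set a := (side ∅ H x y).card
  set b := (side ∅ H y x).card
  have h3' : (a : ℝ) ≤ (side F H x y).card + F.card := by exact_mod_cast h3
  have h4' : (b : ℝ) ≤ (side F H y x).card + F.card := by exact_mod_cast h4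
  have h5' : ((side F H x y).card : ℝ) ≤ a := by exact_mod_cast h5
  have h6' : ((side F H y x).card : ℝ) ≤ b := by exact_mod_cast h6
  rw [abs_le]
  constructor
  · linarith [neg_abs_le ((a : ℝ) + codeg H x y + com H x y - (b + codeg H x y + com H x y))]
  · linarith [le_abs_self ((a : ℝ) + codeg H x y + com H x y - (b + codeg H x y + com H x y))]

theorem side_sub_side_empty {k : ℕ} {d : V → ℤ} {H : Finset (Finset V)}
    (hH : H ∈ withDegrees k d) {x y : V} (hxy : x ≠ y) :
    ((side ∅ H x y).card : ℝ) - (side ∅ H y x).card = d x - d y := by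
  have h1 := degree_eq_side_add H hxy
  have h2 := degree_eq_side_add H hxy.symm
  rw [codeg_comm H y x, com_comm H y x] at h2
  rw [mem_withDegrees] at hH
  rw [← hH.2 x, ← hH.2 y, h1, h2]
  push_cast
  ring

/-- Off the frozen sets, the links of `x` and `y` differ in all but few of their members, unless
`x` and `y` have a large codegree or many common link sets. -/
theorem degree_add_degree_le (F H : Finset (Finset V)) {x y : V} (hxy : x ≠ y) :
    degree H x + degree H y ≤ disc F H x y + 2 * (codeg H x y + com H x y) + 2 * F.card := by
  have h1 := degree_eq_side_add H hxy
  have h2 := degree_eq_side_add H hxy.symm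
  rw [codeg_comm H y x, com_comm H y x] at h2
  have h3 := card_side_empty_le F H hxy
  have h4 := card_side_empty_le F H hxy.symm
  unfold disc
  omega

theorem disc_le_degree (F H : Finset (Finset V)) {x y : V} (hxy : x ≠ y) :
    disc F H x y ≤ degree H x + degree H y := by
  have h1 := degree_eq_side_add H hxy
  have h2 := degree_eq_side_add H hxy.symm
  have h5 := card_le_card (side_subset_side_empty F H x y)
  have h6 := card_le_card (side_subset_side_empty F H y x)
  unfold disc
  omega

/-- The degree sequence `d` with one unit moved from `b` to `a`. -/
def shift (d : V → ℤ) (b a : V) : V → ℤ :=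
  fun v => d v + (if v = a then 1 else 0) - (if v = b then 1 else 0)

/-- The graph `H` with the edge `g ∪ {b}` replaced by `g ∪ {a}`. -/
def move (H : Finset (Finset V)) (b a : V) (g : Finset V) : Finset (Finset V) :=
  insert (insert a g) (H.erase (insert b g))

theorem move_mem {k : ℕ} {d : V → ℤ} {H : Finset (Finset V)} (hH : H ∈ withDegrees k d)
    {a b : V} {g : Finset V} (hg : g ∈ side ∅ H b a) :
    move H b a g ∈ withDegrees k (shift d b a) := by
  rw [mem_withDegrees] at hH ⊢
  rw [mem_side] at hg
  constructor
  · intro e he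
    rw [move, mem_insert, mem_erase] at he
    rcases he with rfl | he
    · have := hH.1 _ hg.2.2.1
      rw [card_insert_of_notMem hg.1] at this
      rw [card_insert_of_notMem hg.2.1, this]
    · exact hH.1 _ he.2
  · intro v
    have h1 : insert a g ∉ H.erase (insert b g) := fun h => hg.2.2.2.1 (mem_erase.mp h).2
    have h2 := hH.2 v
    rw [degree_eq_sum, ← add_sum_erase _ _ hg.2.2.1] at h2
    rw [degree_eq_sum, move, sum_insert h1, shift, ← h2]
    push_cast
    simp only [mem_insert]
    by_cases hva : v = a
    · subst hva
      by_cases hvb : v = b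
      · simp [hvb]
      · simp [hvb, hg.2.1]; ring
    · by_cases hvb : v = b
      · subst hvb; simp [hva, hg.1]
      · simp [hva, hvb]

theorem mem_side_move {H : Finset (Finset V)} {a b : V} (hab : a ≠ b) {g : Finset V}
    (hg : g ∈ side ∅ H b a) : g ∈ side ∅ (move H b a g) a b := by
  rw [mem_side] at hg ⊢
  refine ⟨hg.2.1, hg.1, mem_insert_self _ _, ?_, by simp, by simp⟩
  rw [move, mem_insert, mem_erase]
  have : insert b g ≠ insert a g := insert_ne_insert hab.symm hg.1
  tauto

theorem move_move {H : Finset (Finset V)} {a b : V} {g : Finset V}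
    (hg : g ∈ side ∅ H b a) : move (move H b a g) a b g = H := by
  rw [mem_side] at hg
  rw [move, move, erase_insert, insert_erase hg.2.2.1]
  exact fun h => hg.2.2.2.1 (mem_erase.mp h).2

theorem shift_shift (d : V → ℤ) (a b : V) : shift (shift d b a) a b = d := by
  ext v; simp only [shift]; ring

/-- Double counting along the moves of one edge from `b` to `a`. -/
theorem sum_card_side_shift (k : ℕ) (d : V → ℤ) {a b : V} (hab : a ≠ b) :
    ∑ H ∈ withDegrees k d, (side ∅ H b a).card =
      ∑ H ∈ withDegrees k (shift d b a), (side ∅ H a b).card := by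
  simp only [card_eq_sum_ones, sum_sigma']
  refine sum_nbij' (fun p => ⟨move p.1 b a p.2, p.2⟩) (fun p => ⟨move p.1 a b p.2, p.2⟩)
    ?_ ?_ ?_ ?_ ?_
  · rintro ⟨H, g⟩ hp
    simp only [mem_sigma] at hp ⊢
    exact ⟨move_mem hp.1 hp.2, mem_side_move hab hp.2⟩
  · rintro ⟨H, g⟩ hp
    simp only [mem_sigma] at hp ⊢
    refine ⟨?_, mem_side_move hab.symm hp.2⟩
    have := move_mem hp.1 hp.2
    rwa [shift_shift] at this
  · rintro ⟨H, g⟩ hp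
    simp only [mem_sigma] at hp
    simp [move_move hp.2]
  · rintro ⟨H, g⟩ hp
    simp only [mem_sigma] at hp
    simp [move_move hp.2]
  · simp

/-! ### A Poincaré inequality on the slice -/

theorem sum_powersetCard_succ (j : ℕ) (Ψ : Finset V → V → ℝ) :
    ∑ f ∈ powersetCard (j + 1) (univ : Finset V), ∑ x ∈ f, Ψ (f.erase x) x =
      ∑ p ∈ powersetCard j (univ : Finset V), ∑ x ∈ pᶜ, Ψ p x := by
  simp only [sum_sigma']
  refine sum_nbij' (fun q => ⟨q.1.erase q.2, q.2⟩) (fun q => ⟨insert q.2 q.1, q.2⟩) ?_ ?_ ?_ ?_ ?_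
  · rintro ⟨f, x⟩ h
    simp only [mem_sigma, mem_powersetCard, subset_univ, true_and, mem_compl] at h ⊢
    refine ⟨?_, notMem_erase _ _⟩
    rw [card_erase_of_mem h.2, h.1]; rfl
  · rintro ⟨f, x⟩ h
    simp only [mem_sigma, mem_powersetCard, subset_univ, true_and, mem_compl] at h ⊢
    refine ⟨?_, mem_insert_self _ _⟩
    rw [card_insert_of_notMem h.2, h.1]
  · rintro ⟨f, x⟩ h
    simp only [mem_sigma] at h
    simp [insert_erase h.2]
  · rintro ⟨f, x⟩ h
    simp only [mem_sigma, mem_compl] at h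
    simp [erase_insert h.2]
  · simp

/-- The down operator: `(down φ)(p)` is the sum of `φ` over the sets `p ∪ {x}`, `x ∉ p`. -/
def down (φ : Finset V → ℝ) (p : Finset V) : ℝ := ∑ x ∈ pᶜ, φ (insert x p)

/-- The up operator: `(up ψ)(f)` is the sum of `ψ` over the sets `f \ {x}`, `x ∈ f`. -/
def up (ψ : Finset V → ℝ) (f : Finset V) : ℝ := ∑ x ∈ f, ψ (f.erase x)

theorem sum_mul_up (j : ℕ) (φ ψ : Finset V → ℝ) :
    ∑ f ∈ powersetCard (j + 1) (univ : Finset V), φ f * up ψ f =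
      ∑ p ∈ powersetCard j (univ : Finset V), down φ p * ψ p := by
  simp only [up, down, mul_sum, sum_mul]
  rw [← sum_powersetCard_succ j fun p x => φ (insert x p) * ψ p]
  refine sum_congr rfl fun f _ => sum_congr rfl fun x hx => ?_
  rw [insert_erase hx]

theorem sum_down (j : ℕ) (φ : Finset V → ℝ) :
    ∑ p ∈ powersetCard j (univ : Finset V), down φ p =
      (j + 1) * ∑ f ∈ powersetCard (j + 1) (univ : Finset V), φ f := by
  have h := sum_mul_up j φ 1
  simp only [Pi.one_apply, mul_one] at h
  rw [← h, mul_sum]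
  refine sum_congr rfl fun f hf => ?_
  rw [mem_powersetCard] at hf
  simp [up, hf.2]; ring

/-- `sum_down` with the operator unfolded. -/
theorem sum_powersetCard_const (j : ℕ) (φ : Finset V → ℝ) :
    ∑ p ∈ powersetCard j (univ : Finset V), ∑ x ∈ pᶜ, φ (insert x p) =
      (j + 1) * ∑ f ∈ powersetCard (j + 1) (univ : Finset V), φ f := sum_down j φ

/-- The commutation relation between the up and the down operator, in quadratic form. -/
theorem sum_up_sq (j : ℕ) (ψ : Finset V → ℝ) (hj : j + 1 ≤ Fintype.card V) :
    ∑ f ∈ powersetCard (j + 2) (univ : Finset V), up ψ f ^ 2 =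
      ∑ q ∈ powersetCard j (univ : Finset V), down ψ q ^ 2 +
        ((Fintype.card V : ℝ) - 2 * j - 2) *
          ∑ p ∈ powersetCard (j + 1) (univ : Finset V), ψ p ^ 2 := by
  have h1 : ∀ f ∈ powersetCard (j + 2) (univ : Finset V), up ψ f ^ 2 =
      ∑ x ∈ f, (ψ (f.erase x) ^ 2 +
        ∑ y ∈ f.erase x, ψ (f.erase x) * ψ (insert x ((f.erase x).erase y))) := by
    intro f _
    rw [up, sq, sum_mul_sum]
    refine sum_congr rfl fun x hx => ?_
    rw [← add_sum_erase _ _ hx, sq]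
    congr 1
    refine sum_congr rfl fun y hy => ?_
    rw [mem_erase] at hy
    rw [erase_right_comm, insert_erase (mem_erase.mpr ⟨hy.1.symm, hx⟩)]
  rw [sum_congr rfl h1, sum_powersetCard_succ (j + 1)
    (fun p x => ψ p ^ 2 + ∑ y ∈ p, ψ p * ψ (insert x (p.erase y)))]
  simp only [sum_add_distrib]
  have h2 : ∀ p ∈ powersetCard (j + 1) (univ : Finset V), ∑ x ∈ pᶜ, ψ p ^ 2 =
      ((Fintype.card V : ℝ) - j - 1) * ψ p ^ 2 := by
    intro p hp
    rw [mem_powersetCard] at hp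
    rw [sum_const, card_compl, hp.2, nsmul_eq_mul, Nat.cast_sub hj]
    push_cast; ring
  rw [sum_congr rfl h2, ← mul_sum]
  have h3 : ∀ p ∈ powersetCard (j + 1) (univ : Finset V),
      ∑ x ∈ pᶜ, ∑ y ∈ p, ψ p * ψ (insert x (p.erase y)) =
        ∑ y ∈ p, ψ (insert y (p.erase y)) * (down ψ (p.erase y) - ψ (insert y (p.erase y))) := by
    intro p _
    rw [sum_comm]
    refine sum_congr rfl fun y hy => ?_
    rw [insert_erase hy, ← mul_sum, down, compl_erase, sum_insert (by simpa using hy),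
      insert_erase hy]
    ring
  rw [sum_congr rfl h3, sum_powersetCard_succ j
    (fun q y => ψ (insert y q) * (down ψ q - ψ (insert y q)))]
  have h4 : ∀ q ∈ powersetCard j (univ : Finset V),
      ∑ y ∈ qᶜ, ψ (insert y q) * (down ψ q - ψ (insert y q)) =
        down ψ q ^ 2 - ∑ y ∈ qᶜ, ψ (insert y q) ^ 2 := by
    intro q _
    simp only [mul_sub, sum_sub_distrib, ← sum_mul, ← sq]
    rw [sq (down ψ q)]; rfl
  rw [sum_congr rfl h4, sum_sub_distrib, sum_powersetCard_const j (fun p => ψ p ^ 2)]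
  ring

/-- The down operator on functions of mean zero, bounded by the second eigenvalue. -/
theorem sum_down_sq_le (j : ℕ) (hj : j + 1 ≤ Fintype.card V) (φ : Finset V → ℝ)
    (hφ : ∑ f ∈ powersetCard (j + 1) (univ : Finset V), φ f = 0) :
    ∑ p ∈ powersetCard j (univ : Finset V), down φ p ^ 2 ≤
      j * ((Fintype.card V : ℝ) - j - 1) *
        ∑ f ∈ powersetCard (j + 1) (univ : Finset V), φ f ^ 2 := by
  induction j generalizing φ with
  | zero =>
    have := sum_down 0 φ
    simp only [powersetCard_zero, sum_singleton] at this ⊢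
    rw [this, hφ]; simp
  | succ j ih =>
    set n := (Fintype.card V : ℝ) with hn'
    have hn : ((j + 1 : ℕ) : ℝ) + 1 ≤ n := by
      rw [hn', ← Nat.cast_add_one]; exact Nat.cast_le.mpr hj
    push_cast at hn ⊢
    set A := ∑ p ∈ powersetCard (j + 1) (univ : Finset V), down φ p ^ 2 with hA
    set B := ∑ f ∈ powersetCard (j + 1 + 1) (univ : Finset V), φ f ^ 2 with hB
    have hB0 : 0 ≤ B := sum_nonneg fun _ _ => sq_nonneg _
    have hA0 : 0 ≤ A := sum_nonneg fun _ _ => sq_nonneg _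
    have h0 : ∑ p ∈ powersetCard (j + 1) (univ : Finset V), down φ p = 0 := by
      rw [sum_down, hφ, mul_zero]
    have h1 := ih (by omega) (down φ) h0
    have h2 := sum_up_sq j (down φ) (by omega)
    have h3 : A = ∑ f ∈ powersetCard (j + 2) (univ : Finset V), φ f * up (down φ) f := by
      rw [show j + 2 = (j + 1) + 1 from rfl, sum_mul_up, hA]
      simp only [sq]
    have h4 : A ^ 2 ≤ B * ∑ f ∈ powersetCard (j + 2) (univ : Finset V), up (down φ) f ^ 2 := by
      rw [h3]; exact sum_mul_sq_le_sq_mul_sq _ _ _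
    rw [h2] at h4
    have h5 : A ^ 2 ≤ B * ((j + 1) * (n - (j + 1) - 1) * A) := by
      refine h4.trans (mul_le_mul_of_nonneg_left ?_ hB0)
      calc _ ≤ j * (n - j - 1) * A + (n - 2 * j - 2) * A := by gcongr
        _ = _ := by ring
    rcases hA0.eq_or_lt with h | h
    · rw [← h]
      have : 0 ≤ n - (j + 1) - 1 := by linarith
      positivity
    · have : A * A ≤ ((j + 1) * (n - (j + 1) - 1) * B) * A := by nlinarith
      exact le_of_mul_le_mul_right this h

/-- The Poincaré inequality for the walk on the `(j+1)`-subsets of `V` that exchanges one element: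
its spectral gap. -/
theorem poincare (j : ℕ) (hj : j + 1 ≤ Fintype.card V) (φ : Finset V → ℝ) :
    2 * (Fintype.card V : ℝ) * (∑ f ∈ powersetCard (j + 1) (univ : Finset V), φ f ^ 2 -
        (∑ f ∈ powersetCard (j + 1) (univ : Finset V), φ f) ^ 2 /
          ((Fintype.card V).choose (j + 1))) ≤
      ∑ p ∈ powersetCard j (univ : Finset V), ∑ x ∈ pᶜ, ∑ y ∈ pᶜ,
        (φ (insert x p) - φ (insert y p)) ^ 2 := by
  set n := (Fintype.card V : ℝ) with hn
  set N : ℝ := ((Fintype.card V).choose (j + 1) : ℝ) with hN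
  have hN0 : 0 < N := by rw [hN]; exact_mod_cast Nat.choose_pos hj
  set S := ∑ f ∈ powersetCard (j + 1) (univ : Finset V), φ f with hS
  have hcard : ((powersetCard (j + 1) (univ : Finset V)).card : ℝ) = N := by
    rw [card_powersetCard, card_univ]
  let φ' : Finset V → ℝ := fun f => φ f - S / N
  have h0 : ∑ f ∈ powersetCard (j + 1) (univ : Finset V), φ' f = 0 := by
    simp only [φ', sum_sub_distrib, sum_const, nsmul_eq_mul, hcard]
    field_simp; rw [← hS]; ring
  have h1 : ∑ f ∈ powersetCard (j + 1) (univ : Finset V), φ' f ^ 2 =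
      ∑ f ∈ powersetCard (j + 1) (univ : Finset V), φ f ^ 2 - S ^ 2 / N := by
    simp only [φ', sub_sq, sum_sub_distrib, sum_add_distrib, sum_const, nsmul_eq_mul, hcard,
      ← sum_mul, ← mul_sum]
    rw [← hS]; field_simp; ring
  have h2 := sum_down_sq_le j hj φ' h0
  rw [← h1]
  have h3 : ∀ p ∈ powersetCard j (univ : Finset V), ∑ x ∈ pᶜ, ∑ y ∈ pᶜ,
      (φ (insert x p) - φ (insert y p)) ^ 2 =
        2 * (n - j) * ∑ x ∈ pᶜ, φ' (insert x p) ^ 2 - 2 * down φ' p ^ 2 := by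
    intro p hp
    rw [mem_powersetCard] at hp
    have hc : ((pᶜ).card : ℝ) = n - j := by
      rw [card_compl, hp.2, Nat.cast_sub (by omega)]
    have : ∀ x y, (φ (insert x p) - φ (insert y p)) ^ 2 = φ' (insert x p) ^ 2 -
        2 * (φ' (insert x p) * φ' (insert y p)) + φ' (insert y p) ^ 2 := by
      intro x y; simp only [φ']; ring
    simp only [this, sum_add_distrib, sum_sub_distrib, sum_const, nsmul_eq_mul, hc, ← mul_sum,
      ← sum_mul]
    simp only [down]; ring
  rw [sum_congr rfl h3, sum_sub_distrib, ← mul_sum, ← mul_sum,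
    sum_powersetCard_const j (fun f => φ' f ^ 2)]
  linarith

/-! ### The mean number of common link sets -/

section

/-- The number of members of `side F H x y` that contain `p`. -/
def sideOver (F H : Finset (Finset V)) (x y : V) (p : Finset V) : ℕ :=
  ((side F H x y).filter fun g => p ⊆ g).card

theorem sideOver_exch {F H : Finset (Finset V)} {x y : V} {g l : Finset V} (hxy : x ≠ y)
    (hg : g ∈ side F H x y) (hl : l ∈ side F H y x) (p : Finset V) :
    (sideOver F (exch H x y g l) x y p : ℝ) =
      sideOver F H x y p - (if p ⊆ g then 1 else 0) + (if p ⊆ l then 1 else 0) := by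
  have hl' : l ∉ (side F H x y).erase g := by
    rw [mem_erase, not_and]; intro _ h
    rw [mem_side] at hl h; tauto
  simp only [sideOver, card_filter, side_exch hxy hg hl]
  rw [sum_insert hl', ← add_sum_erase _ _ hg]
  push_cast
  ring

section

variable {k : ℕ} {d : V → ℤ} {F : Finset (Finset V)} {𝒢 : Finset (Finset (Finset V))}

/-- The second moment of the number of members of one side above `p`, compared with the mixed
moment of the two sides. -/
theorem Family.sum_sideOver (h𝒢 : Family k d F 𝒢) {x y : V} (hxy : x ≠ y) (p : Finset V)
    (w : ℕ → ℕ → ℝ) :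
    ∑ H ∈ 𝒢, w (side F H x y).card (side F H y x).card * (side F H y x).card *
        (sideOver F H x y p * (sideOver F H x y p - 1)) =
      ∑ H ∈ 𝒢, w (side F H x y).card (side F H y x).card * ((side F H x y).card - 1) *
        (sideOver F H x y p * sideOver F H y x p) := by
  have h := h𝒢.sum_exch hxy fun H g _ => w (side F H x y).card (side F H y x).card *
    ((if p ⊆ g then 1 else 0) * (sideOver F H x y p - 1))
  have e1 : ∀ (S : Finset (Finset V)),
      ∑ g ∈ S, (if p ⊆ g then (1 : ℝ) else 0) = (S.filter fun g => p ⊆ g).card := by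
    intro S; rw [card_filter]; push_cast; rfl
  calc _ = ∑ H ∈ 𝒢, ∑ g ∈ side F H x y, ∑ l ∈ side F H y x,
        w (side F H x y).card (side F H y x).card *
          ((if p ⊆ g then 1 else 0) * (sideOver F H x y p - 1)) := by
        refine sum_congr rfl fun H _ => ?_
        simp only [sum_const, nsmul_eq_mul, ← mul_sum, ← sum_mul, e1]
        simp only [sideOver]; ring
    _ = _ := h
    _ = ∑ H ∈ 𝒢, ∑ g ∈ side F H x y, ∑ l ∈ side F H y x,
        w (side F H x y).card (side F H y x).card *
          ((if p ⊆ l then 1 else 0) * (sideOver F H x y p - (if p ⊆ g then 1 else 0))) := by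
        refine sum_congr rfl fun H _ => sum_congr rfl fun g hg => sum_congr rfl fun l hl => ?_
        rw [card_side_exch hxy hg hl, card_side_exch' hxy hg hl, sideOver_exch hxy hg hl]
        by_cases hp : p ⊆ l <;> simp [hp]
    _ = _ := by
        refine sum_congr rfl fun H _ => ?_
        simp only [← mul_sum, ← sum_mul, sum_sub_distrib, e1, sum_const, nsmul_eq_mul]
        simp only [sideOver]; ring

theorem card_of_mem_side {H : Finset (Finset V)} (hH : IsKGraph k H) {x y : V}
    {g : Finset V} (hg : g ∈ side F H x y) : g.card + 1 = k := by
  rw [mem_side] at hg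
  rw [← hH _ hg.2.2.1, card_insert_of_notMem hg.1]

theorem sum_card_over {j : ℕ} {S : Finset (Finset V)} (hS : ∀ g ∈ S, g.card = j + 1) :
    ∑ p ∈ powersetCard j (univ : Finset V), (S.filter fun g => p ⊆ g).card =
      (j + 1) * S.card := by
  simp only [card_filter]
  rw [sum_comm, card_eq_sum_ones, mul_sum]
  refine sum_congr rfl fun g hg => ?_
  rw [← card_filter]
  have : (powersetCard j (univ : Finset V)).filter (fun p => p ⊆ g) = powersetCard j g := by
    ext p; simp only [mem_filter, mem_powersetCard, subset_univ, true_and]; tauto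
  rw [this, card_powersetCard, hS g hg, Nat.choose_succ_self_right, mul_one]

theorem card_over_le {j : ℕ} {S : Finset (Finset V)} (hS : ∀ g ∈ S, g.card = j + 1)
    {p : Finset V} (hp : p.card = j) : (S.filter fun g => p ⊆ g).card ≤ Fintype.card V := by
  have : (S.filter fun g => p ⊆ g) ⊆ univ.image fun z => insert z p := by
    intro g hg
    rw [mem_filter] at hg
    have h1 : (g \ p).card = 1 := by rw [card_sdiff_of_subset hg.2, hS g hg.1, hp]; omega
    obtain ⟨z, hz⟩ := card_eq_one.mp h1
    rw [mem_image]
    refine ⟨z, mem_univ _, ?_⟩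
    rw [← sdiff_union_of_subset hg.2, hz]; rfl
  exact (card_le_card this).trans card_image_le

end

/-- The inequality behind `Family.sum_sideOver_sub_sq_le` for a single member of the family, with
sides of sizes `A` and `B`, of which `a p` and `b p` members contain `p`. The last two terms of the
summand vanish unless one of the sides is empty, in which case `0⁻¹ = 0` makes them count. -/
theorem side_energy_aux {ι : Type*} (s : Finset ι) (a b : ι → ℕ) (A B j n : ℕ)
    (ha : ∑ p ∈ s, a p = (j + 1) * A) (hb : ∑ p ∈ s, b p = (j + 1) * B)
    (han : ∀ p ∈ s, a p ≤ n) (hbn : ∀ p ∈ s, b p ≤ n) :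
    ∑ p ∈ s, ((a p + b p : ℝ) + (a p * b p) * ((B : ℝ)⁻¹ * (A - 1) + (A : ℝ)⁻¹ * (B - 1) - 2) +
        (1 - (B : ℝ)⁻¹ * B) * (a p * (a p - 1)) + (1 - (A : ℝ)⁻¹ * A) * (b p * (b p - 1))) ≤
      (j + 1) * (A + B) + 2 * n * (j + 1) * ((A - B : ℝ) ^ 2 / (A + B)) := by
  have ha' : ∑ p ∈ s, (a p : ℝ) = (j + 1) * A := by exact_mod_cast ha
  have hb' : ∑ p ∈ s, (b p : ℝ) = (j + 1) * B := by exact_mod_cast hb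
  have han' : ∀ p ∈ s, (a p : ℝ) ≤ n := fun p hp => by exact_mod_cast han p hp
  have hbn' : ∀ p ∈ s, (b p : ℝ) ≤ n := fun p hp => by exact_mod_cast hbn p hp
  simp only [sum_add_distrib, ← mul_sum, ← sum_mul, ha', hb']
  have haa : ∑ p ∈ s, (a p : ℝ) * (a p - 1) ≤ n * ((j + 1) * A) := by
    rw [← ha', mul_sum]
    refine sum_le_sum fun p hp => ?_
    have := han' p hp
    have h0 : (0 : ℝ) ≤ a p := Nat.cast_nonneg _
    nlinarith
  have hbb : ∑ p ∈ s, (b p : ℝ) * (b p - 1) ≤ n * ((j + 1) * B) := by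
    rw [← hb', mul_sum]
    refine sum_le_sum fun p hp => ?_
    have := hbn' p hp
    have h0 : (0 : ℝ) ≤ b p := Nat.cast_nonneg _
    nlinarith
  have hab1 : ∑ p ∈ s, (a p : ℝ) * b p ≤ n * ((j + 1) * A) := by
    rw [← ha', mul_sum]
    refine sum_le_sum fun p hp => ?_
    have := hbn' p hp
    have h0 : (0 : ℝ) ≤ a p := Nat.cast_nonneg _
    nlinarith
  have hab2 : ∑ p ∈ s, (a p : ℝ) * b p ≤ n * ((j + 1) * B) := by
    rw [← hb', mul_sum]
    refine sum_le_sum fun p hp => ?_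
    have := han' p hp
    have h0 : (0 : ℝ) ≤ b p := Nat.cast_nonneg _
    nlinarith
  have hab0 : 0 ≤ ∑ p ∈ s, (a p : ℝ) * b p := sum_nonneg fun p _ => by positivity
  have hA0 : (0 : ℝ) ≤ A := Nat.cast_nonneg _
  have hB0 : (0 : ℝ) ≤ B := Nat.cast_nonneg _
  have hn0 : (0 : ℝ) ≤ n := Nat.cast_nonneg _
  have hj0 : (0 : ℝ) ≤ j := Nat.cast_nonneg _
  set Z := ∑ p ∈ s, (a p : ℝ) * b p
  rcases Nat.eq_zero_or_pos A with hA | hA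
  · subst hA
    rcases Nat.eq_zero_or_pos B with hB | hB
    · subst hB
      simp at haa hbb hab1 ⊢
      nlinarith
    · have hB' : (0 : ℝ) < B := by exact_mod_cast hB
      simp only [Nat.cast_zero, mul_zero] at hab1
      have : Z = 0 := le_antisymm hab1 hab0
      rw [this, inv_mul_cancel₀ hB'.ne']
      have e : ((0 : ℕ) - B : ℝ) ^ 2 / ((0 : ℕ) + B) = B := by
        simp only [Nat.cast_zero, zero_sub, zero_add]; field_simp
      rw [e]
      simp only [Nat.cast_zero]
      nlinarith [mul_nonneg (mul_nonneg hn0 (by linarith : (0 : ℝ) ≤ j + 1)) hB0]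
  · have hA' : (0 : ℝ) < A := by exact_mod_cast hA
    rcases Nat.eq_zero_or_pos B with hB | hB
    · subst hB
      simp only [Nat.cast_zero, mul_zero] at hab2
      have : Z = 0 := le_antisymm hab2 hab0
      rw [this, inv_mul_cancel₀ hA'.ne']
      have e : (A - (0 : ℕ) : ℝ) ^ 2 / (A + (0 : ℕ)) = A := by
        simp only [Nat.cast_zero, sub_zero, add_zero]; field_simp
      rw [e]
      simp only [Nat.cast_zero]
      nlinarith [mul_nonneg (mul_nonneg hn0 (by linarith : (0 : ℝ) ≤ j + 1)) hA0]
    · have hB' : (0 : ℝ) < B := by exact_mod_cast hB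
      rw [inv_mul_cancel₀ hA'.ne', inv_mul_cancel₀ hB'.ne']
      have e : (B : ℝ)⁻¹ * (A - 1) + (A : ℝ)⁻¹ * (B - 1) - 2 =
          ((A - B : ℝ) ^ 2 - (A + B)) / (A * B) := by field_simp; ring
      rw [e]
      have h1 : Z * (((A - B : ℝ) ^ 2 - (A + B)) / (A * B)) ≤
          2 * n * (j + 1) * ((A - B : ℝ) ^ 2 / (A + B)) := by
        have h2 : Z * (A + B) ≤ 2 * n * (j + 1) * (A * B) := by nlinarith
        calc Z * (((A - B : ℝ) ^ 2 - (A + B)) / (A * B)) ≤ Z * ((A - B : ℝ) ^ 2 / (A * B)) := by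
              gcongr; linarith
          _ = (A - B : ℝ) ^ 2 * (Z * (A + B)) / ((A * B) * (A + B)) := by field_simp
          _ ≤ (A - B : ℝ) ^ 2 * (2 * n * (j + 1) * (A * B)) / ((A * B) * (A + B)) := by gcongr
          _ = _ := by field_simp
      linarith

section

variable {j : ℕ} {d : V → ℤ} {F : Finset (Finset V)} {𝒢 : Finset (Finset (Finset V))}

/-- The switchings at `x`, `y` redistribute the union of the two sides at random, so that the
differences of the two sides above the `(k-2)`-sets are, in mean square, at most those of
independent signs, plus a term from the bias `A - B` of the sizes `A` and `B` of the sides. -/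
theorem Family.sum_sideOver_sub_sq_le (h𝒢 : Family (j + 2) d F 𝒢) {x y : V} (hxy : x ≠ y) :
    ∑ H ∈ 𝒢, ∑ p ∈ powersetCard j (univ : Finset V),
        ((sideOver F H x y p : ℝ) - sideOver F H y x p) ^ 2 ≤
      ∑ H ∈ 𝒢, ((j + 1) * (disc F H x y : ℝ) + 2 * Fintype.card V * (j + 1) *
        (((side F H x y).card - (side F H y x).card : ℝ) ^ 2 / disc F H x y)) := by
  have h1 := fun p => h𝒢.sum_sideOver hxy p fun _ B => (B : ℝ)⁻¹
  have h2 := fun p => h𝒢.sum_sideOver hxy.symm p fun _ B => (B : ℝ)⁻¹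
  have key : ∀ p, ∑ H ∈ 𝒢, ((sideOver F H x y p : ℝ) - sideOver F H y x p) ^ 2 =
      ∑ H ∈ 𝒢, ((sideOver F H x y p + sideOver F H y x p : ℝ) +
        (sideOver F H x y p * sideOver F H y x p) *
          (((side F H y x).card : ℝ)⁻¹ * ((side F H x y).card - 1) +
            ((side F H x y).card : ℝ)⁻¹ * ((side F H y x).card - 1) - 2) +
        (1 - ((side F H y x).card : ℝ)⁻¹ * (side F H y x).card) *
          (sideOver F H x y p * (sideOver F H x y p - 1)) +
        (1 - ((side F H x y).card : ℝ)⁻¹ * (side F H x y).card) *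
          (sideOver F H y x p * (sideOver F H y x p - 1))) := by
    intro p
    have e1 := h1 p
    have e2 := h2 p
    -- both moment identities, weighted by the inverse size of the opposite side, are subtracted
    rw [← sub_eq_zero, ← sum_sub_distrib] at e1 e2 ⊢
    rw [← add_zero (0 : ℝ)]
    nth_rewrite 2 [← e1]
    rw [← e2, ← sum_add_distrib]
    refine sum_congr rfl fun H _ => ?_
    ring
  rw [sum_comm, sum_congr rfl fun p _ => key p, sum_comm]
  refine sum_le_sum fun H hH => ?_
  have hk := (mem_withDegrees.mp (h𝒢.sub H hH)).1
  have hc1 : ∀ g ∈ side F H x y, g.card = j + 1 := fun g hg => by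
    have := card_of_mem_side hk hg; omega
  have hc2 : ∀ g ∈ side F H y x, g.card = j + 1 := fun g hg => by
    have := card_of_mem_side hk hg; omega
  have := side_energy_aux (powersetCard j (univ : Finset V)) (sideOver F H x y)
    (sideOver F H y x) (side F H x y).card (side F H y x).card j (Fintype.card V)
    (sum_card_over hc1) (sum_card_over hc2)
    (fun p hp => card_over_le hc1 (mem_powersetCard.mp hp).2)
    (fun p hp => card_over_le hc2 (mem_powersetCard.mp hp).2)
  simpa [disc] using this

end

/-- The number of edges that contain `f`. -/
def setDegree (H : Finset (Finset V)) (f : Finset V) : ℕ := (H.filter fun e => f ⊆ e).card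

theorem setDegree_insert_sub (H : Finset (Finset V)) {x y : V} (hxy : x ≠ y)
    {p : Finset V} (hx : x ∉ p) (hy : y ∉ p) :
    (setDegree H (insert x p) : ℝ) - setDegree H (insert y p) =
      sideOver ∅ H x y p - sideOver ∅ H y x p := by
  have key : ∀ {x y : V}, x ≠ y → x ∉ p → y ∉ p → setDegree H (insert x p) =
      sideOver ∅ H x y p + (H.filter fun e => x ∈ e ∧ y ∈ e ∧ p ⊆ e).card +
        (univ.filter fun g : Finset V => x ∉ g ∧ y ∉ g ∧ insert x g ∈ H ∧ insert y g ∈ H ∧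
          p ⊆ g).card := by
    intro x y hxy hx hy
    have h1 : setDegree H (insert x p) = (H.filter fun e => x ∈ e ∧ y ∈ e ∧ p ⊆ e).card +
        (H.filter fun e => x ∈ e ∧ (y ∉ e.erase x ∧ p ⊆ e.erase x)).card := by
      rw [setDegree, ← card_filter_add_card_filter_not (fun e => y ∈ e), filter_filter,
        filter_filter]
      congr 2
      · ext e; simp only [mem_filter, insert_subset_iff]; tauto
      · ext e
        simp only [mem_filter, insert_subset_iff, subset_erase, mem_erase]
        have := hxy.symm
        tauto
    rw [h1, ← card_link H (fun e => y ∉ e ∧ p ⊆ e) x,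
      ← card_filter_add_card_filter_not (s := univ.filter fun g : Finset V =>
        x ∉ g ∧ insert x g ∈ H ∧ (y ∉ g ∧ p ⊆ g)) (fun g => insert y g ∉ H), filter_filter,
      filter_filter]
    have e1 : (univ.filter fun g : Finset V => (x ∉ g ∧ insert x g ∈ H ∧ (y ∉ g ∧ p ⊆ g)) ∧
        insert y g ∉ H) = (side ∅ H x y).filter fun g => p ⊆ g := by
      ext g; simp only [mem_filter, mem_univ, true_and, mem_side, notMem_empty]; tauto
    have e2 : (univ.filter fun g : Finset V => (x ∉ g ∧ insert x g ∈ H ∧ (y ∉ g ∧ p ⊆ g)) ∧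
        ¬ insert y g ∉ H) = univ.filter fun g : Finset V => x ∉ g ∧ y ∉ g ∧ insert x g ∈ H ∧
          insert y g ∈ H ∧ p ⊆ g := by
      ext g; simp only [mem_filter, mem_univ, true_and]; tauto
    rw [e1, e2, sideOver]
    ring
  rw [key hxy hx hy, key hxy.symm hy hx]
  have e1 : (H.filter fun e => y ∈ e ∧ x ∈ e ∧ p ⊆ e) =
      (H.filter fun e => x ∈ e ∧ y ∈ e ∧ p ⊆ e) := by
    ext e; simp only [mem_filter]; tauto
  have e2 : (univ.filter fun g : Finset V => y ∉ g ∧ x ∉ g ∧ insert y g ∈ H ∧ insert x g ∈ H ∧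
      p ⊆ g) = univ.filter fun g : Finset V => x ∉ g ∧ y ∉ g ∧ insert x g ∈ H ∧
        insert y g ∈ H ∧ p ⊆ g := by
    ext e; simp only [mem_filter]; tauto
  rw [e1, e2]; push_cast; ring

theorem sideOver_empty_eq (F H : Finset (Finset V)) (x y : V) (p : Finset V) :
    sideOver ∅ H x y p =
      sideOver F H x y p + ((side ∅ H x y \ side F H x y).filter fun g => p ⊆ g).card := by
  unfold sideOver
  rw [← card_union_of_disjoint, ← filter_union, union_sdiff_of_subset
    (side_subset_side_empty F H x y)]
  exact disjoint_filter_filter disjoint_sdiff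

/-- Freezing the sets of `F` changes the discrepancies only by a bounded amount. -/
theorem sum_sideOver_empty_sub_sq_le {j : ℕ} (F : Finset (Finset V)) {H : Finset (Finset V)}
    (hH : IsKGraph (j + 2) H) {x y : V} (hxy : x ≠ y) :
    ∑ p ∈ powersetCard j (univ : Finset V),
        ((sideOver ∅ H x y p : ℝ) - sideOver ∅ H y x p) ^ 2 ≤
      2 * ∑ p ∈ powersetCard j (univ : Finset V),
        ((sideOver F H x y p : ℝ) - sideOver F H y x p) ^ 2 + 4 * (j + 1) * (F.card : ℝ) ^ 2 := by
  set r := fun x y p => ((side ∅ H x y \ side F H x y).filter fun g => p ⊆ g).card with hr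
  have hcard : ∀ x y, ∀ g ∈ side ∅ H x y \ side F H x y, g.card = j + 1 := fun x y g hg => by
    have := card_of_mem_side hH (mem_sdiff.mp hg).1; omega
  have hsum : ∀ {x y : V}, x ≠ y → ∑ p ∈ powersetCard j (univ : Finset V), (r x y p : ℝ) ≤
      (j + 1) * F.card := by
    intro x y hxy
    have h1 := sum_card_over (hcard x y)
    have h2 := card_sdiff_side_le F H hxy
    rw [← Nat.cast_sum, h1]
    push_cast
    have : ((side ∅ H x y \ side F H x y).card : ℝ) ≤ F.card := by exact_mod_cast h2
    gcongr
  have hle : ∀ {x y : V}, x ≠ y → ∀ p, (r x y p : ℝ) ≤ F.card := by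
    intro x y hxy p
    exact_mod_cast (card_filter_le _ _).trans (card_sdiff_side_le F H hxy)
  have hp : ∀ p, ((sideOver ∅ H x y p : ℝ) - sideOver ∅ H y x p) ^ 2 ≤
      2 * ((sideOver F H x y p : ℝ) - sideOver F H y x p) ^ 2 +
        2 * F.card * (r x y p + r y x p) := by
    intro p
    rw [sideOver_empty_eq F H x y, sideOver_empty_eq F H y x]
    push_cast
    have h1 := hle hxy p
    have h2 := hle hxy.symm p
    have h3 : (0 : ℝ) ≤ r x y p := Nat.cast_nonneg _
    have h4 : (0 : ℝ) ≤ r y x p := Nat.cast_nonneg _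
    simp only [hr] at h1 h2 h3 h4 ⊢
    generalize (sideOver F H x y p : ℝ) = a
    generalize (sideOver F H y x p : ℝ) = b
    generalize (((side ∅ H x y \ side F H x y).filter fun g => p ⊆ g).card : ℝ) = s at *
    generalize (((side ∅ H y x \ side F H y x).filter fun g => p ⊆ g).card : ℝ) = t at *
    nlinarith [sq_nonneg ((a - b) - (s - t)), mul_nonneg h3 h4]
  refine (sum_le_sum fun p _ => hp p).trans ?_
  rw [sum_add_distrib, ← mul_sum, ← mul_sum, sum_add_distrib]
  have h1 := hsum hxy
  have h2 := hsum hxy.symm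
  have hF : (0 : ℝ) ≤ F.card := Nat.cast_nonneg _
  nlinarith

theorem setDegree_eq_card_compl {j : ℕ} {H : Finset (Finset V)} (hH : IsKGraph (j + 1) H)
    {f : Finset V} (hf : f.card = j) :
    setDegree H f = (fᶜ.filter fun x => insert x f ∈ H).card := by
  symm
  refine card_bij (fun x _ => insert x f) ?_ ?_ ?_
  · intro x hx
    rw [mem_filter] at hx ⊢
    exact ⟨hx.2, subset_insert _ _⟩
  · intro x hx y hy hxy
    rw [mem_filter, mem_compl] at hx hy
    have : x ∈ insert y f := hxy ▸ mem_insert_self x f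
    rw [mem_insert] at this
    tauto
  · intro e he
    rw [mem_filter] at he
    have h1 : (e \ f).card = 1 := by rw [card_sdiff_of_subset he.2, hH e he.1, hf]; omega
    obtain ⟨z, hz⟩ := card_eq_one.mp h1
    have hz' : z ∈ e \ f := by rw [hz]; exact mem_singleton_self _
    have : insert z f = e := by rw [← sdiff_union_of_subset he.2, hz]; rfl
    refine ⟨z, ?_, this⟩
    rw [mem_filter, mem_compl, this]
    exact ⟨(mem_sdiff.mp hz').2, he.1⟩

theorem sum_setDegree {j : ℕ} {H : Finset (Finset V)} (hH : IsKGraph (j + 1) H) :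
    ∑ f ∈ powersetCard j (univ : Finset V), setDegree H f = (j + 1) * H.card :=
  sum_card_over hH

theorem sum_com_le {j : ℕ} {H : Finset (Finset V)} (hH : IsKGraph (j + 1) H) :
    ∑ q ∈ (univ : Finset V).offDiag, (com H q.1 q.2 : ℝ) ≤
      ∑ f ∈ powersetCard j (univ : Finset V), (setDegree H f : ℝ) ^ 2 := by
  have h1 : ∑ q ∈ (univ : Finset V).offDiag, com H q.1 q.2 ≤
      ∑ f ∈ powersetCard j (univ : Finset V), setDegree H f ^ 2 := by
    calc ∑ q ∈ (univ : Finset V).offDiag, com H q.1 q.2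
        ≤ ∑ q ∈ (univ : Finset V) ×ˢ univ, ((powersetCard j univ).filter fun g : Finset V =>
            q.1 ∉ g ∧ q.2 ∉ g ∧ insert q.1 g ∈ H ∧ insert q.2 g ∈ H).card := by
          refine (sum_le_sum fun q _ => ?_).trans (sum_le_sum_of_subset fun q _ => mem_product.mpr
            ⟨mem_univ _, mem_univ _⟩)
          refine card_le_card fun g hg => ?_
          simp only [mem_filter, mem_univ, true_and, mem_powersetCard, subset_univ] at hg ⊢
          refine ⟨?_, hg⟩
          have := hH _ hg.2.2.1
          rw [card_insert_of_notMem hg.1] at this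
          omega
      _ = ∑ f ∈ powersetCard j (univ : Finset V), ((univ ×ˢ univ).filter fun q : V × V =>
            q.1 ∉ f ∧ q.2 ∉ f ∧ insert q.1 f ∈ H ∧ insert q.2 f ∈ H).card := by
          simp only [card_filter]; rw [sum_comm]
      _ = _ := by
          refine sum_congr rfl fun f hf => ?_
          rw [setDegree_eq_card_compl hH (mem_powersetCard.mp hf).2, sq, ← card_product]
          congr 1
          ext q
          simp only [mem_filter, mem_product, mem_univ, true_and, mem_compl]
          tauto
  exact_mod_cast h1

theorem sum_compl_swap (j : ℕ) (Ψ : Finset V → V → V → ℝ) (h0 : ∀ p x, Ψ p x x = 0) :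
    ∑ p ∈ powersetCard j (univ : Finset V), ∑ x ∈ pᶜ, ∑ y ∈ pᶜ, Ψ p x y =
      ∑ q ∈ (univ : Finset V).offDiag,
        ∑ p ∈ (powersetCard j (univ : Finset V)).filter (fun p => q.1 ∉ p ∧ q.2 ∉ p),
          Ψ p q.1 q.2 := by
  simp only [sum_filter]
  rw [sum_comm]
  refine sum_congr rfl fun p _ => ?_
  rw [← sum_product' pᶜ pᶜ, ← sum_filter]
  symm
  refine sum_subset ?_ ?_
  · intro q; simp only [mem_filter, mem_offDiag, mem_product, mem_compl]; tauto
  · intro q hq hq'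
    simp only [mem_filter, mem_offDiag, mem_product, mem_compl, mem_univ, true_and] at hq hq'
    have : q.1 = q.2 := by tauto
    rw [this]; exact h0 _ _

variable {j : ℕ} {d : V → ℤ} {F : Finset (Finset V)} {𝒢 : Finset (Finset (Finset V))}

/-- The average over all pairs of the number of common link sets is small: the Poincaré inequality
for codegrees turns the near-independence of `Family.sum_sideOver_sub_sq_le` into an upper bound
on the second moment of the codegrees. -/
theorem Family.sum_com_le (h𝒢 : Family (j + 2) d F 𝒢) (hj : j + 1 ≤ Fintype.card V) {m : ℕ}
    (hm : ∀ H ∈ 𝒢, H.card = m) :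
    2 * (Fintype.card V : ℝ) * ∑ H ∈ 𝒢, ∑ q ∈ (univ : Finset V).offDiag, (com H q.1 q.2 : ℝ) ≤
      2 * (Fintype.card V : ℝ) * (𝒢.card * (((j + 2) * m : ℝ) ^ 2 /
          ((Fintype.card V).choose (j + 1)))) +
        ∑ q ∈ (univ : Finset V).offDiag, ∑ H ∈ 𝒢, (2 * ((j + 1) * (disc F H q.1 q.2 : ℝ) +
          2 * Fintype.card V * (j + 1) * (((side F H q.1 q.2).card - (side F H q.2 q.1).card : ℝ)
            ^ 2 / disc F H q.1 q.2)) + 4 * (j + 1) * (F.card : ℝ) ^ 2) := by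
  have hk : ∀ H ∈ 𝒢, IsKGraph (j + 2) H := fun H hH => (mem_withDegrees.mp (h𝒢.sub H hH)).1
  have h1 : ∀ H ∈ 𝒢, 2 * (Fintype.card V : ℝ) *
      (∑ q ∈ (univ : Finset V).offDiag, (com H q.1 q.2 : ℝ) - ((j + 2) * m : ℝ) ^ 2 /
          ((Fintype.card V).choose (j + 1))) ≤ ∑ q ∈ (univ : Finset V).offDiag,
      (2 * ∑ p ∈ powersetCard j (univ : Finset V),
        ((sideOver F H q.1 q.2 p : ℝ) - sideOver F H q.2 q.1 p) ^ 2 +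
          4 * (j + 1) * (F.card : ℝ) ^ 2) := by
    intro H hH
    have hs : ∑ f ∈ powersetCard (j + 1) (univ : Finset V), (setDegree H f : ℝ) =
        (j + 2) * m := by
      have := sum_setDegree (hk H hH)
      rw [hm H hH] at this
      rw [← Nat.cast_sum, this]; push_cast; ring
    have hp := poincare j hj fun f => (setDegree H f : ℝ)
    rw [hs, sum_compl_swap j (fun p x y => ((setDegree H (insert x p) : ℝ) -
      setDegree H (insert y p)) ^ 2) (by simp)] at hp
    refine le_trans ?_ (hp.trans (sum_le_sum fun q hq => ?_))
    · gcongr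
      exact KGraph.sum_com_le (hk H hH)
    · have hne : q.1 ≠ q.2 := (mem_offDiag.mp hq).2.2
      refine le_trans ?_ (sum_sideOver_empty_sub_sq_le F (hk H hH) hne)
      refine le_trans (le_of_eq ?_) (sum_le_sum_of_subset_of_nonneg (filter_subset
        (fun p => q.1 ∉ p ∧ q.2 ∉ p) _) fun _ _ _ => sq_nonneg _)
      refine sum_congr rfl fun p hp => ?_
      rw [mem_filter] at hp
      rw [setDegree_insert_sub H hne hp.2.1 hp.2.2]
  have h2 := sum_le_sum h1
  rw [← mul_sum, sum_sub_distrib, sum_const, nsmul_eq_mul] at h2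
  have h3 : ∀ q ∈ (univ : Finset V).offDiag, _ := fun q hq =>
    h𝒢.sum_sideOver_sub_sq_le (mem_offDiag.mp hq).2.2
  have h4 : ∑ q ∈ (univ : Finset V).offDiag, ∑ H ∈ 𝒢,
      (2 * ∑ p ∈ powersetCard j (univ : Finset V),
        ((sideOver F H q.1 q.2 p : ℝ) - sideOver F H q.2 q.1 p) ^ 2 +
          4 * (j + 1) * (F.card : ℝ) ^ 2) ≤ ∑ q ∈ (univ : Finset V).offDiag, ∑ H ∈ 𝒢,
        (2 * ((j + 1) * (disc F H q.1 q.2 : ℝ) +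
          2 * Fintype.card V * (j + 1) * (((side F H q.1 q.2).card - (side F H q.2 q.1).card : ℝ)
            ^ 2 / disc F H q.1 q.2)) + 4 * (j + 1) * (F.card : ℝ) ^ 2) := by
    refine sum_le_sum fun q hq => ?_
    rw [sum_add_distrib, sum_add_distrib, ← mul_sum, ← mul_sum]
    gcongr ?_ + _
    exact (mul_le_mul_of_nonneg_left (h3 q hq) zero_le_two).trans_eq (mul_sum _ _ _)
  rw [sum_comm (s := 𝒢) (t := (univ : Finset V).offDiag) (f := fun H q => _ + _)] at h2
  linarith

end

/-! ### The lower tail of the discrepancy of two links -/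

section

/-- The number of sets at which the links of `a` and `c` differ and that contain `b`. -/
def discOver (F H : Finset (Finset V)) (a c b : V) : ℕ :=
  sideOver F H a c {b} + sideOver F H c a {b}

/-- The sets of `side F H a c` avoiding `b` that do not belong to the link of `b`. -/
def offLink (F H : Finset (Finset V)) (a c b : V) : Finset (Finset V) :=
  (side F H a c).filter fun g => b ∉ g ∧ insert b g ∉ H

/-- The sets of `side F H a c` avoiding `b` that belong to the link of `b`. -/
def onLink (F H : Finset (Finset V)) (a c b : V) : Finset (Finset V) :=
  (side F H a c).filter fun g => b ∉ g ∧ insert b g ∈ H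

/-- Those members of the discrepancy at `a`, `c` that also witness a discrepancy at `a`, `b`. -/
def wit (F H : Finset (Finset V)) (a c b : V) : ℕ :=
  (offLink F H a c b).card + (onLink F H c a b).card

section

variable {F H : Finset (Finset V)} {a b c : V} {g l : Finset V}

theorem disc_exch (hac : a ≠ c) (hg : g ∈ side F H a c) (hl : l ∈ side F H c a) :
    disc F (exch H a c g l) a c = disc F H a c := by
  rw [disc, disc, card_side_exch hac hg hl, card_side_exch' hac hg hl]

theorem discOver_exch (hac : a ≠ c) (hg : g ∈ side F H a c) (hl : l ∈ side F H c a) :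
    discOver F (exch H a c g l) a c b = discOver F H a c b := by
  have h1 := sideOver_exch hac hg hl {b}
  have h2 := sideOver_exch hac.symm hl hg {b}
  rw [← exch_symm] at h2
  have : (discOver F (exch H a c g l) a c b : ℝ) = discOver F H a c b := by
    simp only [discOver]; push_cast; rw [h1, h2]; ring
  exact_mod_cast this

theorem insert_third_mem_exch (hac : a ≠ c) (hab : a ≠ b) (hcb : c ≠ b)
    (hg : g ∈ side F H a c) (hl : l ∈ side F H c a) {h : Finset V} (ha : a ∉ h) (hc : c ∉ h) :
    insert b h ∈ exch H a c g l ↔ insert b h ∈ H := by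
  refine mem_exch_of_iff hac hg hl ?_
  simp [ha, hc, hab, hcb]

/-- Exchanging two witnesses destroys both. -/
theorem wit_exch (hac : a ≠ c) (hab : a ≠ b) (hcb : c ≠ b)
    (hg : g ∈ offLink F H a c b) (hl : l ∈ onLink F H c a b) :
    wit F (exch H a c g l) a c b + 2 = wit F H a c b := by
  have hg' := (mem_filter.mp hg).1
  have hl' := (mem_filter.mp hl).1
  have e1 : offLink F (exch H a c g l) a c b = (offLink F H a c b).erase g := by
    ext h
    rw [offLink, side_exch hac hg' hl']
    by_cases hh : a ∉ h ∧ c ∉ h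
    · simp only [offLink, mem_filter, mem_insert, mem_erase,
        insert_third_mem_exch hac hab hcb hg' hl' hh.1 hh.2]
      have := (mem_filter.mp hl).2
      constructor
      · rintro ⟨rfl | h1, h2⟩ <;> tauto
      · tauto
    · have h1 : h ∉ side F H a c := by rw [mem_side]; tauto
      have h2 : h ≠ l := by rintro rfl; rw [mem_side] at hl'; tauto
      simp [offLink, h1, h2]
  have e2 : onLink F (exch H a c g l) c a b = (onLink F H c a b).erase l := by
    ext h
    rw [onLink, side_exch' hac hg' hl']
    by_cases hh : a ∉ h ∧ c ∉ h
    · simp only [onLink, mem_filter, mem_insert, mem_erase,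
        insert_third_mem_exch hac hab hcb hg' hl' hh.1 hh.2]
      have := (mem_filter.mp hg).2
      constructor
      · rintro ⟨rfl | h1, h2⟩ <;> tauto
      · tauto
    · have h1 : h ∉ side F H c a := by rw [mem_side]; tauto
      have h2 : h ≠ g := by rintro rfl; rw [mem_side] at hg'; tauto
      simp [onLink, h1, h2]
  rw [wit, wit, e1, e2, card_erase_of_mem hg, card_erase_of_mem hl]
  have := card_pos.mpr ⟨g, hg⟩
  have := card_pos.mpr ⟨l, hl⟩
  omega

theorem wit_le (F H : Finset (Finset V)) (a c b : V) :
    wit F H a c b ≤ disc F H a b + F.card := by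
  have hdis : Disjoint (offLink F H a c b) (onLink F H c a b) := by
    rw [disjoint_left]; intro g h1 h2
    rw [offLink, mem_filter] at h1; rw [onLink, mem_filter] at h2; tauto
  have h1 : (offLink F H a c b ∪ onLink F H c a b).filter (fun g => insert b g ∉ F) ⊆
      side F H a b ∪ side F H b a := by
    intro g
    simp only [mem_filter, mem_union, offLink, onLink, mem_side]
    tauto
  have h2 : ((offLink F H a c b ∪ onLink F H c a b).filter
      (fun g => ¬ insert b g ∉ F)).card ≤ F.card := by
    refine card_le_card_of_injOn (fun g => insert b g) ?_ ?_
    · intro g hg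
      rw [mem_coe, mem_filter] at hg
      simpa using hg.2
    · intro g hg h hh hgh
      simp only [coe_filter, Set.mem_ofPred_eq, mem_union, offLink, onLink, mem_filter] at hg hh
      exact (insert_inj_left (by tauto) (by tauto)).mp hgh
  have h3 := card_le_card h1
  have h4 := card_union_le (side F H a b) (side F H b a)
  have h5 := card_filter_add_card_filter_not (s := offLink F H a c b ∪ onLink F H c a b)
    (fun g => insert b g ∉ F)
  rw [card_union_of_disjoint hdis] at h5
  unfold wit disc
  omega

theorem card_side_split (F H : Finset (Finset V)) (a c b : V) :
    (side F H a c).card =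
      sideOver F H a c {b} + (offLink F H a c b).card + (onLink F H a c b).card := by
  rw [← card_filter_add_card_filter_not (s := side F H a c) (fun g => b ∈ g),
    ← card_filter_add_card_filter_not (s := (side F H a c).filter fun g => ¬ b ∈ g)
      (fun g => insert b g ∉ H), filter_filter, filter_filter, sideOver, offLink, onLink]
  simp only [singleton_subset_iff, not_not]
  ring

theorem sideOver_singleton_le_codeg (F H : Finset (Finset V)) (a c b : V) :
    sideOver F H a c {b} ≤ codeg H a b := by
  refine card_le_card_of_injOn (fun g => insert a g) ?_ ?_
  · intro g hg
    simp only [coe_filter, Set.mem_ofPred_eq, mem_side, singleton_subset_iff] at hg ⊢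
    exact ⟨hg.1.2.2.1, mem_insert_self _ _, mem_insert_of_mem hg.2⟩
  · intro g hg h hh hgh
    simp only [coe_filter, Set.mem_ofPred_eq, mem_side] at hg hh
    exact (insert_inj_left hg.1.1 hh.1.1).mp hgh

end

variable {k : ℕ} {d : V → ℤ} {F : Finset (Finset V)} {𝒢 : Finset (Finset (Finset V))}

theorem three_eighths_le {A B T : ℝ} (h : |A - B| ≤ T / 4) (hT : T ≤ A + B) :
    3 / 8 * (A + B) ≤ A ∧ 3 / 8 * (A + B) ≤ B := by
  have := abs_le.mp h
  constructor <;> linarith [this.1, this.2]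

/-- First moment: the sets containing `b` form a small part of the discrepancy at `a`, `c`,
whenever `c` and `b` have a small codegree on average. -/
theorem Family.sum_discOver_le (h𝒢 : Family k d F 𝒢) {a b c : V} (hac : a ≠ c) {T : ℝ}
    (hT : 0 < T)
    (hbal : ∀ H ∈ 𝒢, |((side F H a c).card : ℝ) - (side F H c a).card| ≤ T / 4) :
    ∑ H ∈ 𝒢.filter (fun H => T ≤ disc F H a c), (discOver F H a c b : ℝ) ≤
      3 * ∑ H ∈ 𝒢, (codeg H c b : ℝ) := by
  classical
  -- a set over `b` has `B` switchings, which the weight `B⁻¹` makes up for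
  set w : ℕ → ℕ → ℝ := fun A B => if T ≤ A + B then (B : ℝ)⁻¹ else 0 with hw
  have h := h𝒢.sum_exch hac fun H g _ => w (side F H a c).card (side F H c a).card *
    (if {b} ⊆ g then 1 else 0)
  have e1 : ∀ (S : Finset (Finset V)),
      ∑ g ∈ S, (if {b} ⊆ g then (1 : ℝ) else 0) = (S.filter fun g => {b} ⊆ g).card := by
    intro S; rw [card_filter]; push_cast; rfl
  have e2 : ∑ H ∈ 𝒢, w (side F H a c).card (side F H c a).card * (side F H c a).card *
      sideOver F H a c {b} = ∑ H ∈ 𝒢, w (side F H a c).card (side F H c a).card *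
        (side F H a c).card * sideOver F H c a {b} := by
    refine Eq.trans ?_ (h.trans ?_)
    · refine sum_congr rfl fun H _ => ?_
      simp only [sum_const, nsmul_eq_mul, ← mul_sum, e1, sideOver]; ring
    · refine sum_congr rfl fun H _ => ?_
      rw [sum_congr rfl fun g hg => sum_congr rfl fun l hl => by
        rw [card_side_exch hac hg hl, card_side_exch' hac hg hl]]
      simp only [sum_const, nsmul_eq_mul, ← mul_sum, e1, sideOver]; ring
  rw [sum_filter, mul_sum]
  calc ∑ H ∈ 𝒢, (if T ≤ disc F H a c then (discOver F H a c b : ℝ) else 0)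
      = ∑ H ∈ 𝒢, (w (side F H a c).card (side F H c a).card * (side F H c a).card *
          sideOver F H a c {b} + if T ≤ disc F H a c then (sideOver F H c a {b} : ℝ) else 0) := by
        refine sum_congr rfl fun H hH => ?_
        simp only [hw, disc, discOver, Nat.cast_add]
        split_ifs with hTD
        · have := three_eighths_le (hbal H hH) hTD
          have hB : (0 : ℝ) < (side F H c a).card := by linarith
          rw [inv_mul_cancel₀ hB.ne', one_mul]
        · ring
    _ = ∑ H ∈ 𝒢, (w (side F H a c).card (side F H c a).card * (side F H a c).card *
          sideOver F H c a {b} + if T ≤ disc F H a c then (sideOver F H c a {b} : ℝ) else 0) := by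
        rw [sum_add_distrib, e2, ← sum_add_distrib]
    _ ≤ ∑ H ∈ 𝒢, 3 * (codeg H c b : ℝ) := by
        refine sum_le_sum fun H hH => ?_
        have h1 : (sideOver F H c a {b} : ℝ) ≤ codeg H c b := by
          exact_mod_cast sideOver_singleton_le_codeg F H c a b
        have h0 : (0 : ℝ) ≤ sideOver F H c a {b} := Nat.cast_nonneg _
        simp only [hw, disc, Nat.cast_add]
        split_ifs with hTD
        · have := three_eighths_le (hbal H hH) hTD
          have hB : (0 : ℝ) < (side F H c a).card := by linarith
          have : ((side F H c a).card : ℝ)⁻¹ * (side F H a c).card ≤ 2 := by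
            rw [inv_mul_le_iff₀ hB]; linarith
          nlinarith
        · linarith

open Classical in
/-- The members of `𝒢` with a large discrepancy at `a`, `c`, only a small part of which contains
`b`. -/
noncomputable def goodSet (F : Finset (Finset V)) (𝒢 : Finset (Finset (Finset V))) (a c b : V)
    (T : ℝ) : Finset (Finset (Finset V)) :=
  𝒢.filter fun H => T ≤ disc F H a c ∧ (discOver F H a c b : ℝ) ≤ disc F H a c / 8

/-- Birth and death: if the discrepancy at `a`, `c` is large and witnesses are few, then few
switchings at `a`, `c` destroy a pair of witnesses and many create one. Few witnesses are
therefore unlikely. -/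
theorem Family.card_wit_le (h𝒢 : Family k d F 𝒢) {a b c : V} (hac : a ≠ c) (hab : a ≠ b)
    (hcb : c ≠ b) {T : ℝ} {t : ℕ} (htT : (t : ℝ) + 2 ≤ T / 16)
    (hbal : ∀ H ∈ 𝒢, |((side F H a c).card : ℝ) - (side F H c a).card| ≤ T / 4) :
    2 * (((goodSet F 𝒢 a c b T).filter fun H => wit F H a c b ≤ t).card : ℝ) ≤
      ((goodSet F 𝒢 a c b T).filter fun H => wit F H a c b ≤ t + 2).card := by
  classical
  have ht0 : (0 : ℝ) ≤ t := Nat.cast_nonneg _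
  have hT : 0 < T := by linarith
  set w : Finset (Finset V) → ℕ → ℝ := fun H t =>
    if (T ≤ disc F H a c ∧ (discOver F H a c b : ℝ) ≤ disc F H a c / 8) ∧ wit F H a c b ≤ t
      then 1 else 0 with hw
  have hcard : ∀ t, (((goodSet F 𝒢 a c b T).filter fun H => wit F H a c b ≤ t).card : ℝ) =
      ∑ H ∈ 𝒢, w H t := by
    intro t
    rw [goodSet, filter_filter, card_filter]
    push_cast
    rfl
  have h := h𝒢.sum_exch hac fun H g l => w H t * ((if b ∉ g ∧ insert b g ∈ H then 1 else 0) *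
    (if b ∉ l ∧ insert b l ∉ H then 1 else 0))
  have e1 : ∀ (S : Finset (Finset V)) (P : Finset V → Prop) [DecidablePred P],
      ∑ g ∈ S, (if P g then (1 : ℝ) else 0) = (S.filter P).card := by
    intro S P _; rw [card_filter]; push_cast; rfl
  -- reversed, a switching that creates a pair of witnesses destroys one
  have hL : ∑ H ∈ 𝒢, w H t * ((onLink F H a c b).card * (offLink F H c a b).card : ℝ) ≤
      ∑ H ∈ 𝒢, w H (t + 2) * ((t + 2 : ℝ) ^ 2) := by
    calc _ = _ := by
          refine sum_congr rfl fun H _ => ?_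
          rw [onLink, offLink, ← e1, ← e1, sum_mul_sum, mul_sum]
          simp only [mul_sum]
      _ = _ := h
      _ ≤ ∑ H ∈ 𝒢, ∑ g ∈ side F H a c, ∑ l ∈ side F H c a, w H (t + 2) *
          ((if b ∉ l ∧ insert b l ∈ H then 1 else 0) *
            (if b ∉ g ∧ insert b g ∉ H then 1 else 0)) := by
          refine sum_le_sum fun H _ => sum_le_sum fun g hg => sum_le_sum fun l hl => ?_
          have hg' := mem_side.mp hg
          have hl' := mem_side.mp hl
          simp only [insert_third_mem_exch hac hab hcb hg hl hl'.2.1 hl'.1,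
            insert_third_mem_exch hac hab hcb hg hl hg'.1 hg'.2.1]
          by_cases h1 : b ∉ l ∧ insert b l ∈ H
          · by_cases h2 : b ∉ g ∧ insert b g ∉ H
            · have := wit_exch hac hab hcb (mem_filter.mpr ⟨hg, h2⟩) (mem_filter.mpr ⟨hl, h1⟩)
              simp only [hw, disc_exch hac hg hl, discOver_exch hac hg hl, h1, h2]
              have e : wit F (exch H a c g l) a c b ≤ t ↔ wit F H a c b ≤ t + 2 := by omega
              simp only [e, le_refl]
            · simp [h2]
          · simp [h1]
      _ = ∑ H ∈ 𝒢, w H (t + 2) * ((onLink F H c a b).card * (offLink F H a c b).card : ℝ) := by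
          refine sum_congr rfl fun H _ => ?_
          rw [onLink, offLink, ← e1, ← e1, sum_mul_sum, mul_sum]
          simp only [mul_sum]
          rw [sum_comm]
      _ ≤ _ := by
          refine sum_le_sum fun H _ => ?_
          simp only [hw]
          split_ifs with h1
          · have h2 : ((onLink F H c a b).card : ℝ) + (offLink F H a c b).card ≤ t + 2 := by
              have := h1.2
              unfold wit at this
              exact_mod_cast (by omega :
                (onLink F H c a b).card + (offLink F H a c b).card ≤ t + 2)
            have h3 : (0 : ℝ) ≤ (onLink F H c a b).card := Nat.cast_nonneg _
            have h4 : (0 : ℝ) ≤ (offLink F H a c b).card := Nat.cast_nonneg _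
            nlinarith
          · simp
  -- all but a few members of both sides can take part in the creation of a pair of witnesses
  have hR : ∑ H ∈ 𝒢, w H t * ((3 * T / 16) ^ 2) ≤
      ∑ H ∈ 𝒢, w H t * ((onLink F H a c b).card * (offLink F H c a b).card : ℝ) := by
    refine sum_le_sum fun H hH => ?_
    simp only [hw]
    split_ifs with h1
    · obtain ⟨⟨hTD, hov⟩, hwt⟩ := h1
      have h2 : ((side F H a c).card : ℝ) = _ := congrArg Nat.cast (card_side_split F H a c b)
      have h3 : ((side F H c a).card : ℝ) = _ := congrArg Nat.cast (card_side_split F H c a b)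
      have hwt' : ((offLink F H a c b).card : ℝ) + (onLink F H c a b).card ≤ t := by
        exact_mod_cast hwt
      simp only [discOver, disc] at hTD hov
      push_cast at h2 h3 hTD hov
      have h4 := three_eighths_le (hbal H hH) hTD
      have p1 : (0 : ℝ) ≤ (sideOver F H a c {b} : ℝ) := Nat.cast_nonneg _
      have p2 : (0 : ℝ) ≤ (sideOver F H c a {b} : ℝ) := Nat.cast_nonneg _
      have p3 : (0 : ℝ) ≤ ((offLink F H a c b).card : ℝ) := Nat.cast_nonneg _
      have p4 : (0 : ℝ) ≤ ((onLink F H c a b).card : ℝ) := Nat.cast_nonneg _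
      have q1 : 3 * T / 16 ≤ (onLink F H a c b).card := by linarith [h4.1]
      have q2 : 3 * T / 16 ≤ (offLink F H c a b).card := by linarith [h4.2]
      rw [one_mul, one_mul, sq]
      exact mul_le_mul q1 q2 (by positivity) (by linarith)
    · simp
  rw [hcard, hcard]
  have h1 := hR.trans hL
  rw [← sum_mul, ← sum_mul] at h1
  have h2 : ((t : ℝ) + 2) ^ 2 ≤ (T / 16) ^ 2 := by gcongr
  have h3 : 0 ≤ ∑ H ∈ 𝒢, w H (t + 2) := sum_nonneg fun H _ => by
    simp only [hw]; split_ifs <;> norm_num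
  have h5 : 0 ≤ ∑ H ∈ 𝒢, w H t := sum_nonneg fun H _ => by
    simp only [hw]; split_ifs <;> norm_num
  have h4 : (∑ H ∈ 𝒢, w H t) * (3 * T / 16) ^ 2 ≤ (∑ H ∈ 𝒢, w H (t + 2)) * (T / 16) ^ 2 :=
    h1.trans (mul_le_mul_of_nonneg_left h2 h3)
  have h6 : (0 : ℝ) < (T / 16) ^ 2 := by positivity
  have h7 : (9 * ∑ H ∈ 𝒢, w H t) * (T / 16) ^ 2 ≤ (∑ H ∈ 𝒢, w H (t + 2)) * (T / 16) ^ 2 := by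
    calc _ = (∑ H ∈ 𝒢, w H t) * (3 * T / 16) ^ 2 := by ring
      _ ≤ _ := h4
  have h8 := le_of_mul_le_mul_right h7 h6
  linarith

theorem Family.card_wit_le_pow (h𝒢 : Family k d F 𝒢) {a b c : V} (hac : a ≠ c) (hab : a ≠ b)
    (hcb : c ≠ b) {T : ℝ} (i : ℕ) {t : ℕ} (htT : (t : ℝ) + 2 * i ≤ T / 16)
    (hbal : ∀ H ∈ 𝒢, |((side F H a c).card : ℝ) - (side F H c a).card| ≤ T / 4) :
    2 ^ i * (((goodSet F 𝒢 a c b T).filter fun H => wit F H a c b ≤ t).card : ℝ) ≤ 𝒢.card := by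
  induction i generalizing t with
  | zero =>
    rw [pow_zero, one_mul]
    exact_mod_cast (card_filter_le _ _).trans (card_filter_le _ _)
  | succ i ih =>
    push_cast at htT
    have h1 := h𝒢.card_wit_le hac hab hcb (t := t) (T := T)
      (by linarith [(Nat.cast_nonneg i : (0 : ℝ) ≤ i)]) hbal
    have h2 := ih (t := t + 2) (by push_cast; linarith)
    calc _ = 2 ^ i * (2 * (((goodSet F 𝒢 a c b T).filter
          fun H => wit F H a c b ≤ t).card : ℝ)) := by ring
      _ ≤ _ := (mul_le_mul_of_nonneg_left h1 (by positivity)).trans h2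

/-- If the links of `a` and `c` are far apart for most members of `𝒢`, then so are those of `a`
and `b`. -/
theorem Family.card_disc_lt_le (h𝒢 : Family k d F 𝒢) {a b c : V} (hac : a ≠ c) (hab : a ≠ b)
    (hcb : c ≠ b) {S T : ℝ} (i : ℕ) (hT : 0 < T) (hS : 0 ≤ S)
    (htT : S + F.card + 2 * i ≤ T / 16)
    (hbal : ∀ H ∈ 𝒢, |((side F H a c).card : ℝ) - (side F H c a).card| ≤ T / 4) :
    ((𝒢.filter fun H => (disc F H a b : ℝ) < S).card : ℝ) ≤
      (𝒢.filter fun H => (disc F H a c : ℝ) < T).card +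
        24 / T * ∑ H ∈ 𝒢, (codeg H c b : ℝ) + 𝒢.card / 2 ^ i := by
  classical
  set t := ⌊S + F.card⌋₊ with ht
  have htS : (t : ℝ) ≤ S + F.card := Nat.floor_le (by positivity)
  have h1 := h𝒢.card_wit_le_pow hac hab hcb i (t := t) (T := T) (by linarith) hbal
  have h2 := h𝒢.sum_discOver_le (b := b) hac hT hbal
  set bad := 𝒢.filter (fun H => T ≤ disc F H a c ∧ (disc F H a c : ℝ) / 8 < discOver F H a c b)
    with hbad
  have h3 : (bad.card : ℝ) * (T / 8) ≤ 3 * ∑ H ∈ 𝒢, (codeg H c b : ℝ) := by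
    refine le_trans ?_ h2
    rw [← nsmul_eq_mul, ← sum_const]
    refine le_trans (sum_le_sum fun H hH => ?_) (sum_le_sum_of_subset_of_nonneg
      (fun H hH => ?_) fun _ _ _ => Nat.cast_nonneg _)
    · rw [hbad, mem_filter] at hH; linarith [hH.2.1, hH.2.2]
    · rw [hbad, mem_filter] at hH; rw [mem_filter]; exact ⟨hH.1, hH.2.1⟩
  -- a small discrepancy at `a`, `b` leaves few witnesses
  have hsub : (𝒢.filter fun H => (disc F H a b : ℝ) < S) ⊆
      (𝒢.filter fun H => (disc F H a c : ℝ) < T) ∪ (bad ∪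
        (goodSet F 𝒢 a c b T).filter fun H => wit F H a c b ≤ t) := by
    intro H hH
    rw [mem_filter] at hH
    simp only [mem_union, mem_filter, hbad, goodSet]
    by_cases hc1 : (disc F H a c : ℝ) < T
    · exact Or.inl ⟨hH.1, hc1⟩
    · push Not at hc1
      right
      by_cases hc2 : (disc F H a c : ℝ) / 8 < discOver F H a c b
      · exact Or.inl ⟨hH.1, hc1, hc2⟩
      · push Not at hc2
        refine Or.inr ⟨⟨hH.1, hc1, hc2⟩, ?_⟩
        rw [ht]
        refine Nat.le_floor ?_
        have : (wit F H a c b : ℝ) ≤ disc F H a b + F.card := by exact_mod_cast wit_le F H a c b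
        linarith [hH.2]
  have h4 := (card_le_card hsub).trans ((card_union_le _ _).trans
    (Nat.add_le_add_left (card_union_le _ _) _))
  have h4' : ((𝒢.filter fun H => (disc F H a b : ℝ) < S).card : ℝ) ≤
      (𝒢.filter fun H => (disc F H a c : ℝ) < T).card + (bad.card +
        ((goodSet F 𝒢 a c b T).filter fun H => wit F H a c b ≤ t).card) := by exact_mod_cast h4
  have h5 : (bad.card : ℝ) ≤ 24 / T * ∑ H ∈ 𝒢, (codeg H c b : ℝ) := by
    rw [div_mul_eq_mul_div, le_div_iff₀ hT]; linarith
  have h6 : (((goodSet F 𝒢 a c b T).filter fun H => wit F H a c b ≤ t).card : ℝ) ≤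
      𝒢.card / 2 ^ i := by
    rw [le_div_iff₀ (by positivity)]; linarith
  linarith

end

/-! ### The range of parameters -/

/-- The range of parameters: `n` vertices, edges of size `k`, degrees within a factor `1 ± ε` of
`D`. The small constant `c` bounds `k * ε`, `k ^ 2 / n` and `k` times the edge density, which is
about `D / (n - 1).choose (k - 1)`. By the last condition the admitted deviation `ε * D` is at
least `1 / ε`, so that it absorbs bounded changes of the degrees. -/
structure Sparse (n k : ℕ) (D ε c : ℝ) : Prop where
  three_le : 3 ≤ k
  c_pos : 0 < c
  c_le : c ≤ 1 / 10 ^ 6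
  eps_pos : 0 < ε
  k_eps : k * ε ≤ c
  k_sq : (k : ℝ) ^ 2 ≤ c * n
  k_dens : k * D ≤ c * (n - 1).choose (k - 1)
  one_le : 1 ≤ ε ^ 2 * D

namespace Sparse

variable {n k : ℕ} {D ε c : ℝ}

theorem three_le' (h : Sparse n k D ε c) : (3 : ℝ) ≤ k := by exact_mod_cast h.three_le

theorem k_pos (h : Sparse n k D ε c) : (0 : ℝ) < k := by linarith [h.three_le']

theorem D_pos (h : Sparse n k D ε c) : 0 < D := by
  have := h.one_le
  by_contra hD
  have : ε ^ 2 * D ≤ 0 := mul_nonpos_of_nonneg_of_nonpos (sq_nonneg _) (by linarith)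
  linarith

theorem eps_le (h : Sparse n k D ε c) : ε ≤ c / k := by
  rw [le_div_iff₀ h.k_pos]; linarith [h.k_eps]

theorem ck_le (h : Sparse n k D ε c) : c / k ≤ c / 3 :=
  div_le_div_of_nonneg_left h.c_pos.le (by norm_num) h.three_le'

theorem eps_small (h : Sparse n k D ε c) : ε ≤ 1 / 10 ^ 6 := by
  linarith [h.eps_le, h.ck_le, h.c_le, h.c_pos]

theorem epsD (h : Sparse n k D ε c) : 1 / ε ≤ ε * D := by
  rw [div_le_iff₀ h.eps_pos]; linarith [h.one_le]

theorem epsD_ge (h : Sparse n k D ε c) : 10 ^ 6 ≤ ε * D := by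
  refine le_trans ?_ h.epsD
  rw [le_div_iff₀ h.eps_pos]
  linarith [h.eps_small]

theorem D_ge (h : Sparse n k D ε c) : 10 ^ 12 ≤ D := by
  have h1 := h.epsD_ge
  have h2 := h.eps_small
  have h3 := h.D_pos
  nlinarith

theorem n_pos (h : Sparse n k D ε c) : (0 : ℝ) < n := by
  have := h.k_sq
  have h1 := h.c_pos
  have h2 : (0 : ℝ) < (k : ℝ) ^ 2 := by have := h.k_pos; positivity
  by_contra hn
  have : c * (n : ℝ) ≤ 0 := mul_nonpos_of_nonneg_of_nonpos h1.le (by linarith)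
  linarith

theorem k_div_n (h : Sparse n k D ε c) : (k : ℝ) ≤ c / k * n := by
  rw [div_mul_eq_mul_div, le_div_iff₀ h.k_pos, ← sq]; exact h.k_sq

theorem n_ge (h : Sparse n k D ε c) : 10 ^ 6 * (k : ℝ) ≤ n := by
  have h1 := h.k_div_n
  have h2 := h.ck_le
  have h3 := h.c_le
  have h4 := h.n_pos
  have : c / k * n ≤ 1 / 10 ^ 6 * n :=
    mul_le_mul_of_nonneg_right (by linarith [h.c_pos]) h4.le
  linarith

theorem k_le_n (h : Sparse n k D ε c) : k ≤ n := by
  have h1 := h.n_ge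
  have h2 := h.k_pos
  have : (k : ℝ) ≤ n := by linarith
  exact_mod_cast this

end Sparse

theorem sum_codeg_eq {k : ℕ} {H : Finset (Finset V)} (hH : IsKGraph k H) (a : V) :
    ∑ x, codeg H x a = k * degree H a := by
  simp only [codeg, card_filter]
  rw [sum_comm, degree_eq_sum, mul_sum]
  refine sum_congr rfl fun e he => ?_
  by_cases ha : a ∈ e
  · simp [ha, hH e he]
  · simp [ha]

theorem sum_degree {k : ℕ} {H : Finset (Finset V)} (hH : IsKGraph k H) :
    ∑ v, degree H v = k * H.card := by
  simp only [degree_eq_sum]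
  rw [sum_comm, card_eq_sum_ones, mul_sum]
  refine sum_congr rfl fun e he => ?_
  simp [hH e he]

/-- The degree sequence `d` is within a factor `1 ± ε` of the constant `D`. -/
def Near (D ε : ℝ) (d : V → ℤ) : Prop := ∀ v, |(d v : ℝ) - D| ≤ ε * D

section

variable {k m : ℕ} {D ε c : ℝ} {d : V → ℤ} {F : Finset (Finset V)}
  {𝒢 : Finset (Finset (Finset V))}

theorem Near.le (h : Sparse (Fintype.card V) k D ε c) (hd : Near D ε d) (v : V) :
    (d v : ℝ) ≤ (1 + 1 / 10 ^ 6) * D := by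
  have h1 := (abs_le.mp (hd v)).2
  have h2 := h.eps_small
  have h3 := h.D_pos
  nlinarith

theorem Near.ge (h : Sparse (Fintype.card V) k D ε c) (hd : Near D ε d) (v : V) :
    (1 - 1 / 10 ^ 6) * D ≤ (d v : ℝ) := by
  have h1 := (abs_le.mp (hd v)).1
  have h2 := h.eps_small
  have h3 := h.D_pos
  nlinarith

theorem degree_cast {H : Finset (Finset V)} (hH : H ∈ withDegrees k d) (v : V) :
    (degree H v : ℝ) = d v := by
  have := (mem_withDegrees.mp hH).2 v
  exact_mod_cast congrArg (Int.cast : ℤ → ℝ) this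

theorem sum_d_eq {H : Finset (Finset V)} (hH : H ∈ withDegrees k d) :
    ∑ v, (d v : ℝ) = k * H.card := by
  have h1 := sum_degree (mem_withDegrees.mp hH).1
  have h2 : ((∑ v, degree H v : ℕ) : ℝ) = k * H.card := by rw [h1]; push_cast; ring
  rw [← h2]; push_cast
  exact sum_congr rfl fun v _ => (degree_cast hH v).symm

theorem sum_d_le (h : Sparse (Fintype.card V) k D ε c) (hd : Near D ε d) :
    ∑ v, (d v : ℝ) ≤ 2 * (Fintype.card V * D) := by
  calc ∑ v, (d v : ℝ) ≤ ∑ v : V, 2 * D := sum_le_sum fun v _ => by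
        have := hd.le h v; linarith [h.D_pos]
    _ = _ := by rw [sum_const, card_univ, nsmul_eq_mul]; ring

theorem Near.sub_le (hd : Near D ε d) (x y : V) :
    |(d x : ℝ) - d y| ≤ 2 * (ε * D) := by
  have h1 := abs_le.mp (hd x)
  have h2 := abs_le.mp (hd y)
  rw [abs_le]; constructor <;> linarith [h1.1, h1.2, h2.1, h2.2]

theorem balance (h : Sparse (Fintype.card V) k D ε c) (hd : Near D ε d) (hF : F.card ≤ 2)
    {H : Finset (Finset V)} (hH : H ∈ withDegrees k d) {x y : V} (hxy : x ≠ y) :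
    |((side F H x y).card : ℝ) - (side F H y x).card| ≤ 4 * (ε * D) := by
  have h1 := abs_side_sub_side_le F hH hxy
  have h2 := hd.sub_le x y
  have h3 : (F.card : ℝ) ≤ 2 := by exact_mod_cast hF
  linarith [h.epsD_ge]

theorem sum_codeg_offDiag_le (h : Sparse (Fintype.card V) k D ε c) (hd : Near D ε d)
    (h𝒢 : Family k d F 𝒢) :
    ∑ q ∈ (univ : Finset V).offDiag, ∑ H ∈ 𝒢, (codeg H q.1 q.2 : ℝ) ≤
      2 * (c / k) * ((Fintype.card V : ℝ) ^ 2 * D) * 𝒢.card := by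
  rw [sum_comm]
  calc ∑ H ∈ 𝒢, ∑ q ∈ (univ : Finset V).offDiag, (codeg H q.1 q.2 : ℝ)
      ≤ ∑ H ∈ 𝒢, 2 * (c / k) * ((Fintype.card V : ℝ) ^ 2 * D) := by
        refine sum_le_sum fun H hH => ?_
        have hw := h𝒢.sub H hH
        calc _ ≤ ∑ q ∈ (univ : Finset V) ×ˢ univ, (codeg H q.1 q.2 : ℝ) :=
              sum_le_sum_of_subset_of_nonneg (fun q _ => mem_product.mpr
                ⟨mem_univ _, mem_univ _⟩) fun _ _ _ => Nat.cast_nonneg _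
          _ = ∑ a, ∑ x, (codeg H x a : ℝ) := by rw [sum_product, sum_comm]
          _ = ∑ a, (k : ℝ) * d a := by
              refine sum_congr rfl fun a _ => ?_
              rw [← degree_cast hw, ← Nat.cast_sum, sum_codeg_eq (mem_withDegrees.mp hw).1]
              push_cast; rfl
          _ = k * ∑ a, (d a : ℝ) := by rw [mul_sum]
          _ ≤ (c / k * Fintype.card V) * (2 * (Fintype.card V * D)) :=
              mul_le_mul h.k_div_n (sum_d_le h hd) (by rw [sum_d_eq hw]; positivity)
                (by have := h.c_pos; positivity)
          _ = _ := by ring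
    _ = _ := by rw [sum_const, nsmul_eq_mul]; ring

theorem sum_codeg_right_le (h : Sparse (Fintype.card V) k D ε c) (hd : Near D ε d)
    (h𝒢 : Family k d F 𝒢) (a : V) :
    ∑ x, ∑ H ∈ 𝒢, (codeg H x a : ℝ) ≤ 2 * (c / k) * (Fintype.card V * D) * 𝒢.card := by
  rw [sum_comm]
  calc ∑ H ∈ 𝒢, ∑ x, (codeg H x a : ℝ)
      ≤ ∑ H ∈ 𝒢, 2 * (c / k) * (Fintype.card V * D) := by
        refine sum_le_sum fun H hH => ?_
        have hw := h𝒢.sub H hH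
        rw [← Nat.cast_sum, sum_codeg_eq (mem_withDegrees.mp hw).1]
        push_cast
        rw [degree_cast hw]
        have h1 := hd.le h a
        have h2 := hd.ge h a
        have h3 := h.D_pos
        calc (k : ℝ) * d a ≤ (c / k * Fintype.card V) * (2 * D) :=
              mul_le_mul h.k_div_n (by linarith) (by linarith) (by have := h.c_pos; positivity)
          _ = _ := by ring
    _ = _ := by rw [sum_const, nsmul_eq_mul]; ring

/-- The probability that a pair has a small discrepancy enters the bound on the average number
of common link sets only with a small factor. -/
theorem sum_com_offDiag_le (h : Sparse (Fintype.card V) k D ε c) (hd : Near D ε d)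
    (h𝒢 : Family k d F 𝒢) (hF : F.card ≤ 2) (hm : ∀ H ∈ 𝒢, H.card = m) {P : ℝ}
    (hP : ∀ q ∈ (univ : Finset V).offDiag,
      ((𝒢.filter fun H => (disc F H q.1 q.2 : ℝ) < D / 1024).card : ℝ) ≤ P) :
    ∑ q ∈ (univ : Finset V).offDiag, ∑ H ∈ 𝒢, (com H q.1 q.2 : ℝ) ≤
      ((Fintype.card V : ℝ) ^ 2 * D) * (13 * (c / k) * 𝒢.card + 8 * c * P) := by
  have hP0 : 0 ≤ P := by
    have h1 := h.n_ge
    have h2 := h.three_le'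
    have : 1 < Fintype.card V := by
      have : (1 : ℝ) < Fintype.card V := by linarith
      exact_mod_cast this
    obtain ⟨x, y, hxy⟩ := Fintype.exists_pair_of_one_lt_card this
    exact (Nat.cast_nonneg _).trans (hP (x, y) (by simpa using hxy))
  rcases 𝒢.eq_empty_or_nonempty with rfl | ⟨H0, hH0⟩
  · have h1 := h.D_pos
    have h2 := h.c_pos
    simp only [sum_empty, sum_const_zero]
    positivity
  obtain ⟨j, rfl⟩ : ∃ j, k = j + 2 := ⟨k - 2, by have := h.three_le; omega⟩
  set n : ℝ := (Fintype.card V : ℝ) with hn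
  set G : ℝ := (𝒢.card : ℝ) with hG
  have hn0 : 0 < n := h.n_pos
  have hD0 := h.D_pos
  have hc0 := h.c_pos
  have hε0 := h.eps_pos
  have hG0 : 0 ≤ G := Nat.cast_nonneg _
  have hkp := h.k_pos
  set K : ℝ := ((j + 2 : ℕ) : ℝ) with hK
  have hjK : (j : ℝ) + 1 ≤ K := by rw [hK]; push_cast; linarith
  have hj0 : (0 : ℝ) ≤ j := Nat.cast_nonneg _
  have hjn : j + 2 ≤ Fintype.card V := h.k_le_n
  have hmain := h𝒢.sum_com_le (by omega) hm
  rw [sum_comm] at hmain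
  -- the density term
  have hB : ((Fintype.card V - 1).choose (j + 1) : ℝ) ≤ (Fintype.card V).choose (j + 1) := by
    exact_mod_cast Nat.choose_le_choose _ (Nat.sub_le _ _)
  have hdens := h.k_dens
  rw [show j + 2 - 1 = j + 1 from rfl] at hdens
  have hchoose : (0 : ℝ) < (Fintype.card V).choose (j + 1) := by
    exact_mod_cast Nat.choose_pos (by omega)
  have h1 : ((j + 2) * m : ℝ) ^ 2 / ((Fintype.card V).choose (j + 1)) ≤
      4 * (c / K) * (n ^ 2 * D) := by
    have e1 : ((j + 2) * m : ℝ) = ∑ v, (d v : ℝ) := by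
      rw [sum_d_eq (h𝒢.sub H0 hH0), hm H0 hH0]; push_cast; ring
    have e2 := sum_d_le h hd
    have e3 : (0 : ℝ) ≤ ∑ v, (d v : ℝ) := by rw [← e1]; positivity
    rw [e1, div_le_iff₀ hchoose]
    have e4 : K * D ≤ c * (Fintype.card V).choose (j + 1) :=
      hdens.trans (mul_le_mul_of_nonneg_left hB hc0.le)
    have e5 : D ≤ c / K * (Fintype.card V).choose (j + 1) := by
      rw [div_mul_eq_mul_div, le_div_iff₀ hkp]; linarith
    calc (∑ v, (d v : ℝ)) ^ 2 ≤ (2 * (n * D)) ^ 2 := by gcongr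
      _ = 4 * n ^ 2 * D * D := by ring
      _ ≤ 4 * n ^ 2 * D * (c / K * (Fintype.card V).choose (j + 1)) := by gcongr
      _ = _ := by ring
  -- the terms of one pair
  have h2 : ∀ q ∈ (univ : Finset V).offDiag, ∑ H ∈ 𝒢, (2 * ((j + 1) * (disc F H q.1 q.2 : ℝ) +
      2 * n * (j + 1) * (((side F H q.1 q.2).card - (side F H q.2 q.1).card : ℝ)
        ^ 2 / disc F H q.1 q.2)) + 4 * (j + 1) * (F.card : ℝ) ^ 2) ≤
      K * (8 * D * G) + 4 * n * K * (16384 * (ε ^ 2 * D) * G + 4 * (ε * D) * P) := by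
    intro q hq
    have hne := (mem_offDiag.mp hq).2.2
    have h3 : ∀ H ∈ 𝒢, ((side F H q.1 q.2).card - (side F H q.2 q.1).card : ℝ)
        ^ 2 / disc F H q.1 q.2 ≤ 16384 * (ε ^ 2 * D) +
          4 * (ε * D) * (if (disc F H q.1 q.2 : ℝ) < D / 1024 then 1 else 0) := by
      intro H hH
      have hb := balance h hd hF (h𝒢.sub H hH) hne
      set σ := ((side F H q.1 q.2).card - (side F H q.2 q.1).card : ℝ) with hσ
      have hσD : |σ| ≤ disc F H q.1 q.2 := by
        rw [hσ, disc, abs_le]; push_cast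
        constructor <;> linarith [(Nat.cast_nonneg _ : (0 : ℝ) ≤ (side F H q.1 q.2).card),
          (Nat.cast_nonneg _ : (0 : ℝ) ≤ (side F H q.2 q.1).card)]
      have hD1 : (0 : ℝ) ≤ disc F H q.1 q.2 := Nat.cast_nonneg _
      -- `σ ^ 2 / disc` is at most `|σ|` in any case, and much smaller if `disc` is of order `D`
      rw [← sq_abs]
      split_ifs with hlt
      · have : |σ| ^ 2 / disc F H q.1 q.2 ≤ |σ| := by
          rcases hD1.eq_or_lt with h0 | h0
          · rw [← h0]; simp
          · rw [div_le_iff₀ h0, sq]; gcongr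
        have : 0 ≤ 16384 * (ε ^ 2 * D) := by positivity
        linarith
      · push Not at hlt
        have h0 : (0 : ℝ) < disc F H q.1 q.2 := lt_of_lt_of_le (by positivity) hlt
        rw [div_le_iff₀ h0, mul_zero, add_zero]
        calc |σ| ^ 2 ≤ (4 * (ε * D)) ^ 2 := by gcongr
          _ = 16384 * (ε ^ 2 * D) * (D / 1024) := by ring
          _ ≤ _ := by gcongr
    have h4 : ∀ H ∈ 𝒢, (2 * ((j + 1) * (disc F H q.1 q.2 : ℝ) +
      2 * n * (j + 1) * (((side F H q.1 q.2).card - (side F H q.2 q.1).card : ℝ)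
        ^ 2 / disc F H q.1 q.2)) + 4 * (j + 1) * (F.card : ℝ) ^ 2) ≤
        K * (8 * D) + 4 * n * K * (16384 * (ε ^ 2 * D) +
          4 * (ε * D) * (if (disc F H q.1 q.2 : ℝ) < D / 1024 then 1 else 0)) := by
      intro H hH
      have hw := h𝒢.sub H hH
      have e1 : (disc F H q.1 q.2 : ℝ) ≤ 3 * D := by
        have : (disc F H q.1 q.2 : ℝ) ≤ degree H q.1 + degree H q.2 := by
          exact_mod_cast disc_le_degree F H hne
        rw [degree_cast hw, degree_cast hw] at this
        linarith [hd.le h q.1, hd.le h q.2]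
      have e2 : (F.card : ℝ) ^ 2 ≤ 4 := by
        have : (F.card : ℝ) ≤ 2 := by exact_mod_cast hF
        nlinarith [(Nat.cast_nonneg _ : (0 : ℝ) ≤ F.card)]
      have e3 := h3 H hH
      have e4 : (0 : ℝ) ≤ ((side F H q.1 q.2).card - (side F H q.2 q.1).card : ℝ)
        ^ 2 / disc F H q.1 q.2 := by positivity
      calc _ ≤ 2 * (K * (3 * D) + 2 * n * K * (16384 * (ε ^ 2 * D) +
          4 * (ε * D) * (if (disc F H q.1 q.2 : ℝ) < D / 1024 then 1 else 0))) + 4 * K * 4 := by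
            gcongr
        _ ≤ _ := by
            have : 16 * K ≤ 2 * K * D := by
              have := h.D_ge
              nlinarith
            linarith
    refine (sum_le_sum h4).trans ?_
    simp only [sum_add_distrib, ← mul_sum, sum_const, nsmul_eq_mul]
    have e5 : ∑ H ∈ 𝒢, (if (disc F H q.1 q.2 : ℝ) < D / 1024 then (1 : ℝ) else 0) =
        (𝒢.filter fun H => (disc F H q.1 q.2 : ℝ) < D / 1024).card := by
      rw [card_filter]; push_cast; rfl
    rw [e5]
    have e6 := hP q hq
    have : 4 * n * K * (4 * (ε * D) *
        ((𝒢.filter fun H => (disc F H q.1 q.2 : ℝ) < D / 1024).card : ℝ)) ≤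
        4 * n * K * (4 * (ε * D) * P) := by gcongr
    linarith
  have hcard : ((univ : Finset V).offDiag.card : ℝ) ≤ n ^ 2 := by
    rw [offDiag_card, card_univ, hn, sq]
    exact_mod_cast Nat.sub_le _ _
  have h5 := sum_le_sum h2
  rw [sum_const, nsmul_eq_mul] at h5
  have hX0 : 0 ≤ K * (8 * D * G) + 4 * n * K * (16384 * (ε ^ 2 * D) * G + 4 * (ε * D) * P) := by
    positivity
  have h6 := hmain.trans (add_le_add_right (h5.trans (mul_le_mul_of_nonneg_right hcard hX0)) _)
  have h7 : 2 * n * (G * (((j + 2) * m : ℝ) ^ 2 / ((Fintype.card V).choose (j + 1)))) ≤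
      2 * n * (G * (4 * (c / K) * (n ^ 2 * D))) := by gcongr
  have hKn : K ≤ c / K * n := h.k_div_n
  have hKe : K * ε ≤ c := h.k_eps
  have hee : K * ε ^ 2 ≤ c * (c / K) := by
    have := h.eps_le
    calc K * ε ^ 2 = (K * ε) * ε := by ring
      _ ≤ c * (c / K) := by gcongr
  have h8 : n ^ 2 * (K * (8 * D * G)) ≤ n ^ 2 * ((c / K * n) * (8 * D * G)) := by gcongr
  have h9 : n ^ 2 * (4 * n * K * (16384 * (ε ^ 2 * D) * G + 4 * (ε * D) * P)) ≤
      n ^ 3 * D * (4 * (16384 * (c * (c / K)) * G + 4 * c * P)) := by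
    calc _ = n ^ 3 * D * (4 * (16384 * (K * ε ^ 2) * G + 4 * (K * ε) * P)) := by ring
      _ ≤ _ := by gcongr
  have h10 : c * (c / K) ≤ 1 / 10 ^ 6 * (c / K) := by
    have := h.c_le
    gcongr
  have h11 : n ^ 3 * D * (4 * (16384 * (c * (c / K)) * G + 4 * c * P)) ≤
      n ^ 3 * D * (4 * (16384 * (1 / 10 ^ 6 * (c / K)) * G + 4 * c * P)) := by gcongr
  have h12 : 2 * n * ∑ q ∈ (univ : Finset V).offDiag, ∑ H ∈ 𝒢, (com H q.1 q.2 : ℝ) ≤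
      2 * n * ((n ^ 2 * D) * (13 * (c / K) * G + 8 * c * P)) := by
    refine h6.trans ?_
    have : 0 ≤ n ^ 3 * D * (c / K) * G := by positivity
    linarith
  exact le_of_mul_le_mul_left h12 (by positivity)

end

/-! ### Two vertices rarely have similar links -/

section

variable {k m : ℕ} {D ε c : ℝ} {d : V → ℤ} {F : Finset (Finset V)}
  {𝒢 : Finset (Finset (Finset V))}

theorem sum_offDiag_eq (f : V × V → ℝ) :
    ∑ q ∈ (univ : Finset V).offDiag, f q = ∑ x, ∑ y ∈ univ.erase x, f (x, y) := by
  refine sum_finset_product _ _ _ fun q => ?_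
  simp only [mem_offDiag, mem_univ, true_and, mem_erase, and_true]
  exact ne_comm

theorem two_pow_floor_inv_le (h : Sparse (Fintype.card V) k D ε c) :
    (1 : ℝ) / 2 ^ ⌊D / 4096⌋₊ ≤ c / k := by
  have h1 : (⌊D / 4096⌋₊ : ℝ) + 1 ≤ 2 ^ ⌊D / 4096⌋₊ := by
    exact_mod_cast (Nat.lt_two_pow_self (n := ⌊D / 4096⌋₊))
  have h2 := Nat.lt_floor_add_one (D / 4096)
  have hD := h.D_pos
  have hε := h.eps_pos
  have h3 : (1 : ℝ) / 2 ^ ⌊D / 4096⌋₊ ≤ 4096 / D := by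
    rw [div_le_div_iff₀ (by positivity) hD]; linarith
  have h4 : 4096 / D ≤ 4096 * ε ^ 2 := by
    rw [div_le_iff₀ hD]; linarith [h.one_le]
  have h5 := h.eps_small
  have h6 := h.eps_le
  nlinarith

/-- Discrepancies are large on average over all pairs: where one is small, most of the degree is
accounted for by edges through both vertices and by common link sets. -/
theorem Family.sum_card_disc_lt_le (h : Sparse (Fintype.card V) k D ε c) (hd : Near D ε d)
    (h𝒢 : Family k d F 𝒢) (hF : F.card ≤ 2) (hm : ∀ H ∈ 𝒢, H.card = m) {P : ℝ}
    (hP : ∀ q ∈ (univ : Finset V).offDiag,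
      ((𝒢.filter fun H => (disc F H q.1 q.2 : ℝ) < D / 1024).card : ℝ) ≤ P) :
    ∑ q ∈ (univ : Finset V).offDiag, ((𝒢.filter fun H => (disc F H q.1 q.2 : ℝ) < D).card : ℝ) ≤
      (Fintype.card V : ℝ) ^ 2 * (60 * (c / k) * 𝒢.card + 32 * c * P) := by
  have hD := h.D_pos
  have h1 := sum_com_offDiag_le h hd h𝒢 hF hm hP
  have h2 := sum_codeg_offDiag_le h hd h𝒢
  have h3 : ∀ q ∈ (univ : Finset V).offDiag,
      ((𝒢.filter fun H => (disc F H q.1 q.2 : ℝ) < D).card : ℝ) * (D / 4) ≤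
        ∑ H ∈ 𝒢, (com H q.1 q.2 : ℝ) + ∑ H ∈ 𝒢, (codeg H q.1 q.2 : ℝ) := by
    intro q hq
    rw [← nsmul_eq_mul, ← sum_const, ← sum_add_distrib]
    refine le_trans (sum_le_sum fun H hH => ?_) (sum_le_sum_of_subset_of_nonneg
      (filter_subset (fun H => (disc F H q.1 q.2 : ℝ) < D) _) fun _ _ _ => by positivity)
    rw [mem_filter] at hH
    have hw := h𝒢.sub H hH.1
    have h4 : ((degree H q.1 : ℝ) + degree H q.2) ≤
        disc F H q.1 q.2 + 2 * (codeg H q.1 q.2 + com H q.1 q.2) + 2 * F.card := by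
      exact_mod_cast degree_add_degree_le F H (mem_offDiag.mp hq).2.2
    rw [degree_cast hw, degree_cast hw] at h4
    have h5 : (F.card : ℝ) ≤ 2 := by exact_mod_cast hF
    linarith [hd.ge h q.1, hd.ge h q.2, h.D_ge, hH.2]
  have h4 := sum_le_sum h3
  rw [← sum_mul, sum_add_distrib] at h4
  have h5 : (∑ q ∈ (univ : Finset V).offDiag,
      ((𝒢.filter fun H => (disc F H q.1 q.2 : ℝ) < D).card : ℝ)) * (D / 4) ≤
      ((Fintype.card V : ℝ) ^ 2 * (60 * (c / k) * 𝒢.card + 32 * c * P)) * (D / 4) := by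
    refine h4.trans ((add_le_add h1 h2).trans (le_of_eq ?_))
    ring
  exact le_of_mul_le_mul_right h5 (by positivity)

set_option maxHeartbeats 1000000 in
/-- For every pair of vertices the links differ in a number of sets of order `D`, for all but a
small fraction of the members of the family. The worst pair is controlled by the average over all
pairs through two comparisons with a third vertex, and it enters that average only with a small
factor. -/
theorem Family.card_disc_lt (h : Sparse (Fintype.card V) k D ε c) (hd : Near D ε d)
    (h𝒢 : Family k d F 𝒢) (hF : F.card ≤ 2) (hm : ∀ H ∈ 𝒢, H.card = m) {a b : V}
    (hab : a ≠ b) :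
    ((𝒢.filter fun H => (disc F H a b : ℝ) < D / 1024).card : ℝ) ≤
      4000 * (c / k) * 𝒢.card := by
  set cnt : V → V → ℝ → ℝ := fun x y S => ((𝒢.filter fun H => (disc F H x y : ℝ) < S).card : ℝ)
    with hcnt
  have cnt_comm : ∀ x y S, cnt x y S = cnt y x S := fun x y S => by
    simp only [hcnt, disc_comm F _ x y]
  have cnt_nonneg : ∀ x y S, 0 ≤ cnt x y S := fun x y S => Nat.cast_nonneg _
  set n : ℝ := (Fintype.card V : ℝ) with hn
  set G : ℝ := (𝒢.card : ℝ) with hG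
  have hn0 : 0 < n := h.n_pos
  have hD := h.D_pos
  have hD' := h.D_ge
  have hc0 := h.c_pos
  have hk0 := h.k_pos
  have hG0 : 0 ≤ G := Nat.cast_nonneg _
  have hn2 : n / 2 ≤ n - 2 := by linarith [h.n_ge, h.three_le']
  obtain ⟨q0, hq0, hmax⟩ := exists_max_image ((univ : Finset V).offDiag)
    (fun q => cnt q.1 q.2 (D / 1024)) ⟨(a, b), by simpa using hab⟩
  set P := cnt q0.1 q0.2 (D / 1024) with hPdef
  have hP0 : 0 ≤ P := cnt_nonneg _ _ _
  set i := ⌊D / 4096⌋₊ with hi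
  have hi' : (i : ℝ) ≤ D / 4096 := Nat.floor_le (by positivity)
  have hη := two_pow_floor_inv_le h
  rw [← hi] at hη
  have hη' : G / 2 ^ i ≤ (c / k) * G := by
    rw [div_eq_mul_one_div, mul_comm]; gcongr
  have hF' : (F.card : ℝ) ≤ 2 := by exact_mod_cast hF
  have hbal : ∀ {T : ℝ}, D / 32 ≤ T → ∀ x y, x ≠ y → ∀ H ∈ 𝒢,
      |((side F H x y).card : ℝ) - (side F H y x).card| ≤ T / 4 := by
    intro T hT x y hxy H hH
    refine (balance h hd hF (h𝒢.sub H hH) hxy).trans ?_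
    have := h.eps_small
    nlinarith
  have hB := h𝒢.sum_card_disc_lt_le h hd hF hm hmax
  rw [sum_offDiag_eq] at hB
  have hcardE : ∀ x y : V, x ≠ y → (((univ.erase x).erase y).card : ℝ) = n - 2 := by
    intro x y hxy
    rw [card_erase_of_mem (by simp [hxy.symm]), card_erase_of_mem (mem_univ _), card_univ]
    have : 2 ≤ Fintype.card V := by
      have := h.n_ge; have := h.three_le'
      have : (2 : ℝ) ≤ Fintype.card V := by linarith
      exact_mod_cast this
    rw [hn]
    have e : ((Fintype.card V - 1 - 1 : ℕ) : ℝ) = (Fintype.card V : ℝ) - 2 := by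
      rw [Nat.sub_sub, Nat.cast_sub this]; norm_num
    exact e
  have hcod : ∀ a : V, ∀ S : Finset V, ∑ x ∈ S, ∑ H ∈ 𝒢, (codeg H x a : ℝ) ≤
      2 * (c / k) * (n * D) * G := fun a S =>
    (sum_le_sum_of_subset_of_nonneg (subset_univ S) fun _ _ _ =>
      sum_nonneg fun _ _ => Nat.cast_nonneg _).trans (sum_codeg_right_le h hd h𝒢 a)
  have hη2 : ∀ x y : V, x ≠ y → ∑ z ∈ (univ.erase x).erase y, G / 2 ^ i ≤ n * ((c / k) * G) := by
    intro x y hxy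
    rw [sum_const, nsmul_eq_mul, hcardE x y hxy]
    have : 0 ≤ G / 2 ^ i := by positivity
    exact mul_le_mul (by linarith) hη' this hn0.le
  -- averaging over pairs: every vertex is far from most vertices
  have hC : ∀ a, ∑ x ∈ univ.erase a, cnt x a (D / 32) ≤
      n * (218 * (c / k) * G + 64 * c * P) := by
    intro a
    have h1 : ∀ x ∈ univ.erase a, (n - 2) * cnt x a (D / 32) ≤
        ∑ y ∈ univ.erase x, cnt x y D + n * (49 * (c / k) * G) := by
      intro x hx
      have hxa : x ≠ a := (mem_erase.mp hx).1
      calc (n - 2) * cnt x a (D / 32)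
          = ∑ y ∈ (univ.erase x).erase a, cnt x a (D / 32) := by
            rw [sum_const, nsmul_eq_mul, hcardE x a hxa]
        _ ≤ ∑ y ∈ (univ.erase x).erase a, (cnt x y D +
              24 / D * ∑ H ∈ 𝒢, (codeg H y a : ℝ) + G / 2 ^ i) := by
            refine sum_le_sum fun y hy => ?_
            simp only [mem_erase, mem_univ, and_true] at hy
            refine h𝒢.card_disc_lt_le hy.2.symm hxa hy.1 i hD (by positivity) ?_
              (hbal (by linarith) x y hy.2.symm)
            linarith
        _ ≤ ∑ y ∈ univ.erase x, cnt x y D + 24 / D * (2 * (c / k) * (n * D) * G) +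
              n * ((c / k) * G) := by
            rw [sum_add_distrib, sum_add_distrib, ← mul_sum]
            gcongr ?_ + _ * ?_ + ?_
            · exact sum_le_sum_of_subset_of_nonneg (erase_subset _ _)
                fun _ _ _ => cnt_nonneg _ _ _
            · exact hcod a _
            · exact hη2 x a hxa
        _ = _ := by field_simp; ring
    have h2 := sum_le_sum h1
    rw [← mul_sum, sum_add_distrib, sum_const, nsmul_eq_mul] at h2
    have h3 : ∑ x ∈ univ.erase a, ∑ y ∈ univ.erase x, cnt x y D ≤
        n ^ 2 * (60 * (c / k) * G + 32 * c * P) :=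
      (sum_le_sum_of_subset_of_nonneg (erase_subset _ _) fun _ _ _ =>
        sum_nonneg fun _ _ => cnt_nonneg _ _ _).trans hB
    have h4 : ((univ.erase a).card : ℝ) ≤ n := by
      rw [hn, ← card_univ]; exact_mod_cast card_le_card (erase_subset _ _)
    have h5 : ((univ.erase a).card : ℝ) * (n * (49 * (c / k) * G)) ≤
        n * (n * (49 * (c / k) * G)) := by gcongr
    have h6 : 0 ≤ ∑ x ∈ univ.erase a, cnt x a (D / 32) := sum_nonneg fun _ _ => cnt_nonneg _ _ _
    have h7 : n / 2 * ∑ x ∈ univ.erase a, cnt x a (D / 32) ≤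
        n / 2 * (n * (218 * (c / k) * G + 64 * c * P)) := by
      refine (mul_le_mul_of_nonneg_right hn2 h6).trans (h2.trans ?_)
      linarith
    exact le_of_mul_le_mul_left h7 (by positivity)
  -- a comparison through a third vertex makes this a bound for every pair
  have hE : ∀ x y, x ≠ y → cnt x y (D / 1024) ≤ 3510 * (c / k) * G + 128 * c * P := by
    intro x y hxy
    have h1 : (n - 2) * cnt x y (D / 1024) ≤ n * (218 * (c / k) * G + 64 * c * P) +
        n * (1537 * (c / k) * G) := by
      calc (n - 2) * cnt x y (D / 1024)
          = ∑ z ∈ (univ.erase x).erase y, cnt x y (D / 1024) := by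
            rw [sum_const, nsmul_eq_mul, hcardE x y hxy]
        _ ≤ ∑ z ∈ (univ.erase x).erase y, (cnt z x (D / 32) +
              24 / (D / 32) * ∑ H ∈ 𝒢, (codeg H z y : ℝ) + G / 2 ^ i) := by
            refine sum_le_sum fun z hz => ?_
            simp only [mem_erase, mem_univ, and_true] at hz
            rw [cnt_comm z x]
            refine h𝒢.card_disc_lt_le hz.2.symm hxy hz.1 i (by positivity) (by positivity) ?_
              (hbal le_rfl x z hz.2.symm)
            linarith
        _ ≤ n * (218 * (c / k) * G + 64 * c * P) +
              24 / (D / 32) * (2 * (c / k) * (n * D) * G) + n * ((c / k) * G) := by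
            rw [sum_add_distrib, sum_add_distrib, ← mul_sum]
            gcongr ?_ + _ * ?_ + ?_
            · exact (sum_le_sum_of_subset_of_nonneg (erase_subset _ _)
                fun _ _ _ => cnt_nonneg _ _ _).trans (hC x)
            · exact hcod y _
            · exact hη2 x y hxy
        _ = _ := by field_simp; ring
    have h7 : n / 2 * cnt x y (D / 1024) ≤ n / 2 * (3510 * (c / k) * G + 128 * c * P) := by
      refine (mul_le_mul_of_nonneg_right hn2 (cnt_nonneg _ _ _)).trans (h1.trans ?_)
      linarith
    exact le_of_mul_le_mul_left h7 (by positivity)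
  -- for the worst pair, `P` on the right-hand side has a small factor and can be absorbed
  have hPle : P ≤ 4000 * (c / k) * G := by
    have h1 := hE q0.1 q0.2 (mem_offDiag.mp hq0).2.2
    rw [← hPdef] at h1
    have h2 := h.c_le
    have h3 : 128 * c * P ≤ 128 * (1 / 10 ^ 6) * P := by gcongr
    have h4 : 0 ≤ c / k * G := by positivity
    linarith
  exact (hmax (a, b) (by simpa using hab)).trans hPle

end

/-! ### Existence, and edge probabilities up to a constant factor -/

section

variable {k m : ℕ} {D ε c : ℝ} {d : V → ℤ}

theorem card_eq_of_mem_withDegrees (hk : 0 < k) (hsum : ∑ v, d v = k * m)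
    {H : Finset (Finset V)} (hH : H ∈ withDegrees k d) : H.card = m := by
  have h1 := sum_d_eq hH
  have h2 : ∑ v, (d v : ℝ) = k * m := by exact_mod_cast congrArg (Int.cast : ℤ → ℝ) hsum
  rw [h2] at h1
  have hk' : (0 : ℝ) < k := by exact_mod_cast hk
  exact_mod_cast (mul_left_cancel₀ hk'.ne' h1).symm

/-- One unit of degree can be moved from any vertex to any other vertex: in some graph the links
of the two vertices differ in many sets, and these are balanced between the two sides. -/
theorem nonempty_shift (h : Sparse (Fintype.card V) k D ε c) (hd : Near D ε d)
    (hsum : ∑ v, d v = k * m) (hne : (withDegrees k d).Nonempty) {a b : V} (hab : a ≠ b) :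
    (withDegrees k (shift d b a)).Nonempty := by
  have hk : 0 < k := by have := h.three_le; omega
  have h1 := (family_withDegrees k d ∅).card_disc_lt h hd (by simp)
    (fun H hH => card_eq_of_mem_withDegrees hk hsum hH) hab
  have h2 : ∃ H ∈ withDegrees k d, D / 1024 ≤ (disc ∅ H a b : ℝ) := by
    by_contra! hcon
    rw [filter_true_of_mem hcon] at h1
    have h3 : (0 : ℝ) < (withDegrees k d).card := by exact_mod_cast card_pos.mpr hne
    have h4 := h.ck_le
    have h5 := h.c_le
    nlinarith
  obtain ⟨H, hH, hD⟩ := h2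
  have h3 := balance h hd (F := ∅) (by simp) hH hab
  have h4 := h.eps_small
  have h5 := h.D_pos
  have h6 : (0 : ℝ) < (side ∅ H b a).card := by
    rw [disc] at hD; push_cast at hD
    have := (abs_le.mp h3).2
    nlinarith
  obtain ⟨g, hg⟩ := card_pos.mp (by exact_mod_cast h6 : 0 < (side ∅ H b a).card)
  exact ⟨_, move_mem hH hg⟩

theorem sum_sq_shift_lt {d : V → ℤ} {x y : V} (hxy : x ≠ y) (h : d y + 2 ≤ d x) :
    ∑ v, shift d x y v ^ 2 < ∑ v, d v ^ 2 := by
  have hsub : ({x, y} : Finset V) ⊆ univ := subset_univ _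
  rw [← sum_sdiff hsub, ← sum_sdiff (f := fun v => d v ^ 2) hsub, sum_pair hxy, sum_pair hxy]
  have e : ∑ v ∈ univ \ {x, y}, shift d x y v ^ 2 = ∑ v ∈ univ \ {x, y}, d v ^ 2 := by
    refine sum_congr rfl fun v hv => ?_
    simp only [mem_sdiff, mem_insert, mem_singleton, not_or] at hv
    simp [shift, hv.2.1, hv.2.2]
  rw [e]
  simp only [shift, hxy, hxy.symm, if_true, if_false]
  nlinarith

/-- There are `k`-graphs with any feasible number of edges and almost equal degrees: those that
minimize the sum of the squares of the degrees. -/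
theorem exists_almost_regular (k m : ℕ) (hm : m ≤ (Fintype.card V).choose k) :
    ∃ d : V → ℤ, (withDegrees k d).Nonempty ∧ ∑ v, d v = k * m ∧ ∀ x y, d x ≤ d y + 1 := by
  obtain ⟨H, hH, hmin⟩ := exists_min_image (powersetCard m (powersetCard k (univ : Finset V)))
    (fun H => ∑ v, (degree H v : ℤ) ^ 2)
    (powersetCard_nonempty.mpr (by rw [card_powersetCard, card_univ]; exact hm))
  have hk : IsKGraph k H := fun e he =>
    (mem_powersetCard.mp ((mem_powersetCard.mp hH).1 he)).2
  have hHm : H.card = m := (mem_powersetCard.mp hH).2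
  have hw : H ∈ withDegrees k fun v => (degree H v : ℤ) := mem_withDegrees.mpr ⟨hk, fun _ => rfl⟩
  refine ⟨fun v => degree H v, ⟨H, hw⟩, ?_, ?_⟩
  · have := sum_degree hk
    rw [hHm] at this
    show ∑ v, (degree H v : ℤ) = k * m
    exact_mod_cast this
  · intro x y
    by_contra! hcon
    have hxy : x ≠ y := by rintro rfl; linarith
    have h1 := degree_eq_side_add H hxy
    have h2 := degree_eq_side_add H hxy.symm
    rw [codeg_comm H y x, com_comm H y x] at h2
    have h3 : 0 < (side ∅ H x y).card := by omega
    obtain ⟨g, hg⟩ := card_pos.mp h3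
    have h4 := move_mem hw hg
    have h5 := mem_withDegrees.mp h4
    have h6 : move H x y g ∈ powersetCard m (powersetCard k (univ : Finset V)) := by
      rw [mem_powersetCard]
      refine ⟨fun e he => mem_powersetCard.mpr ⟨subset_univ _, h5.1 e he⟩, ?_⟩
      rw [mem_side] at hg
      have h7 : insert y g ∉ H.erase (insert x g) := fun h => hg.2.2.2.1 (mem_erase.mp h).2
      rw [move, card_insert_of_notMem h7, card_erase_of_mem hg.2.2.1, ← hHm]
      have := card_pos.mpr ⟨_, hg.2.2.1⟩
      omega
    have h7 := hmin _ h6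
    simp only [h5.2] at h7
    have h8 := sum_sq_shift_lt (d := fun v => (degree H v : ℤ)) hxy (by
      show (degree H y : ℤ) + 2 ≤ degree H x
      linarith)
    linarith

theorem sum_shift (d : V → ℤ) (b a : V) : ∑ v, shift d b a v = ∑ v, d v := by
  simp [shift, sum_sub_distrib, sum_add_distrib]

/-- Units of degree are moved one by one from `d₀` towards `d`, and all the intermediate sequences
stay near `D`. -/
theorem nonempty_of_reach (h : Sparse (Fintype.card V) k D ε c) (hd : Near D ε d)
    (hsum : ∑ v, d v = k * m) (N : ℕ) (d₀ : V → ℤ) (hd₀ : Near D ε d₀)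
    (hsum₀ : ∑ v, d₀ v = k * m) (hne : (withDegrees k d₀).Nonempty)
    (hN : ∑ v, (d₀ v - d v).natAbs ≤ N) : (withDegrees k d).Nonempty := by
  induction N generalizing d₀ with
  | zero =>
    have : d₀ = d := by
      funext v
      have h1 := (sum_eq_zero_iff.mp (Nat.le_zero.mp hN)) v (mem_univ v)
      omega
    rwa [← this]
  | succ N ih =>
    by_cases heq : d₀ = d
    · rwa [← heq]
    have hs : ∑ v, d₀ v = ∑ v, d v := by rw [hsum, hsum₀]
    have h1 : ∃ u, d u < d₀ u := by
      by_contra! hcon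
      refine heq (funext fun v => ?_)
      have := (sum_eq_sum_iff_of_le fun v _ => hcon v).mp hs
      exact this v (mem_univ v)
    have h2 : ∃ v, d₀ v < d v := by
      by_contra! hcon
      refine heq (funext fun v => ?_)
      have := (sum_eq_sum_iff_of_le fun v _ => hcon v).mp hs.symm
      exact (this v (mem_univ v)).symm
    obtain ⟨u, hu⟩ := h1
    obtain ⟨v, hv⟩ := h2
    have huv : u ≠ v := by rintro rfl; omega
    have hbtw : ∀ w, (d₀ w ≤ shift d₀ u v w ∧ shift d₀ u v w ≤ d w) ∨
        (d w ≤ shift d₀ u v w ∧ shift d₀ u v w ≤ d₀ w) ∨ shift d₀ u v w = d₀ w := by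
      intro w
      by_cases hwu : w = u
      · subst hwu; simp [shift, huv]; omega
      · by_cases hwv : w = v
        · subst hwv; simp [shift, hwu]; omega
        · simp [shift, hwu, hwv]
    refine ih (shift d₀ u v) ?_ (by rw [sum_shift, hsum₀])
      (nonempty_shift h hd₀ hsum₀ hne huv.symm) ?_
    · intro w
      have e1 := abs_le.mp (hd₀ w)
      have e2 := abs_le.mp (hd w)
      rw [abs_le]
      rcases hbtw w with hw | hw | hw
      · have a1 : (d₀ w : ℝ) ≤ shift d₀ u v w := by exact_mod_cast hw.1
        have a2 : (shift d₀ u v w : ℝ) ≤ d w := by exact_mod_cast hw.2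
        constructor <;> linarith [e1.1, e1.2, e2.1, e2.2]
      · have a1 : (d w : ℝ) ≤ shift d₀ u v w := by exact_mod_cast hw.1
        have a2 : (shift d₀ u v w : ℝ) ≤ d₀ w := by exact_mod_cast hw.2
        constructor <;> linarith [e1.1, e1.2, e2.1, e2.2]
      · rw [hw]; exact e1
    · have : ∑ w, (shift d₀ u v w - d w).natAbs < ∑ w, (d₀ w - d w).natAbs := by
        refine sum_lt_sum (fun w _ => ?_) ⟨u, mem_univ u, ?_⟩
        · rcases hbtw w with hw | hw | hw
          · omega
          · omega
          · rw [hw]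
        · simp [shift, huv]; omega
      omega

theorem mul_choose_eq {n k : ℕ} (hk : 0 < k) (hkn : k ≤ n) :
    (k : ℝ) * n.choose k = n * (n - 1).choose (k - 1) := by
  obtain ⟨j, rfl⟩ : ∃ j, k = j + 1 := ⟨k - 1, by omega⟩
  obtain ⟨l, rfl⟩ : ∃ l, n = l + 1 := ⟨n - 1, by omega⟩
  have := Nat.add_one_mul_choose_eq l j
  rw [Nat.add_sub_cancel, Nat.add_sub_cancel]
  exact_mod_cast (by linarith : (j + 1) * (l + 1).choose (j + 1) = (l + 1) * l.choose j)

theorem choose_cast (h : Sparse (Fintype.card V) k D ε c) :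
    (k : ℝ) * (Fintype.card V).choose k =
      Fintype.card V * (Fintype.card V - 1).choose (k - 1) :=
  mul_choose_eq (by have := h.three_le; omega) h.k_le_n

theorem edges_le_choose (h : Sparse (Fintype.card V) k D ε c) (hd : Near D ε d)
    (hsum : ∑ v, d v = k * m) : m ≤ (Fintype.card V).choose k := by
  have h1 : ∑ v, (d v : ℝ) = k * m := by exact_mod_cast congrArg (Int.cast : ℤ → ℝ) hsum
  have h2 := sum_d_le h hd
  rw [h1] at h2
  have h3 := choose_cast h
  have h4 := h.k_dens
  have h5 := h.c_le
  have h6 := h.k_pos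
  have h7 := h.n_pos
  have hD := h.D_pos
  set B : ℝ := ((Fintype.card V - 1).choose (k - 1) : ℝ)
  have hB : 0 ≤ B := Nat.cast_nonneg _
  have h8 : D ≤ B / 2 := by
    have : 3 * D ≤ k * D := by have := h.three_le'; gcongr
    have : c * B ≤ 1 / 10 ^ 6 * B := by gcongr
    linarith
  have h9 : (k : ℝ) * m ≤ k * (Fintype.card V).choose k := by
    rw [h3]
    refine h2.trans ?_
    have : (Fintype.card V : ℝ) * D ≤ Fintype.card V * (B / 2) := by gcongr
    linarith
  have := le_of_mul_le_mul_left h9 h6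
  exact_mod_cast this

/-- Every nearly regular sequence is a degree sequence: it is reached from an almost regular one
by moving single units of degree. -/
theorem nonempty_withDegrees (h : Sparse (Fintype.card V) k D (2 * ε) c) (hd : Near D ε d)
    (hsum : ∑ v, d v = k * m) : (withDegrees k d).Nonempty := by
  have hε : 0 < ε := by linarith [h.eps_pos]
  have hD := h.D_pos
  have hd2 : Near D (2 * ε) d := fun v => (hd v).trans (by nlinarith)
  obtain ⟨d₀, hne, hsum₀, hreg⟩ := exists_almost_regular k m (edges_le_choose h hd2 hsum)
  have hs : ∑ v, (d₀ v : ℝ) = ∑ v, (d v : ℝ) := by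
    rw [← Int.cast_sum, ← Int.cast_sum, hsum₀, hsum]
  have h1 : ∃ u, (d₀ u : ℝ) ≤ D + ε * D := by
    by_contra! hcon
    have : ∑ v, (d v : ℝ) < ∑ v, (d₀ v : ℝ) := by
      have hnV : (univ : Finset V).Nonempty := by
        rw [← card_pos, card_univ]; exact_mod_cast h.n_pos
      refine sum_lt_sum_of_nonempty hnV fun v _ => ?_
      have := (abs_le.mp (hd v)).2
      linarith [hcon v]
    linarith
  have h2 : ∃ u, D - ε * D ≤ (d₀ u : ℝ) := by
    by_contra! hcon
    have : ∑ v, (d₀ v : ℝ) < ∑ v, (d v : ℝ) := by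
      have hnV : (univ : Finset V).Nonempty := by
        rw [← card_pos, card_univ]; exact_mod_cast h.n_pos
      refine sum_lt_sum_of_nonempty hnV fun v _ => ?_
      have := (abs_le.mp (hd v)).1
      linarith [hcon v]
    linarith
  obtain ⟨u, hu⟩ := h1
  obtain ⟨w, hw⟩ := h2
  refine nonempty_of_reach h hd2 hsum _ d₀ (fun v => ?_) hsum₀ hne le_rfl
  have e1 : (d₀ v : ℝ) ≤ d₀ u + 1 := by exact_mod_cast hreg v u
  have e2 : (d₀ w : ℝ) ≤ d₀ v + 1 := by exact_mod_cast hreg w v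
  have e3 := h.epsD_ge
  rw [abs_le]; constructor <;> linarith

/-- The number of `k`-graphs with degree sequence `d` that contain the edge `K`. -/
noncomputable def numWith (k : ℕ) (d : V → ℤ) (K : Finset V) : ℝ :=
  (((withDegrees k d).filter fun H => K ∈ H).card : ℝ)

/-- Double counting along the switchings at `x`, `y` that involve the link set `f`. -/
theorem sum_side_single (x y : V) (hxy : x ≠ y) (f : Finset V) (w : ℕ → ℕ → ℝ) :
    ∑ H ∈ (withDegrees k d).filter (fun H => f ∈ side ∅ H x y),
        w (side ∅ H x y).card (side ∅ H y x).card * (side ∅ H y x).card =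
      ∑ H ∈ (withDegrees k d).filter (fun H => f ∈ side ∅ H y x),
        w (side ∅ H x y).card (side ∅ H y x).card * (side ∅ H x y).card := by
  have h := (family_withDegrees k d ∅).sum_exch hxy fun H g _ =>
    w (side ∅ H x y).card (side ∅ H y x).card * (if g = f then 1 else 0)
  rw [sum_filter, sum_filter]
  refine Eq.trans ?_ (h.trans ?_)
  · refine sum_congr rfl fun H _ => ?_
    simp only [sum_const, nsmul_eq_mul, ← mul_sum, sum_ite_eq']
    split_ifs <;> ring
  · refine sum_congr rfl fun H _ => ?_
    rw [sum_congr rfl fun g hg => sum_congr rfl fun l hl => by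
      rw [card_side_exch hxy hg hl, card_side_exch' hxy hg hl]]
    simp only [sum_const, nsmul_eq_mul, ← mul_sum, sum_ite_eq']
    split_ifs <;> ring

theorem numWith_adjacent_aux (h : Sparse (Fintype.card V) k D ε c) (hd : Near D ε d)
    (hsum : ∑ v, d v = k * m) {f : Finset V} {a b : V} (hab : a ≠ b) (ha : a ∉ f) (hb : b ∉ f)
    (hle : d b ≤ d a) :
    numWith k d (insert b f) ≤ numWith k d (insert a f) ∧
      (1 - 8100 * (c / k)) * numWith k d (insert a f) ≤ numWith k d (insert b f) := by
  have hk : 0 < k := by have := h.three_le; omega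
  have hD := h.D_pos
  have hck : 0 < c / k := div_pos h.c_pos h.k_pos
  set 𝒢₁ := (withDegrees k d).filter (fun H => f ∈ side ∅ H a b) with h𝒢₁
  set 𝒢₂ := (withDegrees k d).filter (fun H => f ∈ side ∅ H b a) with h𝒢₂
  set n₁₂ := (((withDegrees k d).filter fun H => insert a f ∈ H ∧ insert b f ∈ H).card : ℝ)
  have split : ∀ {a b : V}, a ∉ f → b ∉ f → numWith k d (insert a f) =
      ((withDegrees k d).filter (fun H => f ∈ side ∅ H a b)).card +
        (((withDegrees k d).filter fun H => insert a f ∈ H ∧ insert b f ∈ H).card : ℝ) := by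
    intro a b ha hb
    rw [numWith, ← card_filter_add_card_filter_not (fun H => insert b f ∉ H), filter_filter,
      filter_filter]
    push_cast
    congr 2
    · congr 1; ext H; simp [mem_side, ha, hb]
    · congr 1; ext H; simp
  have e1 : numWith k d (insert a f) = 𝒢₁.card + n₁₂ := split ha hb
  have e2 : numWith k d (insert b f) = 𝒢₂.card + n₁₂ := by
    rw [split hb ha]
    congr 2; congr 1; ext H; simp only [mem_filter]; tauto
  have hn12 : 0 ≤ n₁₂ := Nat.cast_nonneg _
  have hAB : ∀ H ∈ withDegrees k d, ((side ∅ H a b).card : ℝ) - (side ∅ H b a).card = d a - d b :=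
    fun H hH => side_sub_side_empty hH hab
  have hle' : (d b : ℝ) ≤ d a := by exact_mod_cast hle
  -- the side of the vertex with the larger degree is the larger one in every graph
  have g1 : (𝒢₂.card : ℝ) ≤ 𝒢₁.card := by
    have h1 := sum_side_single (k := k) (d := d) a b hab f fun _ B => (B : ℝ)⁻¹
    calc (𝒢₂.card : ℝ) = ∑ H ∈ 𝒢₂, (1 : ℝ) := by simp
      _ ≤ ∑ H ∈ 𝒢₂, ((side ∅ H b a).card : ℝ)⁻¹ * (side ∅ H a b).card := by
        refine sum_le_sum fun H hH => ?_
        rw [h𝒢₂, mem_filter] at hH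
        have hB : (0 : ℝ) < (side ∅ H b a).card := by exact_mod_cast card_pos.mpr ⟨f, hH.2⟩
        rw [le_inv_mul_iff₀ hB]
        linarith [hAB H hH.1]
      _ = _ := h1.symm
      _ ≤ ∑ H ∈ 𝒢₁, (1 : ℝ) := sum_le_sum fun H _ => inv_mul_le_one
      _ = _ := by simp
  -- the sides have a ratio close to `1` unless the discrepancy at `a`, `b` is small
  have g2 : (1 - 8100 * (c / k)) * 𝒢₁.card ≤ (𝒢₂.card : ℝ) := by
    have h1 := sum_side_single (k := k) (d := d) a b hab f fun A _ => (A : ℝ)⁻¹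
    have hfam : Family k d {insert a f, insert b f} 𝒢₁ := by
      refine ⟨fun H hH => (mem_filter.mp hH).1, fun H hH H' hH' hF => ?_⟩
      rw [h𝒢₁, mem_filter, mem_side] at hH ⊢
      have q1 := hF (insert a f) (by simp)
      have q2 := hF (insert b f) (by simp)
      refine ⟨hH', ?_⟩
      rw [q1, q2]; exact hH.2
    have htail := hfam.card_disc_lt h hd card_le_two (fun H hH =>
      card_eq_of_mem_withDegrees hk hsum (hfam.sub H hH)) hab
    set S := 𝒢₁.filter (fun H => (disc {insert a f, insert b f} H a b : ℝ) < D / 1024)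
    have hε := h.eps_le
    have hε0 := h.eps_pos
    calc (1 - 8100 * (c / k)) * (𝒢₁.card : ℝ)
        ≤ (1 - 4096 * ε) * 𝒢₁.card - S.card := by
          have : (0 : ℝ) ≤ 𝒢₁.card := Nat.cast_nonneg _
          nlinarith
      _ ≤ ∑ H ∈ 𝒢₁, ((1 - 4096 * ε) -
            if (disc {insert a f, insert b f} H a b : ℝ) < D / 1024 then 1 else 0) := by
          have hS : (S.card : ℝ) = ∑ H ∈ 𝒢₁,
              if (disc {insert a f, insert b f} H a b : ℝ) < D / 1024 then 1 else 0 := by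
            rw [card_filter]; push_cast; rfl
          rw [sum_sub_distrib, sum_const, nsmul_eq_mul, hS]
          exact le_of_eq (by ring)
      _ ≤ ∑ H ∈ 𝒢₁, ((side ∅ H a b).card : ℝ)⁻¹ * (side ∅ H b a).card := by
          refine sum_le_sum fun H hH => ?_
          have hw := hfam.sub H hH
          have hA : (0 : ℝ) < (side ∅ H a b).card := by
            exact_mod_cast card_pos.mpr ⟨f, (mem_filter.mp hH).2⟩
          split_ifs with hlt
          · have : (0 : ℝ) ≤ ((side ∅ H a b).card : ℝ)⁻¹ * (side ∅ H b a).card := by positivity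
            linarith
          · push Not at hlt
            have h2 := card_le_card (side_subset_side_empty {insert a f, insert b f} H a b)
            have h3 := card_le_card (side_subset_side_empty {insert a f, insert b f} H b a)
            have h4 : D / 1024 ≤ ((side ∅ H a b).card : ℝ) + (side ∅ H b a).card := by
              refine hlt.trans ?_
              rw [disc]; exact_mod_cast add_le_add h2 h3
            have h5 := hAB H hw
            have h6 := (abs_le.mp (hd.sub_le a b)).2
            rw [sub_zero, le_inv_mul_iff₀ hA]
            nlinarith
      _ = _ := h1
      _ ≤ ∑ H ∈ 𝒢₂, (1 : ℝ) := sum_le_sum fun H _ => inv_mul_le_one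
      _ = _ := by simp
  rw [e1, e2]
  constructor
  · linarith
  · nlinarith

/-- Sets that differ in one element are edges with almost the same probability. -/
theorem numWith_adjacent (h : Sparse (Fintype.card V) k D ε c) (hd : Near D ε d)
    (hsum : ∑ v, d v = k * m) {f : Finset V} {a b : V} (hab : a ≠ b) (ha : a ∉ f) (hb : b ∉ f) :
    (1 - 8100 * (c / k)) * numWith k d (insert a f) ≤ numWith k d (insert b f) := by
  rcases le_total (d b) (d a) with hle | hle
  · exact (numWith_adjacent_aux h hd hsum hab ha hb hle).2
  · have h1 := (numWith_adjacent_aux h hd hsum hab.symm hb ha hle).1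
    have hck : 0 < c / k := div_pos h.c_pos h.k_pos
    have : 0 ≤ numWith k d (insert a f) := Nat.cast_nonneg _
    nlinarith

/-- A bound on the ratio for sets that differ in one element yields one for all sets of size
`k`. -/
theorem pow_mul_le_of_adjacent (k : ℕ) (N : Finset V → ℝ) (hN : ∀ K, K.card = k → 0 ≤ N K)
    {r : ℝ} (hr0 : 0 ≤ r) (hr1 : r ≤ 1)
    (hadj : ∀ f : Finset V, ∀ a b : V, f.card + 1 = k → a ≠ b → a ∉ f → b ∉ f →
      r * N (insert a f) ≤ N (insert b f)) {K L : Finset V} (hK : K.card = k) (hL : L.card = k) :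
    r ^ k * N K ≤ N L := by
  have key : ∀ t : ℕ, ∀ K : Finset V, K.card = k → (K \ L).card = t → r ^ t * N K ≤ N L := by
    intro t
    induction t with
    | zero =>
      intro K hK ht
      have : K ⊆ L := sdiff_eq_empty_iff_subset.mp (card_eq_zero.mp ht)
      rw [eq_of_subset_of_card_le this (by rw [hK, hL]), pow_zero, one_mul]
    | succ t ih =>
      intro K hK ht
      obtain ⟨a, ha⟩ := card_pos.mp (by omega : 0 < (K \ L).card)
      have h1 : (L \ K).card = (K \ L).card := card_sdiff_comm (by rw [hK, hL])
      obtain ⟨b, hb⟩ := card_pos.mp (by omega : 0 < (L \ K).card)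
      rw [mem_sdiff] at ha hb
      have hab : a ≠ b := by rintro rfl; tauto
      have hbK : b ∉ K.erase a := fun h => hb.2 (mem_of_mem_erase h)
      have h2 := hadj (K.erase a) a b (by
        rw [card_erase_of_mem ha.1, hK]; have := card_pos.mpr ⟨a, ha.1⟩; omega) hab
        (notMem_erase _ _) hbK
      rw [insert_erase ha.1] at h2
      have h3 := ih (insert b (K.erase a)) (by
        rw [card_insert_of_notMem hbK, card_erase_of_mem ha.1, hK]
        have := card_pos.mpr ⟨a, ha.1⟩; omega) (by
        have : insert b (K.erase a) \ L = (K \ L).erase a := by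
          ext v; simp only [mem_sdiff, mem_insert, mem_erase]
          constructor
          · rintro ⟨rfl | h, h'⟩
            · tauto
            · tauto
          · tauto
        rw [this, card_erase_of_mem (mem_sdiff.mpr ha), ht]; rfl)
      calc r ^ (t + 1) * N K = r ^ t * (r * N K) := by ring
        _ ≤ r ^ t * N (insert b (K.erase a)) := by gcongr
        _ ≤ _ := h3
  refine le_trans ?_ (key _ K hK rfl)
  refine mul_le_mul_of_nonneg_right ?_ (hN K hK)
  refine pow_le_pow_of_le_one hr0 hr1 ?_
  rw [← hK]; exact card_le_card sdiff_subset

theorem sum_numWith (hk : 0 < k) (hsum : ∑ v, d v = k * m) :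
    ∑ K ∈ powersetCard k (univ : Finset V), numWith k d K = m * (withDegrees k d).card := by
  simp only [numWith, card_filter]
  push_cast
  rw [sum_comm, card_eq_sum_ones]
  push_cast
  rw [mul_sum]
  refine sum_congr rfl fun H hH => ?_
  have h1 : ((powersetCard k (univ : Finset V)).filter fun K => K ∈ H) = H := by
    ext K
    rw [mem_filter, mem_powersetCard]
    exact ⟨fun h => h.2, fun h => ⟨⟨subset_univ _, (mem_withDegrees.mp hH).1 K h⟩, h⟩⟩
  rw [← sum_filter, h1, sum_const, card_eq_of_mem_withDegrees hk hsum hH]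
  simp

/-- All `k`-sets are edges with the same probability, up to a constant factor: two `k`-sets are
connected by at most `k` steps, each of which costs a factor `1 - O(c / k)`. -/
theorem edgeProb_apriori (h : Sparse (Fintype.card V) k D ε c) (hd : Near D ε d)
    (hsum : ∑ v, d v = k * m) (hne : (withDegrees k d).Nonempty) {K : Finset V}
    (hK : K.card = k) :
    9 / 10 * density (Fintype.card V) k m ≤ edgeProb k d K ∧
      edgeProb k d K ≤ 10 / 9 * density (Fintype.card V) k m := by
  have hk : 0 < k := by have := h.three_le; omega
  have hck : 0 < c / k := div_pos h.c_pos h.k_pos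
  have hck3 := h.ck_le
  have hc := h.c_le
  have hr : (0 : ℝ) ≤ 1 - 8100 * (c / k) := by linarith
  have hpow : (9 : ℝ) / 10 ≤ (1 - 8100 * (c / k)) ^ k := by
    have h1 := one_add_mul_le_pow (a := -(8100 * (c / k))) (by linarith) k
    have h2 : (k : ℝ) * -(8100 * (c / k)) = -(8100 * c) := by
      have := h.k_pos; field_simp
    rw [h2] at h1
    rw [sub_eq_add_neg]
    linarith
  have hall : ∀ K L : Finset V, K.card = k → L.card = k →
      9 / 10 * numWith k d K ≤ numWith k d L := by
    intro K L hK hL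
    refine le_trans ?_ (pow_mul_le_of_adjacent k (numWith k d) (fun _ _ => Nat.cast_nonneg _) hr
      (by linarith) (fun f a b _ hab ha hb => numWith_adjacent h hd hsum hab ha hb) hK hL)
    exact mul_le_mul_of_nonneg_right hpow (Nat.cast_nonneg _)
  have hs := sum_numWith hk hsum
  have hG : (0 : ℝ) < (withDegrees k d).card := by exact_mod_cast card_pos.mpr hne
  have hC : (0 : ℝ) < (Fintype.card V).choose k := by exact_mod_cast Nat.choose_pos h.k_le_n
  have hcard : ((powersetCard k (univ : Finset V)).card : ℝ) = (Fintype.card V).choose k := by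
    rw [card_powersetCard, card_univ]
  have u1 : (Fintype.card V).choose k * (9 / 10 * numWith k d K) ≤ m * (withDegrees k d).card := by
    rw [← hs, ← hcard, ← nsmul_eq_mul, ← sum_const]
    exact sum_le_sum fun L hL => hall K L hK (mem_powersetCard.mp hL).2
  have u2 : 9 / 10 * (m * (withDegrees k d).card : ℝ) ≤
      (Fintype.card V).choose k * numWith k d K := by
    rw [← hs, ← hcard, ← nsmul_eq_mul, ← sum_const, mul_sum]
    exact sum_le_sum fun L hL => hall L K (mem_powersetCard.mp hL).2 hK
  have e : edgeProb k d K = numWith k d K / (withDegrees k d).card := rfl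
  rw [e, density]
  constructor
  · rw [le_div_iff₀ hG, mul_div_assoc', div_mul_eq_mul_div, div_le_iff₀ hC]; linarith
  · rw [div_le_iff₀ hG, mul_div_assoc', div_mul_eq_mul_div, le_div_iff₀ hC]; linarith

end

/-! ### Exact relations between probabilities at neighbouring degree sequences -/

section

/-- The degree sequence left after the removal of the edge `K`. -/
def sub1 (d : V → ℤ) (K : Finset V) : V → ℤ := fun v => d v - if v ∈ K then 1 else 0

/-- The number of `k`-graphs with degree sequence `d`. -/
noncomputable def num (k : ℕ) (d : V → ℤ) : ℝ := ((withDegrees k d).card : ℝ)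

/-- The number of `k`-graphs with degree sequence `d` that contain both `K` and `L`. -/
noncomputable def numPair (k : ℕ) (d : V → ℤ) (K L : Finset V) : ℝ :=
  (((withDegrees k d).filter fun H => K ∈ H ∧ L ∈ H).card : ℝ)

/-- The probability that both `K` and `L` are edges. -/
noncomputable def pairProb (k : ℕ) (d : V → ℤ) (K L : Finset V) : ℝ :=
  numPair k d K L / num k d

variable {k m : ℕ} {d : V → ℤ}

/-- The removal of the edge `K` is a bijection onto the graphs with the smaller degrees that do not
contain `K`. -/
theorem card_filter_erase {K : Finset V} (hK : K.card = k) (Q : Finset (Finset V) → Prop)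
    [DecidablePred Q] :
    ((withDegrees k d).filter fun H => K ∈ H ∧ Q (H.erase K)).card =
      ((withDegrees k (sub1 d K)).filter fun H => K ∉ H ∧ Q H).card := by
  refine card_nbij' (fun H => H.erase K) (fun H => insert K H) ?_ ?_ ?_ ?_
  · intro H hH
    simp only [coe_filter, Set.mem_ofPred_eq, mem_withDegrees] at hH ⊢
    refine ⟨⟨fun e he => hH.1.1 e (mem_of_mem_erase he), fun v => ?_⟩, notMem_erase _ _, hH.2.2⟩
    have h1 := hH.1.2 v
    rw [degree_eq_sum, ← add_sum_erase _ _ hH.2.1] at h1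
    rw [degree_eq_sum, sub1, ← h1]
    push_cast; ring
  · intro H hH
    simp only [coe_filter, Set.mem_ofPred_eq, mem_withDegrees] at hH ⊢
    refine ⟨⟨fun e he => ?_, fun v => ?_⟩, mem_insert_self _ _, ?_⟩
    · rcases mem_insert.mp he with rfl | he
      · exact hK
      · exact hH.1.1 e he
    · have h1 := hH.1.2 v
      rw [degree_eq_sum, sub1] at h1
      rw [degree_eq_sum, sum_insert hH.2.1]
      push_cast at h1 ⊢
      rw [h1]; ring
    · rw [erase_insert hH.2.1]; exact hH.2.2
  · intro H hH
    simp only [coe_filter, Set.mem_ofPred_eq] at hH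
    exact insert_erase hH.2.1
  · intro H hH
    simp only [coe_filter, Set.mem_ofPred_eq] at hH
    exact erase_insert hH.2.1

theorem numWith_eq_sub {K : Finset V} (hK : K.card = k) :
    numWith k d K = num k (sub1 d K) - numWith k (sub1 d K) K := by
  have h1 := card_filter_erase (d := d) hK fun _ => True
  simp only [and_true] at h1
  rw [numWith, h1, num, numWith,
    ← card_filter_add_card_filter_not (s := withDegrees k (sub1 d K)) (fun H => K ∈ H)]
  push_cast; ring

theorem numPair_eq_sub {K L : Finset V} (hK : K.card = k) (hKL : K ≠ L) :
    numPair k d K L = numWith k (sub1 d K) L - numPair k (sub1 d K) K L := by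
  have h1 := card_filter_erase (d := d) hK fun H => L ∈ H
  simp only [mem_erase, hKL.symm, Ne, not_false_eq_true, true_and] at h1
  rw [numPair, h1, numWith, numPair, ← card_filter_add_card_filter_not
    (s := (withDegrees k (sub1 d K)).filter fun H => L ∈ H) (fun H => K ∈ H), filter_filter,
    filter_filter]
  simp only [and_comm (a := L ∈ _)]
  push_cast; ring

theorem edgeProb_eq (K : Finset V) : edgeProb k d K = numWith k d K / num k d := rfl

theorem num_pos (hne : (withDegrees k d).Nonempty) : 0 < num k d := by
  rw [num]; exact_mod_cast card_pos.mpr hne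

theorem edgeProb_mul_num (hne : (withDegrees k d).Nonempty) (K : Finset V) :
    edgeProb k d K * num k d = numWith k d K := by
  rw [edgeProb_eq, div_mul_cancel₀ _ (num_pos hne).ne']

theorem pairProb_mul_num (hne : (withDegrees k d).Nonempty) (K L : Finset V) :
    pairProb k d K L * num k d = numPair k d K L := by
  rw [pairProb, div_mul_cancel₀ _ (num_pos hne).ne']

theorem edgeProb_mul_num_sub1 (hne : (withDegrees k d).Nonempty) {K : Finset V}
    (hne' : (withDegrees k (sub1 d K)).Nonempty) (hK : K.card = k) :
    edgeProb k d K * num k d = num k (sub1 d K) * (1 - edgeProb k (sub1 d K) K) := by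
  rw [edgeProb_mul_num hne, numWith_eq_sub hK, ← edgeProb_mul_num hne']; ring

/-- The probability that two given sets are edges, in terms of the degree sequence without the
first of them. -/
theorem pairProb_recursion (hne : (withDegrees k d).Nonempty) {K L : Finset V}
    (hne' : (withDegrees k (sub1 d K)).Nonempty) (hK : K.card = k) (hKL : K ≠ L) :
    pairProb k d K L * (1 - edgeProb k (sub1 d K) K) =
      edgeProb k d K * (edgeProb k (sub1 d K) L - pairProb k (sub1 d K) K L) := by
  have h1 := edgeProb_mul_num_sub1 hne hne' hK
  have h2 : pairProb k d K L * num k d =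
      num k (sub1 d K) * (edgeProb k (sub1 d K) L - pairProb k (sub1 d K) K L) := by
    rw [pairProb_mul_num hne, numPair_eq_sub hK hKL, ← edgeProb_mul_num hne',
      ← pairProb_mul_num hne']
    ring
  have h3 := num_pos hne'
  have h4 := num_pos hne
  refine mul_right_cancel₀ (mul_pos h3 h4).ne' ?_
  calc _ = (pairProb k d K L * num k d) * (num k (sub1 d K) * (1 - edgeProb k (sub1 d K) K)) := by
        ring
    _ = _ := by rw [h2, ← h1]; ring

/-- The `k`-sets that contain both `a` and `b`. -/
def setsBoth (k : ℕ) (a b : V) : Finset (Finset V) :=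
  (powersetCard k univ).filter fun e => a ∈ e ∧ b ∈ e

/-- The `(k-1)`-sets that contain neither `a` nor `b`. -/
def setsNone (k : ℕ) (a b : V) : Finset (Finset V) :=
  (powersetCard (k - 1) univ).filter fun g => a ∉ g ∧ b ∉ g

/-- The expected number of edges through `a` that cannot be moved to `b`, because they contain `b`
or because their image is an edge already. -/
noncomputable def blocked (k : ℕ) (d : V → ℤ) (a b : V) : ℝ :=
  ∑ e ∈ setsBoth k a b, edgeProb k d e +
    ∑ g ∈ setsNone k a b, pairProb k d (insert a g) (insert b g)

theorem blocked_mul_num (hk : 0 < k) (hne : (withDegrees k d).Nonempty) {a b : V} :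
    blocked k d a b * num k d =
      ∑ H ∈ withDegrees k d, ((codeg H a b : ℝ) + com H a b) := by
  rw [blocked, add_mul, sum_mul, sum_mul, sum_add_distrib]
  congr 1
  · simp only [edgeProb_mul_num hne, numWith, codeg, card_filter]
    push_cast
    rw [sum_comm]
    refine sum_congr rfl fun H hH => ?_
    rw [← sum_filter, ← sum_filter]
    have : (setsBoth k a b).filter (fun e => e ∈ H) = H.filter fun e => a ∈ e ∧ b ∈ e := by
      ext e
      simp only [setsBoth, mem_filter, mem_powersetCard, subset_univ, true_and]
      have := (mem_withDegrees.mp hH).1 e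
      tauto
    rw [this]
  · simp only [pairProb_mul_num hne, numPair, com, card_filter]
    push_cast
    rw [sum_comm]
    refine sum_congr rfl fun H hH => ?_
    rw [← sum_filter, ← sum_filter]
    have : (setsNone k a b).filter (fun g => insert a g ∈ H ∧ insert b g ∈ H) =
        univ.filter fun g => a ∉ g ∧ b ∉ g ∧ insert a g ∈ H ∧ insert b g ∈ H := by
      ext g
      simp only [setsNone, mem_filter, mem_powersetCard, subset_univ, mem_univ, true_and]
      constructor
      · tauto
      · rintro ⟨h1, h2, h3, h4⟩
        have := (mem_withDegrees.mp hH).1 _ h3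
        rw [card_insert_of_notMem h1] at this
        exact ⟨⟨by omega, h1, h2⟩, h3, h4⟩
    rw [this]

theorem sum_card_side_eq (hk : 0 < k) (hne : (withDegrees k d).Nonempty) {a b : V}
    (hab : a ≠ b) :
    ∑ H ∈ withDegrees k d, ((side ∅ H a b).card : ℝ) = num k d * (d a - blocked k d a b) := by
  rw [mul_sub, mul_comm _ (blocked k d a b), blocked_mul_num hk hne, num, ← nsmul_eq_mul,
    ← sum_const, ← sum_sub_distrib]
  refine sum_congr rfl fun H hH => ?_
  rw [← degree_cast hH, degree_eq_side_add H hab]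
  push_cast; ring

theorem setsBoth_comm (k : ℕ) (a b : V) : setsBoth k a b = setsBoth k b a := by
  unfold setsBoth; simp only [and_comm]

theorem blocked_comm (k : ℕ) (d : V → ℤ) (a b : V) : blocked k d a b = blocked k d b a := by
  unfold blocked
  rw [setsBoth_comm]
  congr 1
  unfold setsNone
  simp only [and_comm (a := a ∉ _)]
  refine sum_congr rfl fun g _ => ?_
  unfold pairProb numPair
  simp only [and_comm]

/-- The exact relation between the probabilities of two sets that differ in one element: both are
expressed by the number of graphs without that edge, and the two degree sequences that remain
differ by a move of one unit from `b` to `a`. -/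
theorem edgeProb_switch (hk : 0 < k) (hne : (withDegrees k d).Nonempty) {f : Finset V} {a b : V}
    (hab : a ≠ b) (ha : a ∉ f) (hb : b ∉ f) (hf : f.card + 1 = k)
    (hne1 : (withDegrees k (sub1 d (insert b f))).Nonempty)
    (hne2 : (withDegrees k (sub1 d (insert a f))).Nonempty) :
    edgeProb k d (insert a f) * (d b - blocked k (sub1 d (insert a f)) a b) *
        (1 - edgeProb k (sub1 d (insert b f)) (insert b f)) =
      edgeProb k d (insert b f) * (d a - blocked k (sub1 d (insert b f)) a b) *
        (1 - edgeProb k (sub1 d (insert a f)) (insert a f)) := by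
  have hs : shift (sub1 d (insert a f)) b a = sub1 d (insert b f) := by
    funext v
    simp only [shift, sub1, mem_insert]
    by_cases hva : v = a
    · subst hva; simp [hab, ha]
    · by_cases hvb : v = b
      · subst hvb; simp [hva, hb]
      · simp [hva, hvb]
  have h1 := sum_card_side_shift k (sub1 d (insert a f)) hab
  rw [hs] at h1
  have h2 : ∑ H ∈ withDegrees k (sub1 d (insert a f)), ((side ∅ H b a).card : ℝ) =
      ∑ H ∈ withDegrees k (sub1 d (insert b f)), ((side ∅ H a b).card : ℝ) := by
    exact_mod_cast h1
  rw [sum_card_side_eq hk hne2 hab.symm, sum_card_side_eq hk hne1 hab, blocked_comm k _ b a] at h2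
  have e1 : sub1 d (insert a f) b = d b := by simp [sub1, hab.symm, hb]
  have e2 : sub1 d (insert b f) a = d a := by simp [sub1, hab, ha]
  rw [e1, e2] at h2
  have h3 := edgeProb_mul_num_sub1 hne hne2 (by rw [card_insert_of_notMem ha, hf])
  have h4 := edgeProb_mul_num_sub1 hne hne1 (by rw [card_insert_of_notMem hb, hf])
  refine mul_right_cancel₀ (num_pos hne).ne' ?_
  set p2 := edgeProb k (sub1 d (insert a f)) (insert a f)
  set p1 := edgeProb k (sub1 d (insert b f)) (insert b f)
  calc _ = (edgeProb k d (insert a f) * num k d) *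
        (d b - blocked k (sub1 d (insert a f)) a b) * (1 - p1) := by ring
    _ = (num k (sub1 d (insert a f)) * (d b - blocked k (sub1 d (insert a f)) a b)) *
        (1 - p2) * (1 - p1) := by rw [h3]; ring
    _ = (num k (sub1 d (insert b f)) * (1 - p1)) *
        (d a - blocked k (sub1 d (insert b f)) a b) * (1 - p2) := by rw [h2]; ring
    _ = _ := by rw [← h4]; ring

theorem card_setsNone (k : ℕ) {a b : V} (hab : a ≠ b) :
    (setsNone k a b).card = (Fintype.card V - 2).choose (k - 1) := by
  have : setsNone k a b = powersetCard (k - 1) (univ \ {a, b}) := by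
    ext g
    simp only [setsNone, mem_filter, mem_powersetCard, subset_univ, true_and, subset_sdiff,
      disjoint_insert_right, disjoint_singleton_right]
    tauto
  rw [this, card_powersetCard, card_sdiff_of_subset (subset_univ _), card_univ, card_pair hab]

theorem card_setsBoth {k : ℕ} (hk : 2 ≤ k) {a b : V} (hab : a ≠ b) :
    (setsBoth k a b).card = (Fintype.card V - 2).choose (k - 2) := by
  have h1 : (powersetCard (k - 2) ((univ : Finset V) \ {a, b})).card =
      (Fintype.card V - 2).choose (k - 2) := by
    rw [card_powersetCard, card_sdiff_of_subset (subset_univ _), card_univ, card_pair hab]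
  rw [← h1]
  have key : ∀ g : Finset V, g ⊆ univ \ {a, b} → a ∉ g ∧ b ∉ g := by
    intro g hg
    simpa [subset_sdiff, disjoint_insert_right] using hg
  refine card_nbij' (fun e => e \ {a, b}) (fun g => insert a (insert b g)) ?_ ?_ ?_ ?_
  · intro e he
    simp only [setsBoth, coe_filter, Set.mem_ofPred_eq, mem_powersetCard, subset_univ,
      true_and, mem_coe] at he ⊢
    refine ⟨sdiff_subset_sdiff (subset_univ _) le_rfl, ?_⟩
    rw [card_sdiff_of_subset (by simp [insert_subset_iff, he.2]), card_pair hab, he.1]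
  · intro g hg
    simp only [setsBoth, coe_filter, Set.mem_ofPred_eq, mem_powersetCard, subset_univ,
      true_and, mem_coe] at hg ⊢
    have := key g hg.1
    refine ⟨?_, mem_insert_self _ _, mem_insert_of_mem (mem_insert_self _ _)⟩
    rw [card_insert_of_notMem (by simp [hab, this.1]), card_insert_of_notMem this.2, hg.2]
    omega
  · intro e he
    simp only [setsBoth, coe_filter, Set.mem_ofPred_eq] at he
    ext v
    simp only [mem_insert, mem_sdiff, mem_singleton]
    by_cases hva : v = a
    · subst hva; tauto
    · by_cases hvb : v = b
      · subst hvb; tauto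
      · tauto
  · intro g hg
    simp only [mem_coe, mem_powersetCard] at hg
    have := key g hg.1
    ext v
    simp only [mem_insert, mem_sdiff, mem_singleton]
    by_cases hva : v = a
    · subst hva; tauto
    · by_cases hvb : v = b
      · subst hvb; tauto
      · tauto

theorem sum_sum_mem_eq_zero (k : ℕ) (g : V → ℝ) (hg : ∑ v, g v = 0) :
    ∑ K ∈ powersetCard k (univ : Finset V), ∑ v ∈ K, g v = 0 := by
  induction k with
  | zero => simp
  | succ j ih =>
    rw [sum_powersetCard_succ j fun _ x => g x]
    have : ∀ p : Finset V, ∑ x ∈ pᶜ, g x = -∑ x ∈ p, g x := by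
      intro p
      have := sum_add_sum_compl p g
      linarith
    simp only [this, sum_neg_distrib, ih, neg_zero]

/-- The mean of a degree sequence. -/
noncomputable def meanDeg (d : V → ℤ) : ℝ := (∑ v, (d v : ℝ)) / Fintype.card V

/-- The approximation to `P_K(d)`, multiplied by `C(n-1, k-1)`. -/
noncomputable def approx (k : ℕ) (d : V → ℤ) (K : Finset V) : ℝ :=
  meanDeg d + ((Fintype.card V : ℝ) - 1) / ((Fintype.card V : ℝ) - k) *
    ∑ v ∈ K, ((d v : ℝ) - meanDeg d)

end

/-! ### The approximating formula -/

section

variable {k m : ℕ} {d : V → ℤ} {D ε c τ : ℝ}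

/-- The factor `(n-k)/(n-1)`, the proportion, among the `(k-1)`-sets avoiding one vertex, of
those that avoid a second one; its inverse multiplies the deviations of the degrees in `approx`. -/
noncomputable def gam (n k : ℕ) : ℝ := ((n : ℝ) - k) / ((n : ℝ) - 1)

theorem Sparse.n_gt {n : ℕ} (h : Sparse n k D ε c) : (3 * 10 ^ 6 : ℝ) ≤ n := by
  linarith [h.n_ge, h.three_le']

theorem Sparse.gam_ge {n : ℕ} (h : Sparse n k D ε c) : 991 / 1000 ≤ gam n k := by
  have h1 := h.n_ge
  have h2 := h.n_gt
  rw [gam, le_div_iff₀ (by linarith)]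
  linarith

theorem Sparse.gam_le {n : ℕ} (h : Sparse n k D ε c) : gam n k ≤ 1 := by
  have h2 := h.n_gt
  rw [gam, div_le_one (by linarith)]
  linarith [h.three_le']

theorem approx_eq (k : ℕ) (d : V → ℤ) (K : Finset V) :
    approx k d K =
      meanDeg d + (gam (Fintype.card V) k)⁻¹ * ∑ v ∈ K, ((d v : ℝ) - meanDeg d) := by
  rw [approx, gam, inv_div]

theorem Sparse.inv_gam_le {n : ℕ} (h : Sparse n k D ε c) : (gam n k)⁻¹ ≤ 101 / 100 := by
  rw [inv_le_comm₀ (by linarith [h.gam_ge]) (by norm_num)]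
  refine le_trans ?_ h.gam_ge
  norm_num

theorem Sparse.inv_gam_nonneg {n : ℕ} (h : Sparse n k D ε c) : 0 ≤ (gam n k)⁻¹ := by
  have := h.gam_ge
  positivity

theorem abs_meanDeg_sub_le (hn : 0 < Fintype.card V) (hd : ∀ v, |(d v : ℝ) - D| ≤ τ) :
    |meanDeg d - D| ≤ τ := by
  have hn' : (0 : ℝ) < Fintype.card V := by exact_mod_cast hn
  have e : meanDeg d - D = (∑ v, ((d v : ℝ) - D)) / Fintype.card V := by
    rw [meanDeg, sum_sub_distrib, sum_const, card_univ, nsmul_eq_mul, sub_div,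
      mul_div_cancel_left₀ _ hn'.ne']
  rw [e, abs_div, abs_of_pos hn', div_le_iff₀ hn']
  calc _ ≤ ∑ v, |(d v : ℝ) - D| := abs_sum_le_sum_abs _ _
    _ ≤ ∑ _v : V, τ := sum_le_sum fun v _ => hd v
    _ = _ := by rw [sum_const, card_univ, nsmul_eq_mul, mul_comm]

theorem abs_approx_sub_le (h : Sparse (Fintype.card V) k D ε c) (hd : Near D ε d) {K : Finset V}
    (hK : K.card = k) : |approx k d K - D| ≤ 4 * (k * ε) * D := by
  have hn : 0 < Fintype.card V := by exact_mod_cast h.n_pos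
  have h1 := abs_meanDeg_sub_le hn hd
  have hD := h.D_pos
  have hε := h.eps_pos
  have h2 : |∑ v ∈ K, ((d v : ℝ) - meanDeg d)| ≤ k * (2 * (ε * D)) := by
    calc _ ≤ ∑ v ∈ K, |(d v : ℝ) - meanDeg d| := abs_sum_le_sum_abs _ _
      _ ≤ ∑ v ∈ K, 2 * (ε * D) := sum_le_sum fun v _ => by
          have := hd v
          rw [abs_le] at *
          constructor <;> linarith [h1.1, h1.2, this.1, this.2]
      _ = _ := by rw [sum_const, nsmul_eq_mul, hK]
  have h3 : |(gam (Fintype.card V) k)⁻¹ * ∑ v ∈ K, ((d v : ℝ) - meanDeg d)| ≤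
      101 / 100 * (k * (2 * (ε * D))) := by
    rw [abs_mul, abs_of_nonneg h.inv_gam_nonneg]
    exact mul_le_mul h.inv_gam_le h2 (abs_nonneg _) (by norm_num)
  have h4 : 3 * (ε * D) ≤ k * (ε * D) :=
    mul_le_mul_of_nonneg_right h.three_le' (by positivity)
  rw [approx_eq]
  rw [abs_le] at *
  constructor <;> nlinarith [h1.1, h1.2, h3.1, h3.2]

theorem meanDeg_sub1 {K : Finset V} (hK : K.card = k) :
    meanDeg (sub1 d K) = meanDeg d - k / Fintype.card V := by
  rw [meanDeg, meanDeg, ← sub_div]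
  congr 1
  simp only [sub1]
  push_cast
  rw [sum_sub_distrib, sum_ite_mem, univ_inter, sum_const, hK]
  simp

theorem approx_sub1 {K L : Finset V} (hK : K.card = k) (hL : L.card = k) :
    approx k (sub1 d K) L = approx k d L - k / Fintype.card V +
      (gam (Fintype.card V) k)⁻¹ * (k * (k / Fintype.card V) - (L ∩ K).card) := by
  rw [approx_eq, approx_eq, meanDeg_sub1 hK]
  have : ∑ v ∈ L, ((sub1 d K v : ℝ) - (meanDeg d - k / Fintype.card V)) =
      ∑ v ∈ L, ((d v : ℝ) - meanDeg d) + (k * (k / Fintype.card V) - (L ∩ K).card) := by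
    simp only [sub1]
    push_cast
    simp only [sum_sub_distrib, sum_const, hL, sum_ite_mem, nsmul_eq_mul, mul_one]
    ring
  rw [this]; ring

theorem abs_approx_sub1_sub_le (h : Sparse (Fintype.card V) k D ε c) {K L : Finset V}
    (hK : K.card = k) (hL : L.card = k) :
    |approx k (sub1 d K) L - approx k d L| ≤ 2 * k := by
  have hn := h.n_pos
  have hk3 := h.three_le'
  have h1 : (k : ℝ) / Fintype.card V ≤ 1 / 10 ^ 6 := by
    rw [div_le_div_iff₀ hn (by norm_num)]; linarith [h.n_ge]
  have h2 : (0 : ℝ) ≤ (k : ℝ) / Fintype.card V := by positivity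
  have h3 : ((L ∩ K).card : ℝ) ≤ k := by
    have := card_le_card (inter_subset_left (s₁ := L) (s₂ := K))
    rw [hL] at this; exact_mod_cast this
  have h4 : (0 : ℝ) ≤ (L ∩ K).card := Nat.cast_nonneg _
  have h6 : |(k : ℝ) * (k / Fintype.card V) - (L ∩ K).card| ≤ k := by
    rw [abs_le]; constructor <;> nlinarith
  have h7 : |(gam (Fintype.card V) k)⁻¹ * (k * (k / Fintype.card V) - (L ∩ K).card)| ≤
      101 / 100 * k := by
    rw [abs_mul, abs_of_nonneg h.inv_gam_nonneg]
    exact mul_le_mul h.inv_gam_le h6 (abs_nonneg _) (by norm_num)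
  rw [approx_sub1 hK hL]
  rw [abs_le] at *
  constructor <;> linarith [h7.1, h7.2]

theorem approx_insert_sub {f : Finset V} {a b : V} (ha : a ∉ f) (hb : b ∉ f) :
    approx k d (insert a f) - approx k d (insert b f) =
      (gam (Fintype.card V) k)⁻¹ * (d a - d b) := by
  rw [approx_eq, approx_eq, sum_insert ha, sum_insert hb]; ring

theorem approx_sub1_insert_sub {f : Finset V} {a b : V} (ha : a ∉ f) (hb : b ∉ f)
    (hf : f.card + 1 = k) :
    approx k (sub1 d (insert a f)) (insert a f) - approx k (sub1 d (insert b f)) (insert b f) =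
      (gam (Fintype.card V) k)⁻¹ * (d a - d b) := by
  have h1 : (insert a f).card = k := by rw [card_insert_of_notMem ha, hf]
  have h2 : (insert b f).card = k := by rw [card_insert_of_notMem hb, hf]
  rw [approx_sub1 h1 h1, approx_sub1 h2 h2, inter_self, inter_self, h1, h2,
    ← approx_insert_sub ha hb]
  ring

theorem meanDeg_mul (h : Sparse (Fintype.card V) k D ε c) (hsum : ∑ v, d v = k * m) :
    ((Fintype.card V).choose k : ℝ) * meanDeg d =
      m * ((Fintype.card V - 1).choose (k - 1) : ℝ) := by
  have h1 : ∑ v, (d v : ℝ) = k * m := by exact_mod_cast congrArg (Int.cast : ℤ → ℝ) hsum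
  have h2 := choose_cast h
  have hn := h.n_pos
  rw [meanDeg, h1, ← mul_div_assoc, div_eq_iff hn.ne']
  linear_combination m * h2

theorem sum_approx (h : Sparse (Fintype.card V) k D ε c) (hsum : ∑ v, d v = k * m) :
    ∑ K ∈ powersetCard k (univ : Finset V), approx k d K =
      m * ((Fintype.card V - 1).choose (k - 1) : ℝ) := by
  have hn := h.n_pos
  unfold approx
  rw [sum_add_distrib, ← mul_sum, sum_sum_mem_eq_zero, mul_zero, add_zero, sum_const,
    card_powersetCard, card_univ, nsmul_eq_mul, meanDeg_mul h hsum]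
  rw [sum_sub_distrib, sum_const, card_univ, nsmul_eq_mul, meanDeg, mul_div_cancel₀ _ hn.ne',
    sub_self]

/-- The coefficient of `s` in the expansion of `switch_ratio`, in terms of the deviations of all
quantities from their main terms. -/
theorem switch_bracket {α y g g' e6 e7 μ κ w ε : ℝ} (hκ : 3 * ε ≤ κ) (hε : 0 ≤ ε)
    (hw : 0 ≤ w) (hμ : 0 ≤ μ) (hμ1 : μ ≤ 1 / 10 ^ 6) (hg : |g| ≤ 4 * κ) (hg' : |g'| ≤ 4 * κ)
    (hα1 : |α| ≤ 1001 / 1000) (hy1 : |y| ≤ 1001 / 1000) (h6 : |e6| ≤ 4 * ε + w)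
    (h7 : |e7| ≤ 21 / 10 * ε + 15 * w) :
    |α * g' - y * μ * g + μ * (e6 - e7) - α * e7| ≤ 48 / 10 * κ + 16 * w := by
  have t1 : |α * g'| ≤ 1001 / 1000 * (4 * κ) := by
    rw [abs_mul]; exact mul_le_mul hα1 hg' (abs_nonneg _) (by norm_num)
  have t2 : |y * μ * g| ≤ 1001 / 1000 * (1 / 10 ^ 6) * (4 * κ) := by
    rw [abs_mul, abs_mul, abs_of_nonneg hμ]
    exact mul_le_mul (mul_le_mul hy1 hμ1 hμ (by norm_num)) hg (abs_nonneg _) (by norm_num)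
  have t3 : |μ * (e6 - e7)| ≤ 1 / 10 ^ 6 * (7 * ε + 16 * w) := by
    rw [abs_mul, abs_of_nonneg hμ]
    refine mul_le_mul hμ1 ?_ (abs_nonneg _) (by norm_num)
    have := abs_sub e6 e7
    linarith
  have t4 : |α * e7| ≤ 1001 / 1000 * (21 / 10 * ε + 15 * w) := by
    rw [abs_mul]; exact mul_le_mul hα1 h7 (abs_nonneg _) (by norm_num)
  have u1 := abs_le.mp t1
  have u2 := abs_le.mp t2
  have u3 := abs_le.mp t3
  have u4 := abs_le.mp t4
  rw [abs_le]
  constructor <;> linarith [u1.1, u1.2, u2.1, u2.2, u3.1, u3.2, u4.1, u4.2]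

/-- The estimate behind the comparison of two adjacent sets. Each side is the product of the number
of possible moves (`A`, `B'`), the probability that an edge is absent (`α`, `β`) and the value of
`approx`, all normalized. The difference `s` of the two degrees enters each of the three factors,
and to first order these contributions cancel. -/
theorem switch_ratio {A B' α β g g' s μ γ κ w ε : ℝ} (hκ : 3 * ε ≤ κ) (hκ1 : κ ≤ 1 / 10 ^ 6)
    (hε : 0 ≤ ε) (hw : 0 ≤ w) (hw1 : w ≤ 1 / 10 ^ 5) (hμ : 0 ≤ μ) (hμ1 : μ ≤ 1 / 10 ^ 6)
    (hγ : 99 / 100 ≤ γ) (hγ1 : γ ≤ 1) (hgg : g = g' + γ⁻¹ * s) (hg : |g| ≤ 4 * κ)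
    (hg' : |g'| ≤ 4 * κ) (hs : |s| ≤ 2 * ε) (hAB : |A - B' - s| ≤ 34 * w)
    (hβα : |β - α - γ⁻¹ * s * μ| ≤ 2 * w) (hα : |α - (1 - μ)| ≤ 4 * ε + w)
    (hB : |B' - γ * (1 - μ)| ≤ 2 * ε + 14 * w) :
    0 < B' * β ∧ A * α * (1 + g') ≤ (1 + (12 * κ * ε + 50 * w)) * (B' * β * (1 + g)) := by
  have hγ0 : 0 < γ := by linarith
  have hi : γ⁻¹ ≤ 102 / 100 := by
    rw [inv_le_comm₀ hγ0 (by norm_num)]; linarith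
  have hi0 : 0 ≤ γ⁻¹ := by positivity
  obtain ⟨y, hy⟩ : ∃ y, y = γ⁻¹ * B' := ⟨_, rfl⟩
  obtain ⟨e1, he1⟩ : ∃ e1, e1 = A - B' - s := ⟨_, rfl⟩
  obtain ⟨e2, he2⟩ : ∃ e2, e2 = β - α - γ⁻¹ * s * μ := ⟨_, rfl⟩
  obtain ⟨e6, he6⟩ : ∃ e6, e6 = α - (1 - μ) := ⟨_, rfl⟩
  obtain ⟨e7, he7⟩ : ∃ e7, e7 = y - (1 - μ) := ⟨_, rfl⟩
  have h7 : |e7| ≤ 21 / 10 * ε + 15 * w := by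
    have : e7 = γ⁻¹ * (B' - γ * (1 - μ)) := by rw [he7, hy]; field_simp
    rw [this, abs_mul, abs_of_nonneg hi0]
    have := mul_le_mul hi hB (abs_nonneg _) (by norm_num)
    linarith
  rw [← he1] at hAB
  rw [← he2] at hβα
  rw [← he6] at hα
  have hα1 : |α| ≤ 1001 / 1000 := by
    have := abs_le.mp hα
    rw [abs_le]; constructor <;> linarith [this.1, this.2]
  have hy1 : |y| ≤ 1001 / 1000 := by
    have := abs_le.mp h7
    rw [abs_le]; constructor <;> linarith [this.1, this.2]
  have hB1 : |B'| ≤ 1001 / 1000 := by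
    have : B' = γ * y := by rw [hy]; field_simp
    rw [this, abs_mul, abs_of_pos hγ0]
    calc γ * |y| ≤ 1 * (1001 / 1000) := mul_le_mul hγ1 hy1 (abs_nonneg _) zero_le_one
      _ = _ := one_mul _
  have hbr := switch_bracket hκ hε hw hμ hμ1 hg hg' hα1 hy1 hα h7
  have hsb : |s * (α * g' - y * μ * g + μ * (e6 - e7) - α * e7)| ≤
      2 * ε * (48 / 10 * κ + 16 * w) := by
    rw [abs_mul]; exact mul_le_mul hs hbr (abs_nonneg _) (by linarith)
  have hg1 : |1 + g| ≤ 1001 / 1000 := by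
    have := abs_le.mp hg
    rw [abs_le]; constructor <;> linarith [this.1, this.2]
  have hg1' : |1 + g'| ≤ 1001 / 1000 := by
    have := abs_le.mp hg'
    rw [abs_le]; constructor <;> linarith [this.1, this.2]
  have t5 : |e1 * α * (1 + g')| ≤ 34 * w * (1001 / 1000) * (1001 / 1000) := by
    rw [abs_mul, abs_mul]
    exact mul_le_mul (mul_le_mul hAB hα1 (abs_nonneg _) (by linarith)) hg1' (abs_nonneg _)
      (by positivity)
  have t6 : |B' * e2 * (1 + g)| ≤ 1001 / 1000 * (2 * w) * (1001 / 1000) := by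
    rw [abs_mul, abs_mul]
    exact mul_le_mul (mul_le_mul hB1 hβα (abs_nonneg _) (by norm_num)) hg1 (abs_nonneg _)
      (by positivity)
  -- the exact difference; the bracket vanishes for the main terms
  have key : A * α * (1 + g') - B' * β * (1 + g) =
      s * (α * g' - y * μ * g + μ * (e6 - e7) - α * e7) + e1 * α * (1 + g') -
        B' * e2 * (1 + g) := by
    have hA : A = B' + s + e1 := by rw [he1]; ring
    have hβ : β = α + γ⁻¹ * s * μ + e2 := by rw [he2]; ring
    rw [hA, hβ, he6, he7, hy, hgg]; ring
  have hBlo : 98 / 100 ≤ B' := by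
    have h1 := (abs_le.mp hB).1
    have h2 : 99 / 100 * (1 - 1 / 10 ^ 6) ≤ γ * (1 - μ) :=
      mul_le_mul hγ (by linarith) (by norm_num) hγ0.le
    linarith
  have hβlo : 999 / 1000 ≤ β := by
    have h1 := (abs_le.mp hα).1
    have h2 := (abs_le.mp hβα).1
    have h3 : |γ⁻¹ * s * μ| ≤ 102 / 100 * (2 * ε) * (1 / 10 ^ 6) := by
      rw [abs_mul, abs_mul, abs_of_nonneg hi0, abs_of_nonneg hμ]
      exact mul_le_mul (mul_le_mul hi hs (abs_nonneg _) (by norm_num)) hμ1 hμ (by positivity)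
    have h4 := (abs_le.mp h3).1
    linarith
  have hBβ : 97 / 100 ≤ B' * β := by
    have : (98 : ℝ) / 100 * (999 / 1000) ≤ B' * β :=
      mul_le_mul hBlo hβlo (by norm_num) (by linarith)
    linarith
  have hmain : 96 / 100 ≤ B' * β * (1 + g) := by
    have h1 := (abs_le.mp hg).1
    have : (97 : ℝ) / 100 * (999 / 1000) ≤ B' * β * (1 + g) :=
      mul_le_mul hBβ (by linarith) (by norm_num) (by linarith)
    linarith
  refine ⟨by linarith, ?_⟩
  have h1 := (abs_le.mp hsb).2
  have h2 := (abs_le.mp t5).2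
  have h3 := (abs_le.mp t6).1
  have h4 : (12 * κ * ε + 50 * w) * (96 / 100) ≤ (12 * κ * ε + 50 * w) * (B' * β * (1 + g)) :=
    mul_le_mul_of_nonneg_left hmain (by have : 0 ≤ κ := by linarith
                                        positivity)
  have h5 : 0 ≤ κ * ε := mul_nonneg (by linarith) hε
  have h6 : ε * w ≤ 1 / 10 ^ 6 * w := mul_le_mul_of_nonneg_right (by linarith) hw
  linarith

end

/-! ### Consequences of approximate edge and pair probabilities -/

section

variable {k m : ℕ} {d : V → ℤ} {D ε c τ η : ℝ}

/-- The degree sequences of `k`-uniform type (the sum is a multiple of `k`) whose entries are all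
within `τ` of `D`. -/
def Region (k : ℕ) (D τ : ℝ) : Set (V → ℤ) :=
  {d | (∃ m : ℕ, ∑ v, d v = k * m) ∧ ∀ v, |(d v : ℝ) - D| ≤ τ}

/-- The order of magnitude of the edge probabilities. -/
noncomputable def mu (n k : ℕ) (D : ℝ) : ℝ := D / (n - 1).choose (k - 1)

theorem Sparse.choose_pos {n : ℕ} (h : Sparse n k D ε c) :
    (0 : ℝ) < (n - 1).choose (k - 1) := by
  have h1 := h.k_le_n
  exact_mod_cast Nat.choose_pos (by omega)

theorem Sparse.mu_pos {n : ℕ} (h : Sparse n k D ε c) : 0 < mu n k D :=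
  div_pos h.D_pos h.choose_pos

theorem Sparse.mu_le {n : ℕ} (h : Sparse n k D ε c) : mu n k D ≤ c / k := by
  rw [mu, div_le_div_iff₀ h.choose_pos h.k_pos]
  linarith [h.k_dens]

theorem Sparse.ck_small {n : ℕ} (h : Sparse n k D ε c) : c / k ≤ 1 / 3 / 10 ^ 6 := by
  linarith [h.ck_le, h.c_le]

theorem Sparse.mu_small {n : ℕ} (h : Sparse n k D ε c) : mu n k D ≤ 1 / 3 / 10 ^ 6 :=
  h.mu_le.trans h.ck_small

theorem Sparse.choose_mul_mu {n : ℕ} (h : Sparse n k D ε c) :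
    ((n - 1).choose (k - 1) : ℝ) * mu n k D = D := by
  rw [mu, mul_div_cancel₀ _ h.choose_pos.ne']

theorem choose_none_eq {n : ℕ} (h : Sparse n k D ε c) :
    ((n - 2).choose (k - 1) : ℝ) = gam n k * (n - 1).choose (k - 1) := by
  have h1 := h.k_le_n
  have h2 := h.three_le
  obtain ⟨j, rfl⟩ : ∃ j, k = j + 2 := ⟨k - 2, by omega⟩
  obtain ⟨l, rfl⟩ : ∃ l, n = l + (j + 2) := ⟨n - (j + 2), by omega⟩
  have e1 := Nat.choose_mul_succ_eq (l + j) (j + 1)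
  have e2 : ((l + j).choose (j + 1) : ℝ) * (l + j + 1) = (l + j + 1).choose (j + 1) * l := by
    have e3 : l + j + 1 - (j + 1) = l := by omega
    rw [e3] at e1
    exact_mod_cast e1
  have e4 : l + (j + 2) - 2 = l + j := by omega
  have e5 : l + (j + 2) - 1 = l + j + 1 := by omega
  have e6 : j + 2 - 1 = j + 1 := by omega
  rw [e4, e5, e6, gam]
  push_cast
  have h3 : (l + (j + 2) - 1 : ℝ) = l + j + 1 := by ring
  rw [h3, div_mul_eq_mul_div, eq_div_iff (by positivity), e2]
  ring

theorem choose_both_eq {n : ℕ} (h : Sparse n k D ε c) :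
    ((n - 2).choose (k - 2) : ℝ) = (1 - gam n k) * (n - 1).choose (k - 1) := by
  have h0 := choose_none_eq h
  have h1 := h.k_le_n
  have h2 := h.three_le
  have e : (n - 1).choose (k - 1) = (n - 2).choose (k - 2) + (n - 2).choose (k - 1) := by
    obtain ⟨j, rfl⟩ : ∃ j, k = j + 2 := ⟨k - 2, by omega⟩
    obtain ⟨l, rfl⟩ : ∃ l, n = l + 2 := ⟨n - 2, by omega⟩
    exact Nat.choose_succ_succ l j
  have e' : ((n - 1).choose (k - 1) : ℝ) = (n - 2).choose (k - 2) + (n - 2).choose (k - 1) := by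
    exact_mod_cast e
  linarith

theorem Sparse.one_sub_gam_le {n : ℕ} (h : Sparse n k D ε c) : 1 - gam n k ≤ c / k := by
  have h1 := h.n_gt
  have h2 := h.k_div_n
  have h3 := h.ck_small
  have h4 : 1 - gam n k = ((k : ℝ) - 1) / (n - 1) := by
    have : (n : ℝ) - 1 ≠ 0 := by linarith
    rw [gam]; field_simp; ring
  rw [h4, div_le_iff₀ (by linarith)]
  linarith

/-- A lower bound for `η` in the iteration allows additive changes of the degrees by `1` to be
absorbed. -/
theorem Sparse.k_le_eta {n : ℕ} (h : Sparse n k D ε c) (hη : (k : ℝ) ^ 2 * ε ^ 2 ≤ η) :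
    (k : ℝ) ≤ 1 / 3 * η * D := by
  have h1 := h.one_le
  have h2 := h.three_le'
  have h3 := h.D_pos
  have h4 : (k : ℝ) * 1 ≤ k * (ε ^ 2 * D) := mul_le_mul_of_nonneg_left h1 h.k_pos.le
  have h5 : 3 * (k * (ε ^ 2 * D)) ≤ k * (k * (ε ^ 2 * D)) :=
    mul_le_mul_of_nonneg_right h2 (by have := h.k_pos; positivity)
  have h6 : (k : ℝ) ^ 2 * ε ^ 2 * D ≤ η * D := mul_le_mul_of_nonneg_right hη h3.le
  linarith

theorem Region.mono {τ' : ℝ} (hτ : τ ≤ τ') : Region (V := V) k D τ ⊆ Region k D τ' :=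
  fun _ hd => ⟨hd.1, fun v => (hd.2 v).trans hτ⟩

theorem Region.near (hd : d ∈ Region k D τ) (hτ : τ ≤ ε * D) : Near D ε d :=
  fun v => (hd.2 v).trans hτ

theorem sub1_mem (h : Sparse (Fintype.card V) k D ε c) (hd : d ∈ Region k D τ) (hτ : τ ≤ ε * D)
    {K : Finset V} (hK : K.card = k) : sub1 d K ∈ Region k D (τ + 1) := by
  obtain ⟨m, hm⟩ := hd.1
  have hnear := Region.near hd hτ
  have hD := h.D_pos
  refine ⟨⟨m - 1, ?_⟩, fun v => ?_⟩
  · have hm1 : 1 ≤ m := by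
      by_contra hm0
      have hm0 : m = 0 := by omega
      subst hm0
      have h1 : ∑ v, (d v : ℝ) = 0 := by exact_mod_cast congrArg (Int.cast : ℤ → ℝ) hm
      obtain ⟨v, -⟩ := card_pos.mp (by rw [hK]; exact_mod_cast h.k_pos : 0 < K.card)
      have h2 : 0 < ∑ v, (d v : ℝ) := sum_pos (fun v _ => by linarith [hnear.ge h v])
        ⟨v, mem_univ v⟩
      linarith
    simp only [sub1]
    rw [sum_sub_distrib, hm, sum_ite_mem, univ_inter, sum_const, hK]
    push_cast [hm1]
    simp; ring
  · have := abs_le.mp (hd.2 v)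
    simp only [sub1]
    rw [abs_le]
    split_ifs <;> push_cast <;> constructor <;> linarith [this.1, this.2]

theorem edgeProb_bounds (h : Sparse (Fintype.card V) k D ε c) (hd : d ∈ Region k D (ε * D))
    (hne : (withDegrees k d).Nonempty) {K : Finset V} (hK : K.card = k) :
    4 / 5 * mu (Fintype.card V) k D ≤ edgeProb k d K ∧
      edgeProb k d K ≤ 6 / 5 * mu (Fintype.card V) k D := by
  obtain ⟨m, hm⟩ := hd.1
  have hnear := Region.near hd le_rfl
  have hap := edgeProb_apriori h hnear hm hne hK
  have h1 := meanDeg_mul h hm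
  have hB := h.choose_pos
  have hC : (0 : ℝ) < (Fintype.card V).choose k := by exact_mod_cast Nat.choose_pos h.k_le_n
  have h2 : density (Fintype.card V) k m =
      meanDeg d / ((Fintype.card V - 1).choose (k - 1) : ℝ) := by
    rw [density, div_eq_div_iff hC.ne' hB.ne']; linarith
  have h3 := abs_le.mp (abs_meanDeg_sub_le (by exact_mod_cast h.n_pos) hnear)
  have hD := h.D_pos
  have h4 : ε * D ≤ 1 / 10 ^ 6 * D := mul_le_mul_of_nonneg_right h.eps_small hD.le
  have h5 : (1 - 1 / 10 ^ 6) * mu (Fintype.card V) k D ≤ density (Fintype.card V) k m := by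
    rw [h2, mu, ← mul_div_assoc]
    exact div_le_div_of_nonneg_right (by linarith [h3.1]) hB.le
  have h6 : density (Fintype.card V) k m ≤ (1 + 1 / 10 ^ 6) * mu (Fintype.card V) k D := by
    rw [h2, mu, ← mul_div_assoc]
    exact div_le_div_of_nonneg_right (by linarith [h3.2]) hB.le
  have h7 := h.mu_pos
  constructor <;> linarith [hap.1, hap.2]

theorem pairProb_nonneg (k : ℕ) (d : V → ℤ) (K L : Finset V) : 0 ≤ pairProb k d K L :=
  div_nonneg (Nat.cast_nonneg _) (Nat.cast_nonneg _)

/-- In the region of radius `τ`, the edge probabilities are given by `approx` up to a relative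
error of order `η`, and the events that two given sets are edges are independent up to a
relative error of order `η`. -/
def Estimate (V : Type*) [Fintype V] [DecidableEq V] (k : ℕ) (D τ η : ℝ) : Prop :=
  ∀ d : V → ℤ, d ∈ Region k D τ →
    (∀ K : Finset V, K.card = k →
      |edgeProb k d K - approx k d K / (Fintype.card V - 1).choose (k - 1)| ≤
        η * mu (Fintype.card V) k D) ∧
    ∀ K L : Finset V, K.card = k → L.card = k → K ≠ L →
      |pairProb k d K L - edgeProb k d K * edgeProb k d L| ≤
        10 * η * mu (Fintype.card V) k D ^ 2

/-- Changing the degrees by the removal of an edge changes `approx` by little. -/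
theorem abs_approx_div_sub_le {n : ℕ} (h : Sparse n k D ε c)
    (hη : (k : ℝ) ^ 2 * ε ^ 2 ≤ η) {x y : ℝ} {j : ℝ} (hj : 0 ≤ j) (hxy : |x - y| ≤ j * k) :
    |x / (n - 1).choose (k - 1) - y / (n - 1).choose (k - 1)| ≤ j / 3 * η * mu n k D := by
  have hB := h.choose_pos
  rw [← sub_div, abs_div, abs_of_pos hB, mu, ← mul_div_assoc]
  refine div_le_div_of_nonneg_right (hxy.trans ?_) hB.le
  have := mul_le_mul_of_nonneg_left (h.k_le_eta hη) hj
  linarith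

/-- The recursion improves the estimate of the pair probabilities, since the error at the
smaller degree sequence enters with an additional factor of order `mu`. -/
theorem Estimate.pair_le (h : Sparse (Fintype.card V) k D ε c)
    (hne : ∀ d : V → ℤ, d ∈ Region k D (ε * D) → (withDegrees k d).Nonempty)
    (hτ : τ + 1 ≤ ε * D) (hη : (k : ℝ) ^ 2 * ε ^ 2 ≤ η) (hE : Estimate V k D (τ + 1) η)
    (hd : d ∈ Region k D τ) {K L : Finset V} (hK : K.card = k) (hL : L.card = k) (hKL : K ≠ L) :
    |pairProb k d K L - edgeProb k d K * edgeProb k d L| ≤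
      5 * η * mu (Fintype.card V) k D ^ 2 := by
  have hd1 : sub1 d K ∈ Region k D (τ + 1) := sub1_mem h hd (by linarith) hK
  have hdE := Region.mono (by linarith : τ ≤ τ + 1) hd
  have hdε := Region.mono hτ hdE
  have hd1ε := Region.mono hτ hd1
  have hrec := pairProb_recursion (hne d hdε) (hne _ hd1ε) hK hKL
  have b1 := edgeProb_bounds h hdε (hne d hdε) hK
  have b2 := edgeProb_bounds h hd1ε (hne _ hd1ε) hK
  have e1 := (hE d hdE).1 L hL
  have e2 := (hE _ hd1).1 L hL
  have e3 := (hE _ hd1).2 K L hK hL hKL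
  have e4 := abs_approx_div_sub_le h hη (j := 2) (by norm_num)
    (abs_approx_sub1_sub_le (d := d) h hK hL)
  have hμ := h.mu_pos
  have hμ1 := h.mu_small
  have hη0 : 0 ≤ η := le_trans (by positivity) hη
  set μ := mu (Fintype.card V) k D
  set q := edgeProb k (sub1 d K) K
  set E' := pairProb k (sub1 d K) K L - q * edgeProb k (sub1 d K) L
  have e5 : |edgeProb k (sub1 d K) L - edgeProb k d L| ≤ 8 / 3 * η * μ := by
    rw [abs_le] at *
    constructor <;> linarith [e1.1, e1.2, e2.1, e2.2, e4.1, e4.2]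
  have hq : 0 < 1 - q := by linarith [b2.2]
  have key : pairProb k d K L - edgeProb k d K * edgeProb k d L =
      edgeProb k d K * (edgeProb k (sub1 d K) L - edgeProb k d L - E' / (1 - q)) := by
    have : pairProb k d K L = edgeProb k d K *
        (edgeProb k (sub1 d K) L - pairProb k (sub1 d K) K L) / (1 - q) := by
      rw [eq_div_iff hq.ne']; exact hrec
    rw [this]; field_simp; ring
  have e6 : |E' / (1 - q)| ≤ 1 / 3 * η * μ := by
    rw [abs_div, abs_of_pos hq, div_le_iff₀ hq]
    have t1 : 10 * η * μ ^ 2 ≤ 10 * η * (μ * (1 / 3 / 10 ^ 6)) := by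
      rw [sq]; gcongr
    have t2 : η * μ * (1 / 2) ≤ η * μ * (1 - q) :=
      mul_le_mul_of_nonneg_left (by linarith [b2.2]) (by positivity)
    have t3 : 0 ≤ η * μ := by positivity
    linarith
  have hp0 : 0 ≤ edgeProb k d K := by linarith [b1.1]
  rw [key, abs_mul, abs_of_nonneg hp0]
  calc _ ≤ 6 / 5 * μ * (3 * η * μ) := by
        refine mul_le_mul b1.2 ?_ (abs_nonneg _) (by positivity)
        have := abs_sub (edgeProb k (sub1 d K) L - edgeProb k d L) (E' / (1 - q))
        linarith
    _ ≤ _ := by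
        have : 0 ≤ η * μ ^ 2 := by positivity
        linarith

theorem abs_sum_sub_card_mul_le {ι : Type*} (S : Finset ι) (f : ι → ℝ) {a t : ℝ}
    (hf : ∀ i ∈ S, |f i - a| ≤ t) : |∑ i ∈ S, f i - S.card * a| ≤ S.card * t := by
  calc _ = |∑ i ∈ S, (f i - a)| := by rw [sum_sub_distrib, sum_const, nsmul_eq_mul]
    _ ≤ ∑ i ∈ S, |f i - a| := abs_sum_le_sum_abs _ _
    _ ≤ ∑ _i ∈ S, t := sum_le_sum hf
    _ = _ := by rw [sum_const, nsmul_eq_mul]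

theorem card_insert_setsNone {a b : V} {g : Finset V} (hk : 0 < k) (hab : a ≠ b)
    (hg : g ∈ setsNone k a b) :
    (insert a g).card = k ∧ (insert b g).card = k ∧ insert a g ≠ insert b g := by
  simp only [setsNone, mem_filter, mem_powersetCard, subset_univ, true_and] at hg
  refine ⟨by rw [card_insert_of_notMem hg.2.1]; omega,
    by rw [card_insert_of_notMem hg.2.2]; omega, fun he => ?_⟩
  have : a ∈ insert b g := he ▸ mem_insert_self a g
  rcases mem_insert.mp this with h | h
  · exact hab h
  · exact hg.2.1 h

theorem abs_edgeProb_sub_mu_le (h : Sparse (Fintype.card V) k D ε c)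
    (hτ : τ ≤ ε * D) (hE : Estimate V k D τ η) (hd : d ∈ Region k D τ)
    {K : Finset V} (hK : K.card = k) :
    |edgeProb k d K - mu (Fintype.card V) k D| ≤
      (η + 4 * (k * ε)) * mu (Fintype.card V) k D := by
  have h1 := (hE d hd).1 K hK
  have hB := h.choose_pos
  have h2 : |approx k d K / ((Fintype.card V - 1).choose (k - 1) : ℝ) -
      mu (Fintype.card V) k D| ≤ 4 * (k * ε) * mu (Fintype.card V) k D := by
    rw [mu, ← sub_div, abs_div, abs_of_pos hB, ← mul_div_assoc]
    exact div_le_div_of_nonneg_right (abs_approx_sub_le h (Region.near hd hτ) hK) hB.le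
  calc _ ≤ _ := abs_sub_le _ _ _
    _ ≤ _ := add_le_add h1 h2
    _ = _ := by ring

/-- The main term of `blocked`. -/
theorem abs_blocked_sub_le (h : Sparse (Fintype.card V) k D ε c)
    (hne : ∀ d : V → ℤ, d ∈ Region k D (ε * D) → (withDegrees k d).Nonempty)
    (hτ : τ ≤ ε * D) (hη : 0 ≤ η) (hE : Estimate V k D τ η) (hd : d ∈ Region k D τ)
    {a b : V} (hab : a ≠ b) :
    |blocked k d a b - (D - gam (Fintype.card V) k * (1 - mu (Fintype.card V) k D) * D)| ≤
      (ε + 14 * (c / k * η)) * D := by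
  have hk := h.k_pos
  have hk0 : 0 < k := by exact_mod_cast hk
  have hdε := Region.mono hτ hd
  have hp : ∀ K : Finset V, K.card = k → |edgeProb k d K - mu (Fintype.card V) k D| ≤
      (η + 4 * (k * ε)) * mu (Fintype.card V) k D :=
    fun K hK => abs_edgeProb_sub_mu_le h hτ hE hd hK
  have hb := fun K (hK : K.card = k) => edgeProb_bounds h hdε (hne d hdε) (K := K) hK
  have hμ := h.mu_pos
  have hγ := h.gam_ge
  have hγ1 := h.gam_le
  have hx := h.one_sub_gam_le
  have hBμ := h.choose_mul_mu
  have hB := h.choose_pos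
  have hD := h.D_pos
  have hε := h.eps_pos
  have hμc := h.mu_le
  set μ := mu (Fintype.card V) k D
  set γ := gam (Fintype.card V) k
  set B : ℝ := ((Fintype.card V - 1).choose (k - 1) : ℝ)
  have s1 := abs_sum_sub_card_mul_le (setsBoth k a b) (fun e => edgeProb k d e) (a := μ)
    (t := (η + 4 * (k * ε)) * μ) fun e he => hp e (by
      simp only [setsBoth, mem_filter, mem_powersetCard] at he; exact he.1.2)
  have s2 := abs_sum_sub_card_mul_le (setsNone k a b)
    (fun g => pairProb k d (insert a g) (insert b g)) (a := μ ^ 2)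
    (t := (13 * η + 9 * (k * ε)) * μ ^ 2) fun g hg => by
      obtain ⟨c1, c2, c3⟩ := card_insert_setsNone hk0 hab hg
      have t1 := (hE d hd).2 _ _ c1 c2 c3
      have t2 : |edgeProb k d (insert a g) * edgeProb k d (insert b g) - μ ^ 2| ≤
          22 / 10 * (η + 4 * (k * ε)) * μ ^ 2 := by
        have e : edgeProb k d (insert a g) * edgeProb k d (insert b g) - μ ^ 2 =
            edgeProb k d (insert a g) * (edgeProb k d (insert b g) - μ) +
              (edgeProb k d (insert a g) - μ) * μ := by ring
        rw [e]
        refine (abs_add_le _ _).trans ?_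
        rw [abs_mul, abs_mul, abs_of_pos hμ, abs_of_nonneg (by linarith [(hb _ c1).1])]
        have u1 := mul_le_mul (hb _ c1).2 (hp _ c2) (abs_nonneg _) (by positivity)
        have u2 := mul_le_mul_of_nonneg_right (hp _ c1) hμ.le
        linarith
      refine (abs_sub_le _ _ _).trans (add_le_add t1 t2 |>.trans ?_)
      have v1 : 0 ≤ η * μ ^ 2 := by positivity
      have v2 : 0 ≤ k * ε * μ ^ 2 := by positivity
      linarith
  rw [card_setsBoth (by have := h.three_le; omega) hab, choose_both_eq h] at s1
  rw [card_setsNone k hab, choose_none_eq h] at s2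
  have e1 : (1 - γ) * B * μ = (1 - γ) * D := by rw [← hBμ]; ring
  have e2 : γ * B * μ ^ 2 = γ * μ * D := by rw [← hBμ]; ring
  have e3 : blocked k d a b - (D - γ * (1 - μ) * D) =
      (∑ e ∈ setsBoth k a b, edgeProb k d e - (1 - γ) * B * μ) +
      (∑ g ∈ setsNone k a b, pairProb k d (insert a g) (insert b g) - γ * B * μ ^ 2) := by
    rw [blocked, e1, e2]; ring
  rw [e3]
  refine (abs_add_le _ _).trans ((add_le_add s1 s2).trans ?_)
  have f1 : (1 - γ) * B * ((η + 4 * (k * ε)) * μ) = (1 - γ) * ((η + 4 * (k * ε)) * D) := by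
    rw [← hBμ]; ring
  have f2 : γ * B * ((13 * η + 9 * (k * ε)) * μ ^ 2) =
      γ * (μ * ((13 * η + 9 * (k * ε)) * D)) := by rw [← hBμ]; ring
  have f3 : (1 - γ) * ((η + 4 * (k * ε)) * D) ≤ c / k * ((η + 4 * (k * ε)) * D) :=
    mul_le_mul_of_nonneg_right hx (by positivity)
  have f4 : γ * (μ * ((13 * η + 9 * (k * ε)) * D)) ≤
      1 * (c / k * ((13 * η + 9 * (k * ε)) * D)) :=
    mul_le_mul hγ1 (mul_le_mul_of_nonneg_right hμc (by positivity)) (by positivity) zero_le_one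
  have f5 : c / k * (k * ε) = c * ε := by field_simp
  have f6 : c * ε * D ≤ 1 / 10 ^ 6 * ε * D := by
    have := h.c_le
    gcongr
  have f7 : 0 ≤ ε * D := by positivity
  rw [f1, f2]
  calc _ ≤ c / k * ((η + 4 * (k * ε)) * D) + 1 * (c / k * ((13 * η + 9 * (k * ε)) * D)) :=
        add_le_add f3 f4
    _ = 14 * (c / k * η) * D + 13 * (c / k * (k * ε)) * D := by ring
    _ = 14 * (c / k * η) * D + 13 * (c * ε * D) := by rw [f5]; ring
    _ ≤ _ := by linarith

theorem abs_blocked_sub_blocked_le (h : Sparse (Fintype.card V) k D ε c)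
    (hne : ∀ d : V → ℤ, d ∈ Region k D (ε * D) → (withDegrees k d).Nonempty)
    (hτ : τ ≤ ε * D) (hη : (k : ℝ) ^ 2 * ε ^ 2 ≤ η) (hE : Estimate V k D τ η) {d₁ d₂ : V → ℤ}
    (hd₁ : d₁ ∈ Region k D τ) (hd₂ : d₂ ∈ Region k D τ)
    (hap : ∀ K : Finset V, K.card = k → |approx k d₁ K - approx k d₂ K| ≤ 4 * k)
    {a b : V} (hab : a ≠ b) :
    |blocked k d₁ a b - blocked k d₂ a b| ≤ 34 * (c / k * η) * D := by
  have hk := h.k_pos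
  have hk0 : 0 < k := by exact_mod_cast hk
  have hη0 : 0 ≤ η := le_trans (by positivity) hη
  have hd₁ε := Region.mono hτ hd₁
  have hd₂ε := Region.mono hτ hd₂
  have hb₁ := fun K (hK : K.card = k) => edgeProb_bounds h hd₁ε (hne _ hd₁ε) (K := K) hK
  have hb₂ := fun K (hK : K.card = k) => edgeProb_bounds h hd₂ε (hne _ hd₂ε) (K := K) hK
  have hμ := h.mu_pos
  have hγ := h.gam_ge
  have hγ1 := h.gam_le
  have hx := h.one_sub_gam_le
  have hBμ := h.choose_mul_mu
  have hB := h.choose_pos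
  have hD := h.D_pos
  have hμc := h.mu_le
  have hp : ∀ K : Finset V, K.card = k → |edgeProb k d₁ K - edgeProb k d₂ K| ≤
      4 * η * mu (Fintype.card V) k D := by
    intro K hK
    have t1 := abs_le.mp ((hE d₁ hd₁).1 K hK)
    have t2 := abs_le.mp ((hE d₂ hd₂).1 K hK)
    have t3 := abs_le.mp (abs_approx_div_sub_le h hη (j := 4) (by norm_num) (hap K hK))
    have t4 : 0 ≤ η * mu (Fintype.card V) k D := by positivity
    rw [abs_le]
    constructor <;> linarith [t1.1, t1.2, t2.1, t2.2, t3.1, t3.2]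
  set μ := mu (Fintype.card V) k D
  set γ := gam (Fintype.card V) k
  set B : ℝ := ((Fintype.card V - 1).choose (k - 1) : ℝ)
  have s1 := abs_sum_sub_card_mul_le (setsBoth k a b)
    (fun e => edgeProb k d₁ e - edgeProb k d₂ e) (a := 0) (t := 4 * η * μ) fun e he => by
      rw [sub_zero]
      exact hp e (by simp only [setsBoth, mem_filter, mem_powersetCard] at he; exact he.1.2)
  have s2 := abs_sum_sub_card_mul_le (setsNone k a b)
    (fun g => pairProb k d₁ (insert a g) (insert b g) - pairProb k d₂ (insert a g) (insert b g))
    (a := 0) (t := 30 * η * μ ^ 2) fun g hg => by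
      obtain ⟨c1, c2, c3⟩ := card_insert_setsNone hk0 hab hg
      have t1 := abs_le.mp ((hE d₁ hd₁).2 _ _ c1 c2 c3)
      have t2 := abs_le.mp ((hE d₂ hd₂).2 _ _ c1 c2 c3)
      have t3 : |edgeProb k d₁ (insert a g) * edgeProb k d₁ (insert b g) -
          edgeProb k d₂ (insert a g) * edgeProb k d₂ (insert b g)| ≤ 10 * η * μ ^ 2 := by
        have e : edgeProb k d₁ (insert a g) * edgeProb k d₁ (insert b g) -
            edgeProb k d₂ (insert a g) * edgeProb k d₂ (insert b g) =
            edgeProb k d₁ (insert a g) * (edgeProb k d₁ (insert b g) -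
              edgeProb k d₂ (insert b g)) + edgeProb k d₂ (insert b g) *
              (edgeProb k d₁ (insert a g) - edgeProb k d₂ (insert a g)) := by ring
        rw [e]
        refine (abs_add_le _ _).trans ?_
        rw [abs_mul, abs_mul, abs_of_nonneg (by linarith [(hb₁ _ c1).1] :
          0 ≤ edgeProb k d₁ (insert a g)), abs_of_nonneg (by linarith [(hb₂ _ c2).1] :
          0 ≤ edgeProb k d₂ (insert b g))]
        have u1 := mul_le_mul (hb₁ _ c1).2 (hp _ c2) (abs_nonneg _) (by positivity)
        have u2 := mul_le_mul (hb₂ _ c2).2 (hp _ c1) (abs_nonneg _) (by positivity)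
        have u3 : 0 ≤ η * μ ^ 2 := by positivity
        linarith
      have t4 := abs_le.mp t3
      rw [sub_zero, abs_le]
      constructor <;> linarith [t1.1, t1.2, t2.1, t2.2, t4.1, t4.2]
  rw [card_setsBoth (by have := h.three_le; omega) hab, choose_both_eq h, mul_zero, sub_zero,
    sum_sub_distrib] at s1
  rw [card_setsNone k hab, choose_none_eq h, mul_zero, sub_zero, sum_sub_distrib] at s2
  have e3 : blocked k d₁ a b - blocked k d₂ a b =
      (∑ e ∈ setsBoth k a b, edgeProb k d₁ e - ∑ e ∈ setsBoth k a b, edgeProb k d₂ e) +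
      (∑ g ∈ setsNone k a b, pairProb k d₁ (insert a g) (insert b g) -
        ∑ g ∈ setsNone k a b, pairProb k d₂ (insert a g) (insert b g)) := by
    rw [blocked, blocked]; ring
  rw [e3]
  refine (abs_add_le _ _).trans ((add_le_add s1 s2).trans ?_)
  have f1 : (1 - γ) * B * (4 * η * μ) = (1 - γ) * (4 * η * D) := by rw [← hBμ]; ring
  have f2 : γ * B * (30 * η * μ ^ 2) = γ * (μ * (30 * η * D)) := by rw [← hBμ]; ring
  have f3 : (1 - γ) * (4 * η * D) ≤ c / k * (4 * η * D) :=
    mul_le_mul_of_nonneg_right hx (by positivity)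
  have f4 : γ * (μ * (30 * η * D)) ≤ 1 * (c / k * (30 * η * D)) :=
    mul_le_mul hγ1 (mul_le_mul_of_nonneg_right hμc (by positivity)) (by positivity) zero_le_one
  rw [f1, f2]
  linarith

end

/-! ### The bootstrap -/

section

variable {k m : ℕ} {d : V → ℤ} {D ε c τ η : ℝ}

theorem one_add_sub_div {x D : ℝ} (hD : D ≠ 0) : 1 + (x - D) / D = x / D := by
  field_simp; ring

/-- Two adjacent sets have edge probabilities in the ratio that `approx` predicts, up to a factor
`1 + O(k ε² + c η / k)`. -/
theorem Estimate.adjacent_le (h : Sparse (Fintype.card V) k D ε c)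
    (hne : ∀ d : V → ℤ, d ∈ Region k D (ε * D) → (withDegrees k d).Nonempty)
    (hτ : τ + 1 ≤ ε * D) (hη : (k : ℝ) ^ 2 * ε ^ 2 ≤ η) (hη2 : η ≤ 2)
    (hE : Estimate V k D (τ + 1) η) (hd : d ∈ Region k D τ) {f : Finset V} {a b : V}
    (hf : f.card + 1 = k) (hab : a ≠ b) (ha : a ∉ f) (hb : b ∉ f) :
    edgeProb k d (insert a f) * approx k d (insert b f) ≤
      (1 + (12 * (k * ε) * ε + 50 * (c / k * η))) *
        (edgeProb k d (insert b f) * approx k d (insert a f)) := by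
  have hka : (insert a f).card = k := by rw [card_insert_of_notMem ha, hf]
  have hkb : (insert b f).card = k := by rw [card_insert_of_notMem hb, hf]
  have hτ' : τ ≤ ε * D := by linarith
  have hk0 : 0 < k := by have := h.three_le; omega
  have hdε := Region.mono hτ' hd
  have hd1 := sub1_mem h hd hτ' hkb
  have hd2 := sub1_mem h hd hτ' hka
  have hd1ε := Region.mono hτ hd1
  have hd2ε := Region.mono hτ hd2
  have hsw := edgeProb_switch hk0 (hne d hdε) hab ha hb hf (hne _ hd1ε) (hne _ hd2ε)
  have hη0 : 0 ≤ η := le_trans (by positivity) hη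
  have hX := abs_blocked_sub_blocked_le h hne hτ hη hE hd1 hd2 (fun K hK => by
    have t1 := abs_le.mp (abs_approx_sub1_sub_le (d := d) h hkb hK)
    have t2 := abs_le.mp (abs_approx_sub1_sub_le (d := d) h hka hK)
    rw [abs_le]; constructor <;> linarith [t1.1, t1.2, t2.1, t2.2]) hab
  have hX2 := abs_blocked_sub_le h hne hτ hη0 hE hd2 hab
  have hp2 := abs_edgeProb_sub_mu_le h hτ hE hd2 hka
  have hF2 := (hE _ hd2).1 _ hka
  have hF1 := (hE _ hd1).1 _ hkb
  have hFF := approx_sub1_insert_sub (d := d) ha hb hf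
  have hAA := approx_insert_sub (k := k) (d := d) ha hb
  have ga := abs_approx_sub_le h (Region.near hdε le_rfl) hka
  have gb := abs_approx_sub_le h (Region.near hdε le_rfl) hkb
  have hbnd := edgeProb_bounds h hdε (hne d hdε) hkb
  have hD := h.D_pos
  have hB := h.choose_pos
  have hμ := h.mu_pos
  have hμc := h.mu_le
  have hε := h.eps_pos
  have hck := h.ck_small
  have hck0 : 0 < c / k := div_pos h.c_pos h.k_pos
  have hkε := h.k_eps
  have hc := h.c_le
  have hBμ := h.choose_mul_mu
  set μ := mu (Fintype.card V) k D
  set B : ℝ := ((Fintype.card V - 1).choose (k - 1) : ℝ)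
  set p1 := edgeProb k (sub1 d (insert b f)) (insert b f)
  set p2 := edgeProb k (sub1 d (insert a f)) (insert a f)
  set X1 := blocked k (sub1 d (insert b f)) a b
  set X2 := blocked k (sub1 d (insert a f)) a b
  set γ := gam (Fintype.card V) k
  have hw : 0 ≤ c / k * η := by positivity
  have hημ : η * μ ≤ c / k * η := by
    have := mul_le_mul_of_nonneg_left hμc hη0; linarith
  have key := switch_ratio (A := (d a - X1) / D) (B' := (d b - X2) / D) (α := 1 - p2)
    (β := 1 - p1) (g := (approx k d (insert a f) - D) / D)
    (g' := (approx k d (insert b f) - D) / D) (s := (d a - d b) / D) (μ := μ) (γ := γ)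
    (κ := k * ε) (w := c / k * η) (ε := ε)
    (mul_le_mul_of_nonneg_right h.three_le' hε.le) (hkε.trans hc) hε.le hw
    (by have := mul_le_mul hck hη2 hη0 (by norm_num); linarith)
    hμ.le (by linarith) (by linarith [h.gam_ge]) h.gam_le
    (by
      rw [← sub_eq_iff_eq_add', ← sub_div, sub_sub_sub_cancel_right, hAA,
        mul_div_assoc])
    (by rw [abs_div, abs_of_pos hD, div_le_iff₀ hD]; exact ga)
    (by rw [abs_div, abs_of_pos hD, div_le_iff₀ hD]; exact gb)
    (by
      rw [abs_div, abs_of_pos hD, div_le_iff₀ hD]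
      have := (Region.near hdε le_rfl).sub_le a b
      linarith)
    (by
      rw [← sub_div, ← sub_div, abs_div, abs_of_pos hD, div_le_iff₀ hD]
      have e : (d a : ℝ) - X1 - (d b - X2) - (d a - d b) = -(X1 - X2) := by ring
      rw [e, abs_neg]; exact hX)
    (by
      have e : (1 - p1) - (1 - p2) - γ⁻¹ * ((d a - d b) / D) * μ =
          (p2 - approx k (sub1 d (insert a f)) (insert a f) / B) -
            (p1 - approx k (sub1 d (insert b f)) (insert b f) / B) := by
        have e1 : γ⁻¹ * ((d a - d b) / D) * μ = (γ⁻¹ * (d a - d b)) / B := by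
          rw [← hBμ]; field_simp
        rw [e1, ← hFF]; ring
      rw [e]
      have := abs_sub (p2 - approx k (sub1 d (insert a f)) (insert a f) / B)
        (p1 - approx k (sub1 d (insert b f)) (insert b f) / B)
      linarith)
    (by
      have e : 1 - p2 - (1 - μ) = -(p2 - μ) := by ring
      rw [e, abs_neg]
      refine hp2.trans ?_
      have : k * ε * μ ≤ c / k * (k * ε) := by
        rw [mul_comm]; exact mul_le_mul_of_nonneg_right hμc (by positivity)
      have e2 : c / k * (k * ε) = c * ε := by have := h.k_pos; field_simp
      have e3 : c * ε ≤ 1 * ε := mul_le_mul_of_nonneg_right (by linarith) hε.le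
      linarith)
    (by
      have e : (d b - X2) / D - γ * (1 - μ) =
          ((d b - D) - (X2 - (D - γ * (1 - μ) * D))) / D := by field_simp; ring
      rw [e, abs_div, abs_of_pos hD, div_le_iff₀ hD]
      have t1 := Region.near hdε le_rfl b
      have t2 := abs_sub ((d b : ℝ) - D) (X2 - (D - γ * (1 - μ) * D))
      linarith)
  obtain ⟨hpos, hle⟩ := key
  rw [one_add_sub_div hD.ne', one_add_sub_div hD.ne'] at hle
  have hsw' : edgeProb k d (insert a f) * ((d b - X2) / D * (1 - p1)) =
      edgeProb k d (insert b f) * ((d a - X1) / D * (1 - p2)) := by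
    have : edgeProb k d (insert a f) * (d b - X2) * (1 - p1) / D =
      edgeProb k d (insert b f) * (d a - X1) * (1 - p2) / D := by rw [hsw]
    linear_combination this
  have hp0 : 0 ≤ edgeProb k d (insert b f) := by linarith [hbnd.1]
  refine le_of_mul_le_mul_right ?_ hpos
  have := mul_le_mul_of_nonneg_left hle (mul_nonneg hp0 hD.le)
  calc _ = (edgeProb k d (insert a f) * ((d b - X2) / D * (1 - p1))) *
        approx k d (insert b f) := by ring
    _ = edgeProb k d (insert b f) * D *
        ((d a - X1) / D * (1 - p2) * (approx k d (insert b f) / D)) := by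
        rw [hsw']; field_simp
    _ ≤ _ := this
    _ = _ := by
      generalize 1 + (12 * (k * ε) * ε + 50 * (c / k * η)) = Q
      field_simp

theorem sum_edgeProb (hk : 0 < k) (hsum : ∑ v, d v = k * m)
    (hne : (withDegrees k d).Nonempty) :
    ∑ K ∈ powersetCard k (univ : Finset V), edgeProb k d K = m := by
  simp only [edgeProb_eq]
  rw [← sum_div, sum_numWith hk hsum, ← num, mul_div_cancel_right₀ _ (num_pos hne).ne']

/-- Both `edgeProb` and the normalized `approx` sum to the number of edges, so ratios that are
almost the same for adjacent sets, hence for all sets, are close to one. -/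
theorem abs_edgeProb_sub_le_of_adjacent (h : Sparse (Fintype.card V) k D ε c)
    (hd : d ∈ Region k D (ε * D)) (hne : (withDegrees k d).Nonempty) {x : ℝ} (hx : 0 ≤ x)
    (hkx : k * x ≤ 1 / 2)
    (hadj : ∀ f : Finset V, ∀ a b : V, f.card + 1 = k → a ≠ b → a ∉ f → b ∉ f →
      edgeProb k d (insert a f) * approx k d (insert b f) ≤
        (1 + x) * (edgeProb k d (insert b f) * approx k d (insert a f)))
    {K : Finset V} (hK : K.card = k) :
    |edgeProb k d K - approx k d K / (Fintype.card V - 1).choose (k - 1)| ≤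
      21 / 10 * (k * x) * mu (Fintype.card V) k D := by
  obtain ⟨m, hm⟩ := hd.1
  have hk0 : 0 < k := by have := h.three_le; omega
  have hk1 : (1 : ℝ) ≤ k := by linarith [h.three_le']
  have hx1 : x ≤ 1 / 2 := by nlinarith
  have hD := h.D_pos
  have hB := h.choose_pos
  have hμ := h.mu_pos
  have hs1 := sum_edgeProb hk0 hm hne
  have hs2 := sum_approx h hm
  have hp : ∀ L : Finset V, L.card = k → 0 < edgeProb k d L := fun L hL => by
    linarith [(edgeProb_bounds h hd hne hL).1]
  have hap : ∀ L : Finset V, L.card = k → |approx k d L - D| ≤ 1 / 10 ^ 5 * D := fun L hL => by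
    refine (abs_approx_sub_le h (Region.near hd le_rfl) hL).trans ?_
    refine mul_le_mul_of_nonneg_right ?_ hD.le
    linarith [h.k_eps, h.c_le]
  have hap0 : ∀ L : Finset V, L.card = k → 0 < approx k d L := fun L hL => by
    linarith [(abs_le.mp (hap L hL)).1]
  have hcomp : ∀ K L : Finset V, K.card = k → L.card = k →
      (1 - k * x) * (edgeProb k d K / approx k d K) ≤ edgeProb k d L / approx k d L := by
    intro K L hK hL
    have h0 : 0 ≤ edgeProb k d K / approx k d K := div_nonneg (hp K hK).le (hap0 K hK).le
    refine le_trans (mul_le_mul_of_nonneg_right ?_ h0)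
      (pow_mul_le_of_adjacent k (fun K => edgeProb k d K / approx k d K)
        (fun K hK => div_nonneg (hp K hK).le (hap0 K hK).le) (r := 1 - x) (by linarith)
        (by linarith) ?_ hK hL)
    · have := one_add_mul_le_pow (a := -x) (by linarith) k
      rw [← sub_eq_add_neg] at this
      linarith
    · intro f a b hf hab ha hb
      have hka : (insert a f).card = k := by rw [card_insert_of_notMem ha, hf]
      have hkb : (insert b f).card = k := by rw [card_insert_of_notMem hb, hf]
      have h1 := hadj f a b hf hab ha hb
      have h2 := mul_le_mul_of_nonneg_left h1 (by linarith : 0 ≤ 1 - x)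
      have h3 : 0 ≤ edgeProb k d (insert b f) * approx k d (insert a f) :=
        (mul_pos (hp _ hkb) (hap0 _ hka)).le
      rw [← mul_div_assoc, div_le_div_iff₀ (hap0 _ hka) (hap0 _ hkb)]
      nlinarith [mul_nonneg (mul_nonneg hx hx) h3]
  have hcard : ∀ {L : Finset V}, L ∈ powersetCard k (univ : Finset V) → L.card = k :=
    fun hL => (mem_powersetCard.mp hL).2
  have hm0 : (0 : ℝ) < m := by
    rw [← hs1]
    exact sum_pos (fun L hL => hp L (hcard hL)) ⟨K, mem_powersetCard.mpr ⟨subset_univ _, hK⟩⟩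
  set B : ℝ := ((Fintype.card V - 1).choose (k - 1) : ℝ)
  set r := edgeProb k d K / approx k d K
  have hup : (1 - k * x) * (r * B) ≤ 1 := by
    have : ∑ L ∈ powersetCard k (univ : Finset V), (1 - k * x) * r * approx k d L ≤
        ∑ L ∈ powersetCard k (univ : Finset V), edgeProb k d L := sum_le_sum fun L hL => by
      have := hcomp K L hK (hcard hL)
      rwa [le_div_iff₀ (hap0 L (hcard hL))] at this
    rw [← mul_sum, hs1, hs2] at this
    refine le_of_mul_le_mul_right ?_ hm0
    linarith
  have hlo : 1 - k * x ≤ r * B := by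
    have : ∑ L ∈ powersetCard k (univ : Finset V), (1 - k * x) * edgeProb k d L ≤
        ∑ L ∈ powersetCard k (univ : Finset V), r * approx k d L := sum_le_sum fun L hL => by
      have := hcomp L K (hcard hL) hK
      rwa [← mul_div_assoc, div_le_iff₀ (hap0 L (hcard hL))] at this
    rw [← mul_sum, ← mul_sum, hs1, hs2] at this
    refine le_of_mul_le_mul_right ?_ hm0
    linarith
  have hkx0 : 0 ≤ k * x := by positivity
  have hr : |r * B - 1| ≤ 2 * (k * x) := by
    rw [abs_le]
    constructor
    · linarith
    · nlinarith
  have e : edgeProb k d K - approx k d K / B = approx k d K / B * (r * B - 1) := by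
    have := (hap0 K hK).ne'
    simp only [r]
    field_simp
  have hq : |approx k d K / B| ≤ 105 / 100 * mu (Fintype.card V) k D := by
    rw [abs_div, abs_of_pos hB, abs_of_pos (hap0 K hK), mu, ← mul_div_assoc]
    refine div_le_div_of_nonneg_right ?_ hB.le
    linarith [(abs_le.mp (hap K hK)).2]
  rw [e, abs_mul]
  calc _ ≤ 105 / 100 * mu (Fintype.card V) k D * (2 * (k * x)) :=
        mul_le_mul hq hr (abs_nonneg _) (by positivity)
    _ = _ := by ring

/-- One step of the bootstrap: at the cost of one unit of the radius, the error is halved up to the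
unavoidable `O(k ^ 2 * ε ^ 2)`. -/
theorem Estimate.improve (h : Sparse (Fintype.card V) k D ε c)
    (hne : ∀ d : V → ℤ, d ∈ Region k D (ε * D) → (withDegrees k d).Nonempty)
    (hτ : τ + 1 ≤ ε * D) (hη : (k : ℝ) ^ 2 * ε ^ 2 ≤ η) (hη2 : η ≤ 2)
    (hE : Estimate V k D (τ + 1) η) :
    Estimate V k D τ (40 * ((k : ℝ) ^ 2 * ε ^ 2) + η / 2) := by
  have hη0 : 0 ≤ η := le_trans (by positivity) hη
  have hμ := h.mu_pos
  have hε := h.eps_pos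
  have hk := h.k_pos
  have hc := h.c_le
  have hc0 := h.c_pos
  have hkε := h.k_eps
  intro d hd
  have hdε := Region.mono (by linarith : τ ≤ ε * D) hd
  have e1 : (k : ℝ) * (12 * (k * ε) * ε + 50 * (c / k * η)) =
      12 * ((k : ℝ) ^ 2 * ε ^ 2) + 50 * (c * η) := by field_simp
  have e2 : c * η ≤ 1 / 10 ^ 6 * η := mul_le_mul_of_nonneg_right hc hη0
  have e3 : (k : ℝ) ^ 2 * ε ^ 2 ≤ 1 / 10 ^ 6 := by
    have : (k * ε) ^ 2 ≤ (1 / 10 ^ 6) ^ 2 := by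
      have := hkε.trans hc
      gcongr
    rw [mul_pow] at this
    linarith
  constructor
  · intro K hK
    refine (abs_edgeProb_sub_le_of_adjacent h hdε (hne d hdε) (by positivity)
      (by rw [e1]; linarith)
      (fun f a b hf hab ha hb => hE.adjacent_le h hne hτ hη hη2 hd hf hab ha hb) hK).trans ?_
    refine mul_le_mul_of_nonneg_right ?_ hμ.le
    rw [e1]
    have : 0 ≤ (k : ℝ) ^ 2 * ε ^ 2 := by positivity
    linarith
  · intro K L hK hL hKL
    refine (hE.pair_le h hne hτ hη hd hK hL hKL).trans ?_
    refine mul_le_mul_of_nonneg_right ?_ (by positivity)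
    have : 0 ≤ (k : ℝ) ^ 2 * ε ^ 2 := by positivity
    linarith

/-- The bounds up to a constant factor give an estimate with `η = 1`. -/
theorem estimate_base (h : Sparse (Fintype.card V) k D ε c)
    (hne : ∀ d : V → ℤ, d ∈ Region k D (ε * D) → (withDegrees k d).Nonempty)
    (hτ : τ + 1 ≤ ε * D) : Estimate V k D τ 1 := by
  have hμ := h.mu_pos
  have hμ1 := h.mu_small
  have hB := h.choose_pos
  intro d hd
  have hτ' : τ ≤ ε * D := by linarith
  have hdε := Region.mono hτ' hd
  constructor
  · intro K hK
    have h1 := edgeProb_bounds h hdε (hne d hdε) hK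
    have h2 : |approx k d K / ((Fintype.card V - 1).choose (k - 1) : ℝ) -
        mu (Fintype.card V) k D| ≤ 4 * (k * ε) * mu (Fintype.card V) k D := by
      rw [mu, ← sub_div, abs_div, abs_of_pos hB, ← mul_div_assoc]
      exact div_le_div_of_nonneg_right (abs_approx_sub_le h (Region.near hdε le_rfl) hK) hB.le
    have h3 : 4 * (k * ε) * mu (Fintype.card V) k D ≤ 1 / 10 * mu (Fintype.card V) k D :=
      mul_le_mul_of_nonneg_right (by linarith [h.k_eps, h.c_le]) hμ.le
    have h4 := abs_le.mp h2
    rw [abs_le]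
    constructor <;> linarith [h1.1, h1.2, h4.1, h4.2]
  · intro K L hK hL hKL
    have hd1ε := Region.mono hτ (sub1_mem h hd hτ' hK)
    have hrec := pairProb_recursion (hne d hdε) (hne _ hd1ε) hK hKL
    have b1 := edgeProb_bounds h hdε (hne d hdε) hK
    have b2 := edgeProb_bounds h hdε (hne d hdε) hL
    have b3 := edgeProb_bounds h hd1ε (hne _ hd1ε) hK
    have b4 := edgeProb_bounds h hd1ε (hne _ hd1ε) hL
    have y1 := pairProb_nonneg k d K L
    have y2 := pairProb_nonneg k (sub1 d K) K L
    set μ := mu (Fintype.card V) k D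
    have t1 : edgeProb k d K * (edgeProb k (sub1 d K) L - pairProb k (sub1 d K) K L) ≤
        6 / 5 * μ * (6 / 5 * μ) := by
      refine mul_le_mul_of_nonneg b1.2 (by linarith [b4.2]) (by linarith [b1.1]) (by positivity)
    have t2 : pairProb k d K L * (1 / 2) ≤
        pairProb k d K L * (1 - edgeProb k (sub1 d K) K) :=
      mul_le_mul_of_nonneg_left (by linarith [b3.2]) y1
    have t3 : edgeProb k d K * edgeProb k d L ≤ 6 / 5 * μ * (6 / 5 * μ) :=
      mul_le_mul b1.2 b2.2 (by linarith [b2.1]) (by positivity)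
    have t4 : 0 ≤ edgeProb k d K * edgeProb k d L :=
      mul_nonneg (by linarith [b1.1]) (by linarith [b2.1])
    have t5 : 0 ≤ μ ^ 2 := sq_nonneg _
    rw [abs_le]
    constructor <;> nlinarith

theorem estimate_iterate (h : Sparse (Fintype.card V) k D ε c)
    (hne : ∀ d : V → ℤ, d ∈ Region k D (ε * D) → (withDegrees k d).Nonempty) (r : ℕ) :
    ∀ τ : ℝ, τ + r + 1 ≤ ε * D →
      Estimate V k D τ (80 * ((k : ℝ) ^ 2 * ε ^ 2) + 1 / 2 ^ r) := by
  have e3 : (k : ℝ) ^ 2 * ε ^ 2 ≤ 1 / 10 ^ 6 := by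
    have : (k * ε) ^ 2 ≤ (1 / 10 ^ 6) ^ 2 := by
      have := h.k_eps.trans h.c_le
      have := h.eps_pos
      gcongr
    rw [mul_pow] at this
    linarith
  have e0 : 0 ≤ (k : ℝ) ^ 2 * ε ^ 2 := by positivity
  induction r with
  | zero =>
    intro τ hτ
    have hb := estimate_base h hne (τ := τ) (by simpa using hτ)
    have hμ := h.mu_pos
    intro d hd
    refine ⟨fun K hK => ((hb d hd).1 K hK).trans ?_,
      fun K L hK hL hKL => ((hb d hd).2 K L hK hL hKL).trans ?_⟩
    · refine mul_le_mul_of_nonneg_right ?_ hμ.le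
      norm_num; positivity
    · refine mul_le_mul_of_nonneg_right ?_ (by positivity)
      norm_num; positivity
  | succ r ih =>
    intro τ hτ
    push_cast at hτ
    have hr : (0 : ℝ) ≤ r := Nat.cast_nonneg _
    have hp : (1 : ℝ) / 2 ^ r ≤ 1 := by
      rw [div_le_one (by positivity)]; exact one_le_pow₀ (by norm_num)
    have hp0 : (0 : ℝ) ≤ 1 / 2 ^ r := by positivity
    have hi := (ih (τ + 1) (by linarith)).improve h hne (by linarith) (by linarith)
      (by linarith)
    convert hi using 1
    rw [pow_succ]; field_simp; ring

end

/-! ### Conclusion -/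

section

variable {k : ℕ} {D ε c : ℝ}

theorem add_one_sq_le_four_mul_two_pow (r : ℕ) : (r + 1) ^ 2 ≤ 4 * 2 ^ r := by
  induction r with
  | zero => norm_num
  | succ r ih =>
    rw [pow_succ 2]
    rcases r with _ | _ | r
    · norm_num
    · norm_num
    · have : (r + 1 + 1 + 1 + 1) ^ 2 ≤ 2 * (r + 1 + 1 + 1) ^ 2 :=
        Nat.le.intro (k := r ^ 2 + 4 * r + 2) (by ring)
      linarith

/-- The iterated estimate at a degree sequence that deviates by at most `T` from `D`. There is room
for `⌊T⌋` steps of the bootstrap, and `1 / 2 ^ ⌊T⌋` is at most `4 / T ^ 2`. -/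
theorem abs_edgeProb_sub_approx_le {T : ℝ} {d : V → ℤ}
    (h : Sparse (Fintype.card V) k D ε c) (h2 : Sparse (Fintype.card V) k D (2 * ε) c)
    (hT : 1 ≤ T) (hTε : ε * D = 3 * T) (hd : d ∈ Region k D T) {K : Finset V}
    (hK : K.card = k) :
    |edgeProb k d K - approx k d K / (Fintype.card V - 1).choose (k - 1)| ≤
      (80 * ((k : ℝ) ^ 2 * ε ^ 2) + 4 / T ^ 2) * mu (Fintype.card V) k D := by
  have hfl := Nat.floor_le (by linarith : 0 ≤ T)
  have hfl2 := Nat.lt_floor_add_one T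
  have hE := estimate_iterate h (fun d hd => by
    obtain ⟨m, hm⟩ := hd.1
    exact nonempty_withDegrees h2 (Region.near hd le_rfl) hm) ⌊T⌋₊ T (by linarith)
  refine ((hE d hd).1 K hK).trans ?_
  refine mul_le_mul_of_nonneg_right (add_le_add le_rfl ?_) h.mu_pos.le
  rw [div_le_div_iff₀ (by positivity) (by positivity), one_mul]
  have h3 : ((⌊T⌋₊ : ℝ) + 1) ^ 2 ≤ 4 * 2 ^ ⌊T⌋₊ := by
    exact_mod_cast add_one_sq_le_four_mul_two_pow ⌊T⌋₊
  refine le_trans ?_ h3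
  gcongr

end

end KGraph

theorem mainTheorem4 :
    ∃ c : ℝ, 0 < c ∧ ∃ C : ℝ, 0 < C ∧ ∃ N : ℕ,
      ∀ n k m : ℕ, ∀ φ : ℝ, N ≤ n → 3 ≤ k → 4 / 9 < φ → φ < 1 / 2 →
        (k : ℝ) * KGraph.avgDegree n k m ^ (-φ) < c →
        (k : ℝ) * KGraph.density n k m + (k : ℝ) ^ 2 / (n : ℝ) < c →
        Real.log (n : ℝ) ^ 3 < KGraph.avgDegree n k m →
        ∀ d ∈ KGraph.nearlyRegular n k m φ, (KGraph.withDegrees k d).Nonempty ∧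
          ∀ K : Finset (Fin n), K.card = k →
            ∃ δ : ℝ, |δ| ≤ C * ((k : ℝ) ^ 2 * KGraph.avgDegree n k m ^ (-2 * φ)) ∧
              KGraph.edgeProb k d K =
                ((n - 1).choose (k - 1) : ℝ)⁻¹ *
                  (KGraph.avgDegree n k m + ((n : ℝ) - 1) / ((n : ℝ) - (k : ℝ)) *
                    ∑ v ∈ K, ((d v : ℝ) - KGraph.avgDegree n k m)) * (1 + δ) := by
  refine ⟨1 / 10 ^ 7, by norm_num, 800, by norm_num, 1, ?_⟩
  intro n k m φ hn hk hφ1 hφ2 hc1 hc2 hlog d hd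
  set D := KGraph.avgDegree n k m with hDdef
  have hn0 : (0 : ℝ) < n := by exact_mod_cast hn
  have hk3 : (3 : ℝ) ≤ k := by exact_mod_cast hk
  -- a positive mean degree has to come from `hlog`, as `0 ^ (-φ) = 0`
  have hD0 : 0 < D := by
    have : 0 ≤ Real.log n := Real.log_nonneg (by exact_mod_cast hn)
    exact lt_of_le_of_lt (by positivity) hlog
  have hD1 : 1 ≤ D := by
    by_contra hlt
    have := Real.one_le_rpow_of_pos_of_le_one_of_nonpos hD0 (not_le.mp hlt).le
      (by linarith : -φ ≤ 0)
    nlinarith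
  have hdens : 0 ≤ KGraph.density n k m := by unfold KGraph.density; positivity
  have hksq : (k : ℝ) ^ 2 ≤ 1 / 10 ^ 7 * n := by
    have h1 : 0 ≤ (k : ℝ) * KGraph.density n k m := by positivity
    rw [← div_le_iff₀ hn0]
    linarith
  have hkn : k ≤ n := by
    have : (k : ℝ) ≤ n := by nlinarith
    exact_mod_cast this
  have hB : (0 : ℝ) < (n - 1).choose (k - 1) := by
    exact_mod_cast Nat.choose_pos (by omega)
  have hC : (0 : ℝ) < n.choose k := by exact_mod_cast Nat.choose_pos hkn
  have hkd : (k : ℝ) * D ≤ 1 / 10 ^ 6 * (n - 1).choose (k - 1) := by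
    have h1 : KGraph.density n k m = D / (n - 1).choose (k - 1) := by
      rw [KGraph.density, hDdef, KGraph.avgDegree, div_div,
        ← KGraph.mul_choose_eq (by omega) hkn, mul_div_mul_left _ _ (by linarith)]
    have h2 : 0 ≤ (k : ℝ) ^ 2 / n := by positivity
    have h3 : (k : ℝ) * KGraph.density n k m ≤ 1 / 10 ^ 6 := by linarith
    rw [h1, ← mul_div_assoc, div_le_iff₀ hB] at h3
    exact h3
  set x := D ^ (-φ) with hx
  have hx0 : 0 < x := Real.rpow_pos_of_pos hD0 _
  have hxx : D ^ (-2 * φ) = x ^ 2 := by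
    rw [hx, ← Real.rpow_natCast, ← Real.rpow_mul hD0.le]; congr 1; push_cast; ring
  have hxD : D ^ (1 - φ) = x * D := by
    rw [hx, sub_eq_neg_add, Real.rpow_add hD0, Real.rpow_one]
  have hx2 : 1 ≤ x ^ 2 * D := by
    rw [← hxx]
    nth_rewrite 2 [← Real.rpow_one D]
    rw [← Real.rpow_add hD0]
    exact Real.one_le_rpow hD1 (by linarith)
  have hT1 : 1 ≤ x * D := by
    rw [← hxD]; exact Real.one_le_rpow hD1 (by linarith)
  -- the region of radius `3 * D ^ (1 - φ)` leaves room for the steps of the bootstrap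
  have hs : ∀ j : ℝ, 1 ≤ j → j ≤ 6 → KGraph.Sparse n k D (j * x) (1 / 10 ^ 6) := by
    intro j hj hj6
    refine ⟨hk, by norm_num, le_rfl, by positivity, ?_, by linarith, hkd, ?_⟩
    · have : (k : ℝ) * (j * x) = j * (k * x) := by ring
      rw [this]
      have := mul_le_mul hj6 hc1.le (by positivity) (by norm_num)
      linarith
    · have : (j * x) ^ 2 * D = j ^ 2 * (x ^ 2 * D) := by ring
      rw [this]
      nlinarith
  have hcard : Fintype.card (Fin n) = n := Fintype.card_fin n
  have h3 : KGraph.Sparse (Fintype.card (Fin n)) k D (3 * x) (1 / 10 ^ 6) := by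
    rw [hcard]; exact hs 3 (by norm_num) (by norm_num)
  have h6 : KGraph.Sparse (Fintype.card (Fin n)) k D (2 * (3 * x)) (1 / 10 ^ 6) := by
    rw [hcard, ← mul_assoc]; exact hs _ (by norm_num) (by norm_num)
  have hreg : d ∈ KGraph.Region k D (x * D) := ⟨⟨m, hd.1⟩, fun v => hxD ▸ hd.2 v⟩
  have hnear : KGraph.Near D (3 * x) d :=
    KGraph.Region.near (KGraph.Region.mono (by nlinarith) hreg) le_rfl
  refine ⟨KGraph.nonempty_withDegrees h6 hnear hd.1, fun K hK => ?_⟩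
  have hmean : KGraph.meanDeg d = D := by
    have h1 : ∑ v, (d v : ℝ) = k * m := by exact_mod_cast congrArg (Int.cast : ℤ → ℝ) hd.1
    rw [KGraph.meanDeg, h1, hcard]; rfl
  have hest := KGraph.abs_edgeProb_sub_approx_le h3 h6 hT1 (by ring) hreg hK
  have hap := (abs_le.mp (KGraph.abs_approx_sub_le h3 hnear hK)).1
  have hF : KGraph.approx k d K =
      D + ((n : ℝ) - 1) / ((n : ℝ) - (k : ℝ)) * ∑ v ∈ K, ((d v : ℝ) - D) := by
    rw [KGraph.approx, hmean, hcard]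
  rw [← hF, hxx]
  rw [hcard] at hest
  have hapD : 99 / 100 * D ≤ KGraph.approx k d K := by
    have := mul_le_mul_of_nonneg_right hc1.le hD0.le
    linarith
  have hap0 : 0 < KGraph.approx k d K := by linarith
  set B : ℝ := ((n - 1).choose (k - 1) : ℝ)
  set F := KGraph.approx k d K
  refine ⟨KGraph.edgeProb k d K / (F / B) - 1, ?_, ?_⟩
  · have hFB : 0 < F / B := by positivity
    have e : KGraph.edgeProb k d K / (F / B) - 1 = (KGraph.edgeProb k d K - F / B) / (F / B) := by
      rw [sub_div, div_self hFB.ne']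
    rw [e, abs_div, abs_of_pos hFB, div_le_iff₀ hFB]
    refine hest.trans ?_
    -- `1 / T ^ 2` is at most `x ^ 2`, since `T = x * D` and `1 ≤ x ^ 2 * D`
    have t1 : 4 / (x * D) ^ 2 ≤ 4 * x ^ 2 := by
      rw [div_le_iff₀ (by positivity)]
      have : 4 * x ^ 2 * (x * D) ^ 2 = 4 * (x ^ 2 * D) ^ 2 := by ring
      rw [this]
      nlinarith
    have t2 : 4 * x ^ 2 ≤ k ^ 2 * x ^ 2 :=
      mul_le_mul_of_nonneg_right (by nlinarith) (by positivity)
    have t3 : KGraph.mu n k D ≤ 100 / 99 * (F / B) := by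
      rw [KGraph.mu, ← mul_div_assoc]
      exact div_le_div_of_nonneg_right (by linarith) hB.le
    have t4 : 80 * ((k : ℝ) ^ 2 * (3 * x) ^ 2) + 4 / (x * D) ^ 2 ≤ 721 * (k ^ 2 * x ^ 2) := by
      linarith
    calc _ ≤ 721 * (k ^ 2 * x ^ 2) * (100 / 99 * (F / B)) :=
          mul_le_mul t4 t3 (div_pos hD0 hB).le (by positivity)
      _ ≤ _ := by
          have : 0 ≤ k ^ 2 * x ^ 2 * (F / B) := by positivity
          linarith
  · have := hap0.ne'
    field_simp
    ring
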